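/- Let $q=s^2$ be a prime power that is a square, and let $q+\delta$ be the size of the smallest non-trivial blocking set in $\mathrm{PG}(2,q)$ that contains no Baer subplane. Here a blocking set is a set of points meeting every line, it is non-trivial if it contains no line, and a Baer subgeometry of $\mathrm{PG}(n,q)$ (a Baer subplane if $n=2$) is the set of points that have coordinates in $\mathbb F_{\sqrt q}$ with respect to some basis of $\mathbb F_q^{\,n+1}$. Let $Q^+(5,q)$ be the Klein quadric $X_0X_5+X_1X_4+X_2X_3=0$ in $\mathrm{PG}(5,q)$; its generators are the planes of $\mathrm{PG}(5,q)$ contained in it. A set $\mathcal L$ of generators, with characteristic function $\chi$, is a Cameron-Liebler set with parameter $x$ if for every generator $\pi$ the number of elements of $\mathcal L$ disjoint from $\pi$ equals $(x-\chi(\pi))q$. A point-pencil is the set of all generators through a point of $Q^+(5,q)$. A set of generators is of Baer subgeometry type if, for some Baer subgeometry $\Sigma\cong\mathrm{PG}(3,\sqrt q)$ of $\mathrm{PG}(3,q)$, it consists of the generators that correspond under the Klein correspondence, i.e. through the Plücker coordinates $(p_{01},p_{02},p_{03},p_{12},p_{31},p_{23})$ of lines, to the points $P$ of $\Sigma$ (all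 lines through $P$) and to the planes $\pi$ of $\Sigma$, i.e. the planes of $\mathrm{PG}(3,q)$ spanned by points of $\Sigma$ (all lines in $\pi$). Then every Cameron-Liebler set $\mathcal L$ of generators of the Klein quadric with parameter $x<\delta$ is a union of pairwise disjoint sets, each of which is a point-pencil or a set of Baer subgeometry type, the latter being a Cameron-Liebler set with parameter $\sqrt q+1$. -/

import Mathlib

namespace KleinCL

variable {F : Type*} [Field F]

/-- The points of `PG(n-1, F)`. -/
abbrev Pt (F : Type*) [Field F] (n : ℕ) : Type _ := Projectivization F (Fin n → F)

/-! ### Baer subgeometries and blocking sets -/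

/-- `S` is the point set of a Baer subgeometry of `PG(n-1, F)` : the points that have coordinates
in the subfield of order `√|F|` with respect to some basis of `Fⁿ`. For `n = 3` these are the Baer
subplanes of `PG(2, F)`, for `n = 4` the Baer subgeometries `PG(3, √q)` of `PG(3, q)`. -/
def IsBaerSubgeometry {n : ℕ} (S : Set (Pt F n)) : Prop :=
  ∃ K : Subfield F, Nat.card K ^ 2 = Nat.card F ∧
    ∃ b : Module.Basis (Fin n) F (Fin n → F),
      S = {P | ∃ c : Fin n → K, c ≠ 0 ∧ P.submodule = Submodule.span F {∑ i, (c i : F) • b i}}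

/-- A blocking set of `PG(2, F)` : a set of points meeting every line. -/
def IsBlockingSet (B : Set (Pt F 3)) : Prop :=
  ∀ l : Submodule F (Fin 3 → F), Module.finrank F l = 2 → ∃ P ∈ B, P.submodule ≤ l

/-- A non-trivial blocking set: one that contains no line. -/
def IsNontrivialBlockingSet (B : Set (Pt F 3)) : Prop :=
  IsBlockingSet B ∧
    ¬ ∃ l : Submodule F (Fin 3 → F), Module.finrank F l = 2 ∧ ∀ P : Pt F 3, P.submodule ≤ l → P ∈ B

/-- `B` contains a Baer subplane. -/
def ContainsBaerSubplane (B : Set (Pt F 3)) : Prop :=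
  ∃ S : Set (Pt F 3), IsBaerSubgeometry S ∧ S ⊆ B

/-! ### The Klein quadric -/

/-- The quadratic form of the Klein quadric `X₀X₅ + X₁X₄ + X₂X₃ = 0` in `PG(5, F)`. -/
def kleinForm (v : Fin 6 → F) : F := v 0 * v 5 + v 1 * v 4 + v 2 * v 3

/-- The generators of the Klein quadric: the planes of `PG(5, F)` (vector dimension 3) contained
in the quadric. -/
def IsGenerator (G : Submodule F (Fin 6 → F)) : Prop :=
  Module.finrank F G = 3 ∧ ∀ v ∈ G, kleinForm v = 0

/-- `L` is a Cameron-Liebler set of generators of the Klein quadric with parameter `x` : for every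
generator `G`, the number of elements of `L` disjoint from `G` is `(x - χ_L(G)) q`. -/
def IsCameronLiebler (L : Set (Submodule F (Fin 6 → F))) (x : ℝ) : Prop :=
  (∀ G ∈ L, IsGenerator G) ∧
    ∀ G : Submodule F (Fin 6 → F), IsGenerator G →
      (({H | H ∈ L ∧ Disjoint H G}.ncard : ℕ) : ℝ) =
        (x - L.indicator (fun _ => (1 : ℝ)) G) * (Nat.card F : ℝ)

/-- A point-pencil: all the generators through a point of the Klein quadric. -/
def IsPointPencil (C : Set (Submodule F (Fin 6 → F))) : Prop :=
  ∃ P : Pt F 6, (∀ v ∈ P.submodule, kleinForm v = 0) ∧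
    C = {G | IsGenerator G ∧ P.submodule ≤ G}

/-! ### The Klein correspondence -/

/-- The Plücker coordinates `(p₀₁, p₀₂, p₀₃, p₁₂, p₃₁, p₂₃)` of the line spanned by `u` and `v`. -/
def plucker (u v : Fin 4 → F) : Fin 6 → F :=
  ![u 0 * v 1 - u 1 * v 0, u 0 * v 2 - u 2 * v 0, u 0 * v 3 - u 3 * v 0,
    u 1 * v 2 - u 2 * v 1, u 3 * v 1 - u 1 * v 3, u 2 * v 3 - u 3 * v 2]

/-- The Latin plane of a point `P` of `PG(3, F)` : the plane of the Klein quadric formed by the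
lines through `P`. -/
def latin (P : Pt F 4) : Submodule F (Fin 6 → F) :=
  Submodule.span F {p | ∃ u ∈ P.submodule, ∃ v : Fin 4 → F, p = plucker u v}

/-- The Greek plane of a plane `W` of `PG(3, F)` : the plane of the Klein quadric formed by the
lines in `W`. -/
def greek (W : Submodule F (Fin 4 → F)) : Submodule F (Fin 6 → F) :=
  Submodule.span F {p | ∃ u ∈ W, ∃ v ∈ W, p = plucker u v}

/-- The plane `W` of `PG(3, F)` is a plane of the subgeometry `S`, that is, it is spanned by points
of `S`. -/
def IsPlaneOf (S : Set (Pt F 4)) (W : Submodule F (Fin 4 → F)) : Prop :=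
  Module.finrank F W = 3 ∧ W = ⨆ P ∈ {P : Pt F 4 | P ∈ S ∧ P.submodule ≤ W}, P.submodule

/-- The sets of Baer subgeometry type: the generators that correspond to the points and the planes
of a Baer subgeometry `PG(3, √q)` of `PG(3, q)`. -/
def IsBaerType (C : Set (Submodule F (Fin 6 → F))) : Prop :=
  ∃ S : Set (Pt F 4), IsBaerSubgeometry S ∧
    C = {G | (∃ P ∈ S, G = latin P) ∨ ∃ W, IsPlaneOf S W ∧ G = greek W}

end KleinCL

set_option autoImplicit false
set_option linter.unusedSectionVars false

/-! Write s = √q. Under the Klein correspondence a set of generators is a pair (A, B): A holds the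
points whose Latin plane is in the set, B the planes whose Greek plane is, a plane being coded by
the point orthogonal to it for the dot product. Generators of the same kind always meet, and a Latin
and a Greek plane are disjoint exactly when point and plane are not incident. So the Cameron-Liebler
condition is a self-dual condition on (A, B) (`isCameronLiebler_iff`). Double counting non-incident
pairs (`CLPair.count`) shows that a line has as many points in A as planes in B through it, and that
a plane has x + q points of A if it is in B, and x otherwise.

Hence A meets each plane of B in a blocking set of size x + q. If A contains a line, the set
contains the corresponding point-pencil. Otherwise the blocking set is non-trivial and, as x < δ,
contains a Baer subplane; dually for the planes of B through a point of A. An explicit blocking set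
(`crossSet`) gives δ ≤ q + 1, so x ≤ q, and at most q - s - 1 points of a section lie outside its
Baer subplane (`BaerPair.ncard_extra`).

This bound glues the Baer subplanes together. The extra points are too few to block the q - s
non-secants through a point of the Baer subplane, so there is a tangent line; it shows that p is in
the Baer subplane of w only if w is in the dual one of p (`BaerPair.mutual`). They are too few to
fill s - 1 lines through p, so the two Baer subplanes induce the same Baer subline of lines through
p (`BaerPair.transfer`). They are too few to meet all secants, so some secant is clean
(`BaerPair.exists_clean`). Two planes of B on a clean secant then have Baer subplanes that agree on
it (`BaerPair.exists_frame`), and the four basis vectors define a subgeometry PG(3, s). Its planes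
are in B by intersecting Baer sublines of dual Baer subplanes (`BaerFrame.mem_of_coords`), and its
points are in A because too many planes of B pass through them (`BaerPair.exists_baer`).

A subgeometry gives a Cameron-Liebler set with parameter s + 1, a line one with parameter 1.
Removing such a subset leaves a Cameron-Liebler set whose parameter is no larger, and induction on
the size finishes the proof. -/

namespace KleinCL

open Module Projectivization
open scoped Matrix LinearAlgebra.Projectivization

variable {F : Type*} [Field F]

section

/-! ### Points of a subspace over a subfield -/

section SubPoints

variable {K E : Type*} [Field K] [Algebra K F] [AddCommGroup E] [Module F E] [Module K E]
  [IsScalarTower K F E]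

/-- The points of `ℙ F E` represented by vectors of a `K`-subspace `Λ`. -/
def subPts (Λ : Submodule K E) : Set (ℙ F E) := {P | ∃ v ∈ Λ, ∃ h : v ≠ 0, P = mk F v h}

/-- `F`-proportional vectors of `Λ` are `K`-proportional. -/
def IsScalarClosed (F : Type*) {K E : Type*} [Field F] [Field K] [Algebra K F] [AddCommGroup E]
    [Module F E] [Module K E] (Λ : Submodule K E) : Prop :=
  ∀ v ∈ Λ, v ≠ 0 → ∀ a : F, a • v ∈ Λ → ∃ k : K, algebraMap K F k = a

theorem IsScalarClosed.mono {Λ Λ' : Submodule K E} (h : IsScalarClosed F Λ) (hle : Λ' ≤ Λ) :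
    IsScalarClosed F Λ' := fun v hv h0 a ha => h v (hle hv) h0 a (hle ha)

theorem mk_mem_subPts {Λ : Submodule K E} {v : E} (hv : v ≠ 0) :
    mk F v hv ∈ subPts (F := F) Λ ↔ ∃ a : F, a ≠ 0 ∧ a • v ∈ Λ := by
  constructor
  · rintro ⟨w, hw, hw0, h⟩
    obtain ⟨a, ha⟩ := (mk_eq_mk_iff' F _ _ hw0 hv).1 h.symm
    refine ⟨a, ?_, ha ▸ hw⟩
    rintro rfl
    exact hw0 (by simpa using ha.symm)
  · rintro ⟨a, ha, h⟩
    exact ⟨a • v, h, smul_ne_zero ha hv, ((mk_eq_mk_iff' F _ _ _ hv).2 ⟨a, rfl⟩).symm⟩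

/-- Scalar-closedness makes the map from the projective space of `Λ` over `K` to points over `F`
injective, so the count is that of a projective space over `K`. -/
theorem ncard_subPts [Finite K] {Λ : Submodule K E} (h : IsScalarClosed F Λ) {n : ℕ}
    (hn : finrank K Λ = n) :
    (subPts (F := F) Λ).ncard = ∑ i ∈ Finset.range n, Nat.card K ^ i := by
  rw [← card_of_finrank K Λ hn, ← Nat.card_coe_set_eq]
  symm
  have h0 : ∀ v : Λ, v ≠ 0 → (v : E) ≠ 0 := fun v hv h => hv (Subtype.ext h)
  let f : ℙ K Λ → subPts (F := F) Λ := fun P =>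
    ⟨mk F (P.rep : E) (h0 _ P.rep_nonzero), P.rep, P.rep.2, h0 _ P.rep_nonzero, rfl⟩
  refine Nat.card_congr (Equiv.ofBijective f ⟨?_, ?_⟩)
  · intro P Q hPQ
    have := congrArg Subtype.val hPQ
    simp only [f] at this
    obtain ⟨a, ha⟩ := (mk_eq_mk_iff' F _ _ _ _).1 this
    obtain ⟨k, rfl⟩ := h _ Q.rep.2 (h0 _ Q.rep_nonzero) a (ha ▸ P.rep.2)
    rw [← mk_rep P, ← mk_rep Q, mk_eq_mk_iff']
    exact ⟨k, Subtype.ext (by simpa using ha)⟩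
  · rintro ⟨_, v, hv, hv0, rfl⟩
    refine ⟨mk K ⟨v, hv⟩ (fun h => hv0 (congrArg Subtype.val h)), Subtype.ext ?_⟩
    simp only [f]
    obtain ⟨a, ha⟩ := exists_smul_eq_mk_rep K (⟨v, hv⟩ : Λ) (fun h => hv0 (congrArg Subtype.val h))
    rw [mk_eq_mk_iff']
    refine ⟨algebraMap K F a, ?_⟩
    rw [← ha]
    simp [Units.smul_def]

theorem isScalarClosed_self (N : Submodule F E) : IsScalarClosed F N :=
  fun _ _ _ a _ => ⟨a, rfl⟩

end SubPoints

/-- The points of a subspace. -/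
def pts {E : Type*} [AddCommGroup E] [Module F E] (N : Submodule F E) : Set (ℙ F E) :=
  {P | P.submodule ≤ N}

section Pts

variable {E : Type*} [AddCommGroup E] [Module F E]

@[simp] theorem mk_mem_pts {N : Submodule F E} {v : E} (hv : v ≠ 0) :
    mk F v hv ∈ pts N ↔ v ∈ N := by
  simp [pts, submodule_mk, Submodule.span_singleton_le_iff_mem]

theorem mem_pts_rep {N : Submodule F E} {P : ℙ F E} : P ∈ pts N ↔ P.rep ∈ N := by
  conv_lhs => rw [← mk_rep P]
  exact mk_mem_pts _

theorem pts_eq_subPts (N : Submodule F E) : pts N = subPts (F := F) N := by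
  ext P
  induction P using Projectivization.ind with | h v hv => ?_
  rw [mk_mem_pts, mk_mem_subPts]
  exact ⟨fun h => ⟨1, one_ne_zero, by simpa using h⟩,
    fun ⟨a, ha, h⟩ => (Submodule.smul_mem_iff N ha).1 h⟩

theorem ncard_pts [Finite F] {N : Submodule F E} {n : ℕ} (hn : finrank F N = n) :
    (pts N).ncard = ∑ i ∈ Finset.range n, Nat.card F ^ i := by
  rw [pts_eq_subPts]
  exact ncard_subPts (isScalarClosed_self N) hn

theorem pts_mono {N N' : Submodule F E} (h : N ≤ N') : pts N ⊆ pts N' := fun _ hP => le_trans hP h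

theorem pts_inf (N N' : Submodule F E) : pts (N ⊓ N') = pts N ∩ pts N' := by
  ext P; simp [pts]

end Pts

/-! ### Orthogonal subspaces for the dot product -/

section Perp

variable {n : ℕ}

/-- The dot product as a bilinear form. -/
def dotForm : LinearMap.BilinForm F (Fin n → F) := dotProductBilin F F

theorem dotForm_apply (v w : Fin n → F) : dotForm v w = v ⬝ᵥ w := rfl

/-- The orthogonal complement for the dot product. -/
def perp (N : Submodule F (Fin n → F)) : Submodule F (Fin n → F) := dotForm.orthogonal N

theorem mem_perp {N : Submodule F (Fin n → F)} {v : Fin n → F} :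
    v ∈ perp N ↔ ∀ u ∈ N, u ⬝ᵥ v = 0 := Iff.rfl

theorem dotForm_isRefl : (dotForm (F := F) (n := n)).IsRefl := fun v w h => by
  rw [dotForm_apply] at *
  rwa [dotProduct_comm]

theorem dotForm_nondegenerate : (dotForm (F := F) (n := n)).Nondegenerate := by
  refine ⟨fun v h => dotProduct_eq_zero v h, fun v h => dotProduct_eq_zero v fun w => ?_⟩
  rw [dotProduct_comm]
  exact h w

theorem finrank_perp (N : Submodule F (Fin n → F)) : finrank F (perp N) = n - finrank F N := by
  rw [perp, LinearMap.BilinForm.finrank_orthogonal dotForm_nondegenerate, finrank_fin_fun]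

theorem perp_perp (N : Submodule F (Fin n → F)) : perp (perp N) = N :=
  LinearMap.BilinForm.orthogonal_orthogonal dotForm_nondegenerate dotForm_isRefl N

theorem le_perp_comm {M N : Submodule F (Fin n → F)} : M ≤ perp N ↔ N ≤ perp M := by
  constructor <;> exact fun h u hu => mem_perp.2 fun v hv => by
    rw [dotProduct_comm]
    exact mem_perp.1 (h hv) u hu

theorem mem_perp_span_singleton {v w : Fin n → F} : w ∈ perp (F ∙ v) ↔ v ⬝ᵥ w = 0 := by
  rw [mem_perp]
  constructor
  · exact fun h => h v (Submodule.mem_span_singleton_self v)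
  · intro h u hu
    obtain ⟨a, rfl⟩ := Submodule.mem_span_singleton.1 hu
    simp [h]

theorem orthogonal_iff_mem_pts {P Q : Pt F n} : orthogonal P Q ↔ Q ∈ pts (perp P.submodule) := by
  induction P using Projectivization.ind with | h v hv => ?_
  induction Q using Projectivization.ind with | h w hw => ?_
  rw [orthogonal_mk, mk_mem_pts, submodule_mk, mem_perp_span_singleton]

theorem mem_pts_perp_comm {P Q : Pt F n} :
    Q ∈ pts (perp P.submodule) ↔ P ∈ pts (perp Q.submodule) := by
  rw [← orthogonal_iff_mem_pts, orthogonal_comm, orthogonal_iff_mem_pts]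

/-- The intersection is the kernel of a linear form on `N`, which is non-zero because `P` is not
orthogonal to all of `N`. -/
theorem finrank_inf_perp_pt {N : Submodule F (Fin n → F)} {P : Pt F n}
    (h : ¬ P ∈ pts (perp N)) :
    finrank F ↥(N ⊓ perp P.submodule) + 1 = finrank F N := by
  induction P using Projectivization.ind with | h v hv => ?_
  rw [mk_mem_pts] at h
  rw [submodule_mk]
  let f : N →ₗ[F] F := (dotForm v).comp N.subtype
  have hf : LinearMap.range f = ⊤ := by
    rw [LinearMap.range_eq_top]
    refine LinearMap.surjective fun h0 => h fun u hu => ?_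
    have := LinearMap.congr_fun h0 ⟨u, hu⟩
    simpa [f, dotForm_apply, dotProduct_comm] using this
  have h1 := LinearMap.finrank_range_add_finrank_ker f
  rw [hf, finrank_top, finrank_self] at h1
  have h2 : N ⊓ perp (F ∙ v) = (LinearMap.ker f).map N.subtype := by
    ext u
    simp only [Submodule.mem_inf, mem_perp_span_singleton, Submodule.mem_map, LinearMap.mem_ker]
    constructor
    · rintro ⟨h3, h4⟩
      exact ⟨⟨u, h3⟩, h4, rfl⟩
    · rintro ⟨u, h3, rfl⟩
      exact ⟨u.2, h3⟩
  rw [h2, Submodule.finrank_map_subtype_eq]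
  omega

end Perp

end

section

/-! ### Pairs of a point set and a plane set with the Cameron-Liebler property -/

/-- The Cameron-Liebler property for a set `A` of points and a set `B` of planes of `PG(3, F)`,
where the point `w` stands for the plane orthogonal to it. -/
structure CLPair (A B : Set (Pt F 4)) (x : ℝ) : Prop where
  off_plane : ∀ w : Pt F 4, (({P | P ∈ A ∧ ¬ orthogonal P w}.ncard : ℕ) : ℝ) =
    (x - B.indicator (fun _ => (1 : ℝ)) w) * (Nat.card F : ℝ)
  off_point : ∀ p : Pt F 4, (({W | W ∈ B ∧ ¬ orthogonal W p}.ncard : ℕ) : ℝ) =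
    (x - A.indicator (fun _ => (1 : ℝ)) p) * (Nat.card F : ℝ)

theorem CLPair.swap {A B : Set (Pt F 4)} {x : ℝ} (h : CLPair A B x) : CLPair B A x :=
  ⟨h.off_point, h.off_plane⟩

/-! ### Double counting of non-incident point-plane pairs -/

section Counting

variable [Finite F]

instance : Finite (Pt F 4) := Projectivization.finite_of_finite F _

-- A hyperplane leaves an affine space of dimension `d` in `N`, or nothing if it contains `N`. The
-- additive form avoids truncated subtraction.
open Classical in
theorem ncard_off {n d : ℕ} {N : Submodule F (Fin n → F)} (hN : finrank F N = d + 1) (P : Pt F n) :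
    {Q | Q ∈ pts N ∧ ¬ orthogonal P Q}.ncard + (if P ∈ pts (perp N) then Nat.card F ^ d else 0)
      = Nat.card F ^ d := by
  have h1 : {Q | Q ∈ pts N ∧ ¬ orthogonal P Q} = pts N \ pts (N ⊓ perp P.submodule) := by
    ext Q
    simp only [Set.mem_ofPred_eq, orthogonal_iff_mem_pts, pts_inf, Set.mem_sdiff, Set.mem_inter_iff]
    tauto
  rw [h1, Set.ncard_sdiff (pts_mono inf_le_left) (Set.toFinite _), ncard_pts hN]
  split_ifs with h
  · have : N ⊓ perp P.submodule = N := inf_eq_left.2 (le_perp_comm.1 h)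
    rw [this, ncard_pts hN]
    simp
  · have := finrank_inf_perp_pt h
    rw [ncard_pts (n := d) (by omega), Finset.sum_range_succ]
    simp

/-- Both sides count the non-orthogonal pairs of a point of `A` and a point of `N`: by `off_plane`
for each point of `N` on the left, by `ncard_off` for each point of `A` on the right. -/
theorem CLPair.count {A B : Set (Pt F 4)} {x : ℝ} (h : CLPair A B x) {d : ℕ}
    {N : Submodule F (Fin 4 → F)} (hN : finrank F N = d + 1) :
    (Nat.card F : ℝ) * (x * ∑ i ∈ Finset.range (d + 1), (Nat.card F : ℝ) ^ i - (B ∩ pts N).ncard) =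
      (Nat.card F : ℝ) ^ d * (A.ncard - (A ∩ pts (perp N)).ncard) := by
  classical
  have := Fintype.ofFinite (Pt F 4)
  have key := Finset.sum_card_bipartiteAbove_eq_sum_card_bipartiteBelow
    (s := A.toFinset) (t := (pts N).toFinset) (fun P Q => ¬ orthogonal P Q)
  have h1 : ∀ P ∈ A.toFinset, ((((pts N).toFinset.bipartiteAbove
      (fun P Q => ¬ orthogonal P Q) P).card : ℕ) : ℝ) =
      (Nat.card F : ℝ) ^ d - (if P ∈ pts (perp N) then (Nat.card F : ℝ) ^ d else 0) := by
    intro P _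
    have e : ((_ : ℕ) : ℝ) = _ := congrArg Nat.cast (ncard_off hN P)
    push_cast at e
    rw [eq_sub_iff_add_eq]
    refine Eq.trans ?_ e
    rw [← Set.ncard_coe_finset, Finset.coe_bipartiteAbove]
    simp only [Set.mem_toFinset]
  have h2 : ∀ Q ∈ (pts N).toFinset, (((A.toFinset.bipartiteBelow
      (fun P Q => ¬ orthogonal P Q) Q).card : ℕ) : ℝ) =
      x * (Nat.card F : ℝ) - if Q ∈ B then (Nat.card F : ℝ) else 0 := by
    intro Q _
    rw [← Set.ncard_coe_finset, Finset.coe_bipartiteBelow]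
    have := h.off_plane Q
    simp only [Set.mem_toFinset]
    rw [this, Set.indicator_apply]
    split_ifs <;> ring
  have key' : ((∑ P ∈ A.toFinset, ((pts N).toFinset.bipartiteAbove
      (fun P Q => ¬ orthogonal P Q) P).card : ℕ) : ℝ) = _ := congrArg _ key
  rw [Nat.cast_sum, Nat.cast_sum, Finset.sum_congr rfl h1, Finset.sum_congr rfl h2,
    Finset.sum_sub_distrib, Finset.sum_sub_distrib, ← Finset.sum_filter, ← Finset.sum_filter,
    Finset.sum_const, Finset.sum_const, Finset.sum_const, Finset.sum_const,
    ← Set.ncard_coe_finset, ← Set.ncard_coe_finset, ← Set.ncard_coe_finset,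
    ← Set.ncard_coe_finset] at key'
  simp only [Finset.coe_filter, Set.mem_toFinset, Set.coe_toFinset, ncard_pts hN,
    nsmul_eq_mul] at key'
  have e1 : {a | a ∈ A ∧ a ∈ pts (perp N)} = A ∩ pts (perp N) := rfl
  have e2 : {a | a ∈ pts N ∧ a ∈ B} = B ∩ pts N := Set.inter_comm _ _
  rw [e1, e2] at key'
  push_cast at key'
  linarith

theorem card_pos_real : (0 : ℝ) < Nat.card F := by exact_mod_cast Nat.card_pos

theorem one_lt_card_real : (1 : ℝ) < Nat.card F := by exact_mod_cast Finite.one_lt_card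

theorem perp_top {n : ℕ} : perp (⊤ : Submodule F (Fin n → F)) = ⊥ := by
  rw [← Submodule.finrank_eq_zero (R := F), finrank_perp, finrank_top, finrank_fin_fun, Nat.sub_self]

/-- The count over the whole space, once for `A` and once for `B`, forces equal sizes and then
determines them. -/
theorem CLPair.ncard_eq {A B : Set (Pt F 4)} {x : ℝ} (h : CLPair A B x) :
    (A.ncard : ℝ) = x * (Nat.card F + 1) := by
  have h0 := card_pos_real (F := F)
  have h0' := one_lt_card_real (F := F)
  have hb : ∀ C : Set (Pt F 4), C ∩ pts ⊥ = ∅ := fun C => by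
    ext P
    simp only [Set.mem_inter_iff, Set.mem_empty_iff_false, iff_false, not_and, mem_pts_rep,
      Submodule.mem_bot]
    exact fun _ => P.rep_nonzero
  have ht : ∀ C : Set (Pt F 4), C ∩ pts ⊤ = C := fun C => by
    ext P
    simp [pts]
  have h4 : finrank F (⊤ : Submodule F (Fin 4 → F)) = 3 + 1 := by simp
  have h1 := h.count h4
  have h2 := h.swap.count h4
  rw [perp_top, ht, hb, Set.ncard_empty] at h1 h2
  simp only [Finset.sum_range_succ, Finset.sum_range_zero, Nat.cast_zero] at h1 h2
  set q : ℝ := (Nat.card F : ℝ)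
  have h3 : ((A.ncard : ℝ) - B.ncard) * (q * (q ^ 2 - 1)) = 0 := by linear_combination h2 - h1
  have h5 : q * (q ^ 2 - 1) ≠ 0 := by
    have : 0 < q ^ 2 - 1 := by nlinarith
    positivity
  have h6 : (A.ncard : ℝ) - B.ncard = 0 := (mul_eq_zero.1 h3).resolve_right h5
  have h7 : q * (q ^ 2 + 1) ≠ 0 := by positivity
  apply mul_left_cancel₀ h7
  linear_combination h6 * q - h1

/-- In `CLPair.count` for the line `perp M` the exponent is `d = 1`, so the factors q cancel. -/
theorem CLPair.ncard_line {A B : Set (Pt F 4)} {x : ℝ} (h : CLPair A B x)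
    {M : Submodule F (Fin 4 → F)} (hM : finrank F M = 2) :
    (A ∩ pts M).ncard = (B ∩ pts (perp M)).ncard := by
  have hM' : finrank F (perp M) = 1 + 1 := by rw [finrank_perp, hM]
  have h0 := card_pos_real (F := F)
  have h1 := h.count hM'
  rw [perp_perp, h.ncard_eq] at h1
  simp only [Finset.sum_range_succ, Finset.sum_range_zero] at h1
  have : ((A ∩ pts M).ncard : ℝ) = (B ∩ pts (perp M)).ncard := by
    apply mul_left_cancel₀ h0.ne'
    linear_combination h1
  exact_mod_cast this

theorem CLPair.ncard_plane {A B : Set (Pt F 4)} {x : ℝ} (h : CLPair A B x) (w : Pt F 4) :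
    ((A ∩ pts (perp w.submodule)).ncard : ℝ) =
      x + B.indicator (fun _ => (1 : ℝ)) w * (Nat.card F : ℝ) := by
  have h1 := h.off_plane w
  have h2 : {P | P ∈ A ∧ ¬ orthogonal P w} = A \ (A ∩ pts (perp w.submodule)) := by
    ext P
    simp only [Set.mem_ofPred_eq, orthogonal_iff_mem_pts, mem_pts_perp_comm (Q := w), Set.mem_sdiff,
      Set.mem_inter_iff]
    tauto
  rw [h2, Set.cast_ncard_sdiff Set.inter_subset_left (Set.toFinite _), h.ncard_eq] at h1
  linarith

end Counting

end

section

theorem finrank_pair {E : Type*} [AddCommGroup E] [Module F E] {x y : E}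
    (h : LinearIndependent F ![x, y]) : finrank F (Submodule.span F {x, y}) = 2 := by
  have hr : Set.range ![x, y] = {x, y} := by
    simp [Matrix.range_cons, Set.pair_comm]
  rw [← hr, finrank_span_eq_card h, Fintype.card_fin]

/-! ### Baer subspaces: spans over a subfield -/

section BaerSpan

variable {K E : Type*} [Field K] [Algebra K F] [AddCommGroup E] [Module F E] [Module K E]
  [IsScalarTower K F E]

/-- `Λ` is the `K`-span of `F`-independent vectors `x`, `y`, `z`. -/
structure IsTriple (F : Type*) {K E : Type*} [Field F] [Field K] [Algebra K F] [AddCommGroup E]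
    [Module F E] [Module K E] (Λ : Submodule K E) (x y z : E) : Prop where
  indep : LinearIndependent F ![x, y, z]
  span_eq : Λ = Submodule.span K {x, y, z}

theorem IsTriple.mem_left {Λ : Submodule K E} {x y z : E} (h : IsTriple F Λ x y z) : x ∈ Λ :=
  h.span_eq ▸ Submodule.subset_span (by simp)

theorem IsTriple.mem_mid {Λ : Submodule K E} {x y z : E} (h : IsTriple F Λ x y z) : y ∈ Λ :=
  h.span_eq ▸ Submodule.subset_span (by simp)

theorem IsTriple.mem_right {Λ : Submodule K E} {x y z : E} (h : IsTriple F Λ x y z) : z ∈ Λ :=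
  h.span_eq ▸ Submodule.subset_span (by simp)

theorem IsTriple.exists_coords {Λ : Submodule K E} {x y z : E} (h : IsTriple F Λ x y z) {v : E}
    (hv : v ∈ Λ) : ∃ a b c : K, v = a • x + b • y + c • z := by
  rw [h.span_eq, Submodule.mem_span_insert] at hv
  obtain ⟨a, u, hu, rfl⟩ := hv
  obtain ⟨b, c, rfl⟩ := Submodule.mem_span_pair.1 hu
  exact ⟨a, b, c, by rw [add_assoc]⟩

theorem combo_eq_zero {x y z : E} (h : LinearIndependent F ![x, y, z]) {a b c : F}
    (h0 : a • x + b • y + c • z = 0) : a = 0 ∧ b = 0 ∧ c = 0 := by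
  have := Fintype.linearIndependent_iff.1 h ![a, b, c] (by
    simpa [Fin.sum_univ_three] using h0)
  exact ⟨this 0, this 1, this 2⟩

/-- Coordinates over `F` are unique, so those of a vector of `Λ` are the ones it has over `K`. -/
theorem IsTriple.coords_mem {Λ : Submodule K E} {x y z : E} (h : IsTriple F Λ x y z) {a b c : F}
    (hv : a • x + b • y + c • z ∈ Λ) :
    ∃ a' b' c' : K, algebraMap K F a' = a ∧ algebraMap K F b' = b ∧ algebraMap K F c' = c := by
  obtain ⟨a', b', c', h'⟩ := h.exists_coords hv
  refine ⟨a', b', c', ?_⟩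
  have h0 : (algebraMap K F a' - a) • x + (algebraMap K F b' - b) • y
      + (algebraMap K F c' - c) • z = 0 := by
    simp only [sub_smul, algebraMap_smul]
    rw [← neg_eq_zero, ← sub_eq_zero.2 h']
    abel
  obtain ⟨h1, h2, h3⟩ := combo_eq_zero h.indep h0
  exact ⟨sub_eq_zero.1 h1, sub_eq_zero.1 h2, sub_eq_zero.1 h3⟩

theorem IsTriple.isScalarClosed {Λ : Submodule K E} {x y z : E} (h : IsTriple F Λ x y z) :
    IsScalarClosed F Λ := by
  intro v hv hv0 a ha
  obtain ⟨k, l, m, rfl⟩ := h.exists_coords hv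
  have e : a • (k • x + l • y + m • z) = (a * algebraMap K F k) • x + (a * algebraMap K F l) • y
      + (a * algebraMap K F m) • z := by
    simp only [smul_add, mul_smul, algebraMap_smul]
  rw [e] at ha
  obtain ⟨a', b', c', h1, h2, h3⟩ := h.coords_mem ha
  have key : ∀ k a' : K, algebraMap K F a' = a * algebraMap K F k → k ≠ 0 →
      ∃ k, algebraMap K F k = a := by
    intro k a' h1 hk
    refine ⟨a' / k, ?_⟩
    have : algebraMap K F k ≠ 0 := (map_ne_zero _).2 hk
    rw [map_div₀, h1, mul_div_cancel_right₀ _ this]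
  by_cases hk : k = 0
  · by_cases hl : l = 0
    · by_cases hm : m = 0
      · simp [hk, hl, hm] at hv0
      · exact key m c' h3 hm
    · exact key l b' h2 hl
  · exact key k a' h1 hk

theorem range_vec3 {α : Type*} (x y z : α) : Set.range ![x, y, z] = {x, y, z} := by
  ext; simp [eq_comm]; tauto

theorem IsTriple.finrank_eq {Λ : Submodule K E} {x y z : E} (h : IsTriple F Λ x y z) :
    finrank K Λ = 3 := by
  have h1 : LinearIndependent K ![x, y, z] := by
    refine LinearIndependent.restrict_scalars (K := F) (fun a b hab => ?_) h.indep
    simpa [Algebra.smul_def] using hab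
  rw [h.span_eq, ← range_vec3, finrank_span_eq_card h1, Fintype.card_fin]

/-- A `K`-independent triple in a Baer subspace of rank 3 is a basis of it over `K`, and
independent over `F`. -/
theorem IsTriple.of_indep {Λ : Submodule K E} {x y z : E} (h : IsTriple F Λ x y z)
    {x' y' z' : E} (hx : x' ∈ Λ) (hy : y' ∈ Λ) (hz : z' ∈ Λ)
    (hi : LinearIndependent K ![x', y', z']) : IsTriple F Λ x' y' z' := by
  have hle : Submodule.span K {x', y', z'} ≤ Λ := by
    rw [Submodule.span_le]
    rintro v (rfl | rfl | rfl) <;> assumption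
  have : FiniteDimensional K Λ := FiniteDimensional.of_finrank_pos (by rw [h.finrank_eq]; norm_num)
  have heq : Λ = Submodule.span K {x', y', z'} := by
    refine (Submodule.eq_of_le_of_finrank_eq hle ?_).symm
    rw [h.finrank_eq, ← range_vec3, finrank_span_eq_card hi, Fintype.card_fin]
  refine ⟨?_, heq⟩
  -- Independence over `F` is a matter of dimension: the `F`-span of the new triple contains the old
  -- triple, so it has rank 3.
  have hsub : ∀ v ∈ Λ, v ∈ Submodule.span F {x', y', z'} := by
    intro v hv
    rw [heq] at hv
    exact Submodule.span_le_restrictScalars K F _ hv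
  rw [linearIndependent_iff_card_le_finrank_span, Fintype.card_fin, Set.finrank, range_vec3]
  calc 3 = finrank F (Submodule.span F {x, y, z}) := by
        rw [← range_vec3, finrank_span_eq_card h.indep, Fintype.card_fin]
    _ ≤ _ := by
        have : FiniteDimensional F (Submodule.span F {x', y', z'}) :=
          FiniteDimensional.span_of_finite F (by simp)
        apply Submodule.finrank_mono
        rw [Submodule.span_le]
        rintro v (rfl | rfl | rfl)
        exacts [hsub _ h.mem_left, hsub _ h.mem_mid, hsub _ h.mem_right]

theorem indep_of_snoc {Λ : Submodule K E} {a b c : Λ}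
    (h : LinearIndependent K (Fin.snoc (α := fun _ => Λ) ![a, b] c)) :
    LinearIndependent K ![(a : E), b, c] := by
  have e : ![(a : E), b, c] = Λ.subtype ∘ Fin.snoc (α := fun _ => Λ) ![a, b] c := by
    ext i
    fin_cases i <;> rfl
  rw [e]
  exact h.map' Λ.subtype (Submodule.ker_subtype Λ)

theorem IsTriple.exists_of_mem {Λ : Submodule K E} {x y z : E} (h : IsTriple F Λ x y z)
    {x' : E} (hx : x' ∈ Λ) (hx0 : x' ≠ 0) : ∃ y' z', IsTriple F Λ x' y' z' := by
  have h0 : (⟨x', hx⟩ : Λ) ≠ 0 := fun h => hx0 (congrArg Subtype.val h)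
  have : FiniteDimensional K Λ := FiniteDimensional.of_finrank_pos (by rw [h.finrank_eq]; norm_num)
  obtain ⟨y', hy'⟩ := exists_linearIndependent_pair_of_one_lt_finrank
    (by rw [h.finrank_eq]; norm_num) h0
  obtain ⟨z', hz'⟩ := exists_linearIndependent_snoc_of_lt_finrank hy'
    (by rw [h.finrank_eq]; norm_num)
  refine ⟨y', z', h.of_indep hx y'.2 z'.2 ?_⟩
  exact indep_of_snoc hz'

theorem IsTriple.exists_of_mem₂ {Λ : Submodule K E} {x y z : E} (h : IsTriple F Λ x y z)
    {x' y' : E} (hx : x' ∈ Λ) (hy : y' ∈ Λ) (hi : LinearIndependent K ![x', y']) :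
    ∃ z', IsTriple F Λ x' y' z' := by
  have : FiniteDimensional K Λ := FiniteDimensional.of_finrank_pos (by rw [h.finrank_eq]; norm_num)
  have hi' : LinearIndependent K ![(⟨x', hx⟩ : Λ), ⟨y', hy⟩] := by
    refine LinearIndependent.of_comp Λ.subtype ?_
    convert hi using 1
    ext i
    fin_cases i <;> rfl
  obtain ⟨z', hz'⟩ := exists_linearIndependent_snoc_of_lt_finrank hi'
    (by rw [h.finrank_eq]; norm_num)
  refine ⟨z', h.of_indep hx hy z'.2 ?_⟩
  exact indep_of_snoc hz'

theorem IsTriple.smul {Λ : Submodule K E} {x y z : E} (h : IsTriple F Λ x y z) {a : F}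
    (ha : a ≠ 0) : IsTriple F (Submodule.span K {a • x, a • y, a • z}) (a • x) (a • y) (a • z) := by
  refine ⟨?_, rfl⟩
  rw [Fintype.linearIndependent_iff]
  intro g hg
  have h0 : (g 0 * a) • x + (g 1 * a) • y + (g 2 * a) • z = 0 := by
    simpa [Fin.sum_univ_three, smul_smul] using hg
  obtain ⟨h1, h2, h3⟩ := combo_eq_zero h.indep h0
  intro i
  fin_cases i
  exacts [(mul_eq_zero.1 h1).resolve_right ha, (mul_eq_zero.1 h2).resolve_right ha,
    (mul_eq_zero.1 h3).resolve_right ha]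

theorem IsTriple.mem_smul_iff {Λ : Submodule K E} {x y z : E} (h : IsTriple F Λ x y z) {a : F}
    {v : E} : v ∈ Submodule.span K {a • x, a • y, a • z} ↔ ∃ u ∈ Λ, v = a • u := by
  constructor
  · intro hv
    rw [Submodule.mem_span_insert] at hv
    obtain ⟨k, u, hu, rfl⟩ := hv
    obtain ⟨l, m, rfl⟩ := Submodule.mem_span_pair.1 hu
    refine ⟨k • x + (l • y + m • z), Λ.add_mem (Λ.smul_mem _ h.mem_left)
      (Λ.add_mem (Λ.smul_mem _ h.mem_mid) (Λ.smul_mem _ h.mem_right)), ?_⟩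
    simp only [smul_add, smul_comm a]
  · rintro ⟨u, hu, rfl⟩
    obtain ⟨k, l, m, rfl⟩ := h.exists_coords hu
    rw [smul_add, smul_add, smul_comm a, smul_comm a, smul_comm a]
    refine add_mem (add_mem ?_ ?_) ?_ <;> exact Submodule.smul_mem _ _ (Submodule.subset_span (by simp))

theorem IsTriple.ncard_subPts [Finite K] {Λ : Submodule K E} {x y z : E} (h : IsTriple F Λ x y z) :
    (subPts (F := F) Λ).ncard = Nat.card K ^ 2 + Nat.card K + 1 := by
  rw [KleinCL.ncard_subPts h.isScalarClosed h.finrank_eq]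
  simp [Finset.sum_range_succ]
  ring

/-- The number of points of a Baer subline. -/
theorem ncard_subPts_pair [Finite K] {Λ : Submodule K E} (h : IsScalarClosed F Λ) {x y : E}
    (hx : x ∈ Λ) (hy : y ∈ Λ) (hi : LinearIndependent K ![x, y]) :
    (subPts (F := F) (Submodule.span K {x, y})).ncard = Nat.card K + 1 := by
  have hle : Submodule.span K {x, y} ≤ Λ := by
    rw [Submodule.span_le]
    rintro v (rfl | rfl) <;> assumption
  have hr : Set.range ![x, y] = {x, y} := by
    simp [Matrix.range_cons, Set.pair_comm]
  rw [KleinCL.ncard_subPts (n := 2) (h.mono hle)]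
  · simp [Finset.sum_range_succ]
    ring
  · rw [← hr, finrank_span_eq_card hi, Fintype.card_fin]

/-- In a Baer subspace, vectors independent over `K` are not `F`-proportional. -/
theorem IsScalarClosed.pair_indep {Λ : Submodule K E} (h : IsScalarClosed F Λ) {x y : E}
    (hx : x ∈ Λ) (hy : y ∈ Λ) (hx0 : x ≠ 0) :
    LinearIndependent K ![x, y] ↔ ∀ a : F, a • x ≠ y := by
  rw [LinearIndependent.pair_iff' hx0]
  constructor
  · intro h1 a ha
    obtain ⟨k, rfl⟩ := h x hx hx0 a (ha ▸ hy)
    exact h1 k (by rw [← ha, algebraMap_smul])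
  · intro h1 k hk
    exact h1 (algebraMap K F k) (by rw [← hk, algebraMap_smul])

end BaerSpan

end

section

/-! ### Point sets and plane sets of Baer type: local structure -/

/-- The nonzero vectors that represent points of `A`. -/
def vecs {E : Type*} [AddCommGroup E] [Module F E] (A : Set (ℙ F E)) : Set E :=
  {v | ∃ h : v ≠ 0, mk F v h ∈ A}

theorem mk_mem_iff {E : Type*} [AddCommGroup E] [Module F E] {A : Set (ℙ F E)} {v : E}
    (hv : v ≠ 0) : mk F v hv ∈ A ↔ v ∈ vecs A := ⟨fun h => ⟨hv, h⟩, fun h => h.2⟩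

theorem smul_mem_vecs {E : Type*} [AddCommGroup E] [Module F E] {A : Set (ℙ F E)} {v : E} {a : F}
    (ha : a ≠ 0) : a • v ∈ vecs A ↔ v ∈ vecs A := by
  constructor
  · rintro ⟨h, h'⟩
    have hv : v ≠ 0 := fun h0 => h (by simp [h0])
    have e : mk F (a • v) h = mk F v hv := (mk_eq_mk_iff' F _ _ _ _).2 ⟨a, rfl⟩
    exact ⟨hv, e ▸ h'⟩
  · rintro ⟨hv, h'⟩
    have e : mk F (a • v) (smul_ne_zero ha hv) = mk F v hv := (mk_eq_mk_iff' F _ _ _ _).2 ⟨a, rfl⟩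
    exact ⟨smul_ne_zero ha hv, e ▸ h'⟩

variable {K : Type*} [Field K] [Algebra K F]

/-- `Λ` is a Baer subplane of the plane orthogonal to `w`, all of whose points are in `A`. -/
structure IsPlaneSpan (A : Set (Pt F 4)) (w : Fin 4 → F) (Λ : Submodule K (Fin 4 → F)) : Prop where
  triple : ∃ x y z, IsTriple F Λ x y z
  orth : ∀ v ∈ Λ, w ⬝ᵥ v = 0
  mem : ∀ v ∈ Λ, v ≠ 0 → v ∈ vecs A

/-- A Cameron-Liebler pair without lines, in which every plane section contains a Baer subplane. -/
structure BaerPair (K : Type*) [Field K] [Algebra K F] (A B : Set (Pt F 4)) (n : ℕ) : Prop where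
  line : ∀ M : Submodule F (Fin 4 → F), finrank F M = 2 →
    (A ∩ pts M).ncard = (B ∩ pts (perp M)).ncard
  richA : ∀ w ∈ vecs B, (A ∩ pts (perp (F ∙ w))).ncard = n + Nat.card F
  richB : ∀ w ∈ vecs A, (B ∩ pts (perp (F ∙ w))).ncard = n + Nat.card F
  poorB : ∀ w ≠ 0, w ∉ vecs A → (B ∩ pts (perp (F ∙ w))).ncard = n
  poorA : ∀ w ≠ 0, w ∉ vecs B → (A ∩ pts (perp (F ∙ w))).ncard = n
  spanA : ∀ w ∈ vecs B, ∃ Λ : Submodule K (Fin 4 → F), IsPlaneSpan A w Λ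
  spanB : ∀ w ∈ vecs A, ∃ Λ : Submodule K (Fin 4 → F), IsPlaneSpan B w Λ
  le_card : n ≤ Nat.card F
  card_eq : Nat.card F = Nat.card K ^ 2

theorem BaerPair.swap {A B : Set (Pt F 4)} {n : ℕ} (h : BaerPair K A B n) : BaerPair K B A n where
  line M hM := by
    rw [h.line (perp M) (by rw [finrank_perp, hM]), perp_perp]
  richA := h.richB
  richB := h.richA
  poorA := h.poorB
  poorB := h.poorA
  spanA := h.spanB
  spanB := h.spanA
  le_card := h.le_card
  card_eq := h.card_eq

theorem IsPlaneSpan.smul_normal {A : Set (Pt F 4)} {w : Fin 4 → F} {Λ : Submodule K (Fin 4 → F)}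
    (h : IsPlaneSpan A w Λ) (a : F) : IsPlaneSpan A (a • w) Λ :=
  ⟨h.triple, fun v hv => by rw [smul_dotProduct, h.orth v hv, smul_zero], h.mem⟩

/-- Rescaling a Baer subplane. -/
theorem IsPlaneSpan.exists_smul {A : Set (Pt F 4)} {w : Fin 4 → F} {Λ : Submodule K (Fin 4 → F)}
    (h : IsPlaneSpan A w Λ) {a : F} (ha : a ≠ 0) :
    ∃ Λ' : Submodule K (Fin 4 → F), IsPlaneSpan A w Λ' ∧ ∀ v, v ∈ Λ' ↔ a • v ∈ Λ := by
  obtain ⟨x, y, z, ht⟩ := h.triple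
  have key : ∀ v, v ∈ Submodule.span K {a⁻¹ • x, a⁻¹ • y, a⁻¹ • z} ↔ a • v ∈ Λ := by
    intro v
    rw [ht.mem_smul_iff]
    constructor
    · rintro ⟨u, hu, rfl⟩
      rwa [smul_inv_smul₀ ha]
    · intro hv
      exact ⟨_, hv, by rw [inv_smul_smul₀ ha]⟩
  refine ⟨_, ⟨⟨_, _, _, ht.smul (inv_ne_zero ha)⟩, fun v hv => ?_, fun v hv hv0 => ?_⟩, key⟩
  · have := h.orth _ ((key v).1 hv)
    rw [dotProduct_smul, smul_eq_mul] at this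
    exact (mul_eq_zero.1 this).resolve_left ha
  · exact (smul_mem_vecs ha).1 (h.mem _ ((key v).1 hv) (smul_ne_zero ha hv0))

variable [Finite F]

theorem finite_subfield (K : Type*) [Field K] [Algebra K F] : Finite K :=
  Finite.of_injective _ (algebraMap K F).injective

theorem subPts_subset {A : Set (Pt F 4)} {w : Fin 4 → F} {Λ : Submodule K (Fin 4 → F)}
    (h : IsPlaneSpan A w Λ) : subPts Λ ⊆ A ∩ pts (perp (F ∙ w)) := by
  rintro _ ⟨v, hv, hv0, rfl⟩
  refine ⟨(h.mem v hv hv0).2, ?_⟩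
  rw [mk_mem_pts, mem_perp_span_singleton]
  exact h.orth v hv

/-- Of the n + q points of the section, q + s + 1 are in the Baer subplane (s the order of `K`, q =
s²), and n ≤ q. Every counting argument below contradicts this bound s² - s - 1. -/
theorem BaerPair.ncard_extra {A B : Set (Pt F 4)} {n : ℕ} (h : BaerPair K A B n) {w : Fin 4 → F}
    (hw : w ∈ vecs B) {Λ : Submodule K (Fin 4 → F)} (hΛ : IsPlaneSpan A w Λ) :
    ((A ∩ pts (perp (F ∙ w))) \ subPts Λ).ncard + Nat.card K + 1 ≤ Nat.card K ^ 2 := by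
  have := finite_subfield (F := F) K
  obtain ⟨x, y, z, ht⟩ := hΛ.triple
  have h1 := Set.ncard_sdiff_add_ncard_of_subset (subPts_subset hΛ) (Set.toFinite _)
  rw [ht.ncard_subPts, h.richA w hw, h.card_eq] at h1
  have := h.le_card
  rw [h.card_eq] at this
  omega

theorem mem_perp_pair {n : ℕ} {x y v : Fin n → F} :
    v ∈ perp (Submodule.span F {x, y}) ↔ x ⬝ᵥ v = 0 ∧ y ⬝ᵥ v = 0 := by
  rw [mem_perp]
  constructor
  · exact fun h => ⟨h _ (Submodule.subset_span (by simp)), h _ (Submodule.subset_span (by simp))⟩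
  · rintro ⟨h1, h2⟩ u hu
    obtain ⟨a, b, rfl⟩ := Submodule.mem_span_pair.1 hu
    simp [h1, h2]

theorem finrank_eq_two (hq : Nat.card F = Nat.card K ^ 2) : finrank K F = 2 := by
  have := finite_subfield (F := F) K
  rw [Module.natCard_eq_pow_finrank (K := K)] at hq
  exact Nat.pow_right_injective (Finite.one_lt_card) hq

/-- A Baer subplane meets every line of its plane. -/
theorem exists_mem_orth (hq : Nat.card F = Nat.card K ^ 2) {Λ : Submodule K (Fin 4 → F)}
    (hΛ : finrank K Λ = 3) (v : Fin 4 → F) : ∃ y ∈ Λ, y ≠ 0 ∧ y ⬝ᵥ v = 0 := by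
  have := finite_subfield (F := F) K
  -- A `K`-linear map from rank 3 to `F`, of rank 2 over `K`, has a kernel.
  let f : Λ →ₗ[K] F := ((dotForm v).restrictScalars K).comp Λ.subtype
  have hlt : finrank K F < finrank K Λ := by rw [hΛ, finrank_eq_two hq]; norm_num
  have : 0 < finrank K (LinearMap.ker f) := by
    have h1 := LinearMap.finrank_range_add_finrank_ker f
    have h2 := Submodule.finrank_le (LinearMap.range f)
    omega
  obtain ⟨y, hy⟩ := (Submodule.ne_bot_iff _).1 (Submodule.one_le_finrank_iff.1 this)
  refine ⟨y, y.2, fun h => hy.2 (Subtype.ext h), ?_⟩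
  have := hy.1
  rw [dotProduct_comm]
  exact this

/-- If a point is on the Baer subplane of a plane, then the plane is on the dual Baer subplane of
the point. -/
theorem BaerPair.mutual {A B : Set (Pt F 4)} {n : ℕ} (h : BaerPair K A B n) {w p : Fin 4 → F}
    (hw : w ∈ vecs B) {Λ Λ' : Submodule K (Fin 4 → F)} (hΛ : IsPlaneSpan A w Λ) (hp : p ∈ Λ)
    (hp0 : p ≠ 0) (hΛ' : IsPlaneSpan B p Λ') : ∃ a : F, a ≠ 0 ∧ a • w ∈ Λ' := by
  have := finite_subfield (F := F) K
  obtain ⟨_, _, _, ht0⟩ := hΛ.triple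
  obtain ⟨y, z, ht⟩ := ht0.exists_of_mem hp hp0
  have hi : ∀ t : F, LinearIndependent F ![p, t • y + z] := by
    intro t
    rw [LinearIndependent.pair_iff]
    intro a b hab
    have := combo_eq_zero ht.indep (a := a) (b := b * t) (c := b)
      (by rw [← hab, smul_add, smul_smul, add_assoc])
    exact ⟨this.1, this.2.2⟩
  have hle : ∀ t : F, Submodule.span F {p, t • y + z} ≤ perp (F ∙ w) := by
    intro t
    rw [Submodule.span_le]
    rintro v (rfl | rfl)
    · exact mem_perp_span_singleton.2 (hΛ.orth _ hp)
    · refine mem_perp_span_singleton.2 ?_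
      rw [dotProduct_add, dotProduct_smul, hΛ.orth _ ht.mem_mid, hΛ.orth _ ht.mem_right]
      simp
  -- A tangent line.
  obtain ⟨t, ht1⟩ : ∃ t : F, A ∩ pts (Submodule.span F {p, t • y + z}) ⊆ {Projectivization.mk F p hp0} := by
    -- Otherwise each of the q - s non-secants through `p`, given by the `t` outside `K`, carries a
    -- point of `A` other than `p`. These points are distinct and off the Baer subplane: one too
    -- many for `ncard_extra`.
    by_contra! hcon
    have hQ : ∀ t : F, ∃ Q, Q ∈ A ∩ pts (Submodule.span F {p, t • y + z}) ∧ Q ≠ Projectivization.mk F p hp0 := by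
      intro t
      obtain ⟨Q, hQ, hQ'⟩ := Set.not_subset.1 (hcon t)
      exact ⟨Q, hQ, hQ'⟩
    choose Q hQ hQp using hQ
    -- With the coordinate at `z` normalised to 1, the parameter `t` can be read off the point.
    have hform : ∀ t, ∃ a : F, ∃ h0 : a • p + t • y + (1 : F) • z ≠ 0,
        Q t = Projectivization.mk F (a • p + t • y + (1 : F) • z) h0 := by
      intro t
      have h1 := mem_pts_rep.1 (hQ t).2
      obtain ⟨a, b, hab⟩ := Submodule.mem_span_pair.1 h1
      have hb : b ≠ 0 := by
        rintro rfl
        refine hQp t ?_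
        rw [← mk_rep (Q t), mk_eq_mk_iff']
        exact ⟨a, by simpa using hab⟩
      have e : b⁻¹ • (Q t).rep = (b⁻¹ * a) • p + t • y + (1 : F) • z := by
        rw [← hab, smul_add, smul_smul, inv_smul_smul₀ hb, one_smul, add_assoc]
      refine ⟨b⁻¹ * a, ?_, ?_⟩
      · rw [← e]
        exact smul_ne_zero (inv_ne_zero hb) (Q t).rep_nonzero
      · conv_lhs => rw [← mk_rep (Q t)]
        rw [mk_eq_mk_iff']
        exact ⟨b, by rw [← e, smul_inv_smul₀ hb]⟩
    have h1 : (Set.range (algebraMap K F))ᶜ.ncard ≤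
        ((A ∩ pts (perp (F ∙ w))) \ subPts Λ).ncard := by
      refine Set.ncard_le_ncard_of_injOn Q ?_ ?_ (Set.toFinite _)
      · intro t htK
        refine ⟨⟨(hQ t).1, pts_mono (hle t) (hQ t).2⟩, ?_⟩
        obtain ⟨a, h0, e⟩ := hform t
        rw [e, mk_mem_subPts]
        rintro ⟨c, hc, hm⟩
        rw [smul_add, smul_add, smul_smul, smul_smul, smul_smul] at hm
        obtain ⟨_, k2, k3, -, h2, h3⟩ := ht.coords_mem hm
        refine htK ⟨k2 / k3, ?_⟩
        rw [map_div₀, h2, h3, mul_one, mul_div_cancel_left₀ _ hc]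
      · intro t _ t' _ heq
        obtain ⟨a, h0, e⟩ := hform t
        obtain ⟨a', h0', e'⟩ := hform t'
        simp only [e, e'] at heq
        obtain ⟨c, hc⟩ := (mk_eq_mk_iff' F _ _ _ _).1 heq
        have := combo_eq_zero ht.indep (a := c * a' - a) (b := c * t' - t) (c := c * 1 - 1) (by
          rw [sub_smul, sub_smul, sub_smul, mul_smul, mul_smul, mul_smul, ← sub_eq_zero.2 hc]
          simp only [smul_add]
          abel)
        have h2 : c = 1 := by linear_combination this.2.2
        have h3 := this.2.1
        rw [h2] at h3
        linear_combination -h3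
    have h2 : (Set.range (algebraMap K F)).ncard = Nat.card K := by
      rw [← Set.image_univ, Set.ncard_image_of_injective _ (algebraMap K F).injective,
        Set.ncard_univ]
    have h3 := Set.ncard_add_ncard_compl (Set.range (algebraMap K F))
    have h4 := h.ncard_extra hw hΛ
    rw [h.card_eq] at h3
    omega
  set M := Submodule.span F {p, t • y + z} with hM
  have hMr : finrank F M = 2 := finrank_pair (hi t)
  -- The tangent line has one point of `A`, hence lies on at most one plane of `B`. Both `w` and
  -- some plane `u` of the dual Baer subplane `Λ'` contain it, so they agree.
  have h1 : (B ∩ pts (perp M)).ncard ≤ 1 := by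
    rw [← h.line M hMr, ← Set.ncard_singleton (Projectivization.mk F p hp0)]
    exact Set.ncard_le_ncard ht1
  obtain ⟨u, hu, hu0, huv⟩ := exists_mem_orth h.card_eq
    (by obtain ⟨_, _, _, ht'⟩ := hΛ'.triple; exact ht'.finrank_eq) (t • y + z)
  have hu1 : Projectivization.mk F u hu0 ∈ B ∩ pts (perp M) := by
    refine ⟨(hΛ'.mem u hu hu0).2, ?_⟩
    rw [mk_mem_pts, hM, mem_perp_pair, hΛ'.orth u hu, dotProduct_comm, huv]
    exact ⟨rfl, rfl⟩
  have hw1 : Projectivization.mk F w hw.1 ∈ B ∩ pts (perp M) := by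
    refine ⟨hw.2, ?_⟩
    rw [mk_mem_pts]
    have := le_perp_comm.1 (hle t)
    exact this (Submodule.mem_span_singleton_self w)
  have := (Set.ncard_le_one (Set.toFinite _)).1 h1 _ hu1 _ hw1
  obtain ⟨a, ha⟩ := (mk_eq_mk_iff' F _ _ _ _).1 this
  refine ⟨a, ?_, ha ▸ hu⟩
  rintro rfl
  exact hu0 (by simpa using ha.symm)

end

/-! ### Secants through a point and the dual Baer subplane at that point -/

section

variable {K : Type*} [Field K] [Algebra K F]

/-- The Baer subplane `Λ` has a point other than `p` orthogonal to `d`. -/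
def IsSecant (Λ : Submodule K (Fin 4 → F)) (p d : Fin 4 → F) : Prop :=
  ∃ v ∈ Λ, (∀ a : F, v ≠ a • p) ∧ d ⬝ᵥ v = 0

variable [Finite F]

theorem ncard_biUnion_ge {ι α : Type*} [Finite α] (T : Finset ι) (f : ι → Set α) {m : ℕ}
    {X : Set α} (hm : ∀ t ∈ T, m ≤ (f t).ncard) (hX : ∀ t ∈ T, f t ⊆ X)
    (hd : ∀ t ∈ T, ∀ t' ∈ T, t ≠ t' → Disjoint (f t) (f t')) : T.card * m ≤ X.ncard := by
  classical
  have := Fintype.ofFinite α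
  have h1 : (T.biUnion fun t => (f t).toFinset).card = ∑ t ∈ T, (f t).toFinset.card :=
    Finset.card_biUnion fun t ht t' ht' hne => by
      simpa using hd t ht t' ht' hne
  have h2 : T.card * m ≤ ∑ t ∈ T, (f t).toFinset.card := by
    rw [← smul_eq_mul]
    refine Finset.card_nsmul_le_sum _ _ _ fun t ht => ?_
    rw [← Set.ncard_eq_toFinset_card']
    exact hm t ht
  rw [← h1] at h2
  refine h2.trans ?_
  rw [Set.ncard_eq_toFinset_card']
  refine Finset.card_le_card ?_
  intro a ha
  obtain ⟨t, ht, hat⟩ := Finset.mem_biUnion.1 ha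
  exact Set.mem_toFinset.2 (hX t ht (Set.mem_toFinset.1 hat))

theorem perp_eq_span_triple {p x y z : Fin 4 → F} (hp : p ≠ 0)
    (hi : LinearIndependent F ![x, y, z]) (hx : p ⬝ᵥ x = 0) (hy : p ⬝ᵥ y = 0) (hz : p ⬝ᵥ z = 0) :
    perp (F ∙ p) = Submodule.span F {x, y, z} := by
  symm
  refine Submodule.eq_of_le_of_finrank_eq ?_ ?_
  · rw [Submodule.span_le]
    rintro v (rfl | rfl | rfl) <;> exact mem_perp_span_singleton.2 ‹_›
  · rw [finrank_perp, finrank_span_singleton hp, ← range_vec3, finrank_span_eq_card hi,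
      Fintype.card_fin]

theorem eq_smul_of_orth {p x y z v : Fin 4 → F} (hp : p ≠ 0)
    (hi : LinearIndependent F ![x, y, z]) (hx : p ⬝ᵥ x = 0) (hy : p ⬝ᵥ y = 0) (hz : p ⬝ᵥ z = 0)
    (hvx : x ⬝ᵥ v = 0) (hvy : y ⬝ᵥ v = 0) (hvz : z ⬝ᵥ v = 0) : ∃ a : F, v = a • p := by
  have h1 : v ∈ perp (perp (F ∙ p)) := by
    rw [perp_eq_span_triple hp hi hx hy hz, mem_perp]
    intro u hu
    rw [Submodule.mem_span_insert] at hu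
    obtain ⟨a, u', hu', rfl⟩ := hu
    obtain ⟨b, c, rfl⟩ := Submodule.mem_span_pair.1 hu'
    simp [hvx, hvy, hvz]
  rw [perp_perp, Submodule.mem_span_singleton] at h1
  obtain ⟨a, rfl⟩ := h1
  exact ⟨a, rfl⟩

/-- The planes `t • d + e` cut the plane of `w` in s lines through `p`. Each has at least s + 1
points of `A`, since it lies on the planes of a Baer subline of `Λ'`. On a non-secant, s of these
points differ from `p` and are outside `Λ`, and different lines share only `p`; so s - 1 non-secants
would need (s - 1)s extra points, more than s² - s - 1. -/
theorem BaerPair.two_secants {A B : Set (Pt F 4)} {n : ℕ} (h : BaerPair K A B n)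
    {w p : Fin 4 → F} {Λ Λ' : Submodule K (Fin 4 → F)} (hΛ : IsPlaneSpan A w Λ)
    (hp0 : p ≠ 0) (hΛ' : IsPlaneSpan B p Λ') (hw : w ∈ Λ') (hw0 : w ≠ 0) {d e : Fin 4 → F}
    (ht : IsTriple F Λ' w d e) :
    ∃ t t' : K, t ≠ t' ∧ IsSecant Λ p (t • d + e) ∧ IsSecant Λ p (t' • d + e) := by
  classical
  have := finite_subfield (F := F) K
  have := Fintype.ofFinite K
  by_contra! hcon
  have hwB := hΛ'.mem w hw hw0
  -- For a non-secant line there are many points of `A` on it outside the Baer subplane.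
  set X := (A ∩ pts (perp (F ∙ w))) \ subPts Λ with hX
  let f : K → Set (Pt F 4) := fun t =>
    (A ∩ pts (perp (Submodule.span F {w, t • d + e}))) \ {Projectivization.mk F p hp0}
  set T : Finset K := Finset.univ.filter fun t => ¬ IsSecant Λ p (t • d + e) with hT
  have horth : ∀ t : K, p ⬝ᵥ (t • d + e) = 0 := fun t =>
    hΛ'.orth _ (Λ'.add_mem (Λ'.smul_mem _ ht.mem_mid) ht.mem_right)
  have hi : ∀ t : K, LinearIndependent F ![w, t • d + e] := by
    intro t
    rw [LinearIndependent.pair_iff]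
    intro a b hab
    have := combo_eq_zero ht.indep (a := a) (b := b * algebraMap K F t) (c := b)
      (by rw [← hab, smul_add, mul_smul, algebraMap_smul, add_assoc])
    exact ⟨this.1, this.2.2⟩
  have hiK : ∀ t : K, LinearIndependent K ![w, t • d + e] := fun t =>
    LinearIndependent.restrict_scalars (K := F)
      (fun a b hab => by simpa [Algebra.smul_def] using hab) (hi t)
  have hcard : T.card * Nat.card K ≤ X.ncard := by
    refine ncard_biUnion_ge T f ?_ ?_ ?_
    · intro t _
      have h1 : Nat.card K + 1 ≤ (A ∩ pts (perp (Submodule.span F {w, t • d + e}))).ncard := by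
        rw [h.line _ (by rw [finrank_perp, finrank_pair (hi t)]), perp_perp,
          ← ncard_subPts_pair ht.isScalarClosed ht.mem_left
            (Λ'.add_mem (Λ'.smul_mem t ht.mem_mid) ht.mem_right) (hiK t)]
        refine Set.ncard_le_ncard ?_ (Set.toFinite _)
        rintro _ ⟨v, hv, hv0, rfl⟩
        obtain ⟨a, b, rfl⟩ := Submodule.mem_span_pair.1 hv
        refine ⟨(hΛ'.mem _ (Λ'.add_mem (Λ'.smul_mem _ hw) (Λ'.smul_mem _
          (Λ'.add_mem (Λ'.smul_mem t ht.mem_mid) ht.mem_right))) hv0).2, ?_⟩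
        rw [mk_mem_pts]
        exact Submodule.span_le_restrictScalars K F _ hv
      have h2 := Set.pred_ncard_le_ncard_sdiff_singleton
        (A ∩ pts (perp (Submodule.span F {w, t • d + e}))) (Projectivization.mk F p hp0)
      simp only [f]
      omega
    · rintro t ht' Q ⟨⟨hQA, hQ⟩, hQp⟩
      have hns := (Finset.mem_filter.1 ht').2
      have hQ' := mem_pts_rep.1 hQ
      rw [mem_perp_pair] at hQ'
      refine ⟨⟨hQA, ?_⟩, ?_⟩
      · rw [mem_pts_rep, mem_perp_span_singleton]
        exact hQ'.1
      · rintro ⟨v, hv, hv0, rfl⟩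
        rw [mk_mem_pts, mem_perp_pair] at hQ
        refine hns ⟨v, hv, fun a hva => hQp ?_, hQ.2⟩
        rw [Set.mem_singleton_iff, mk_eq_mk_iff']
        exact ⟨a, hva.symm⟩
    · intro t _ t' _ hne
      rw [Set.disjoint_left]
      rintro Q ⟨⟨_, hQ⟩, hQp⟩ ⟨⟨_, hQ'⟩, _⟩
      rw [mem_pts_rep, mem_perp_pair] at hQ hQ'
      have hd : d ⬝ᵥ Q.rep = 0 := by
        have h1 : (t - t') • (d ⬝ᵥ Q.rep) = 0 := by
          have := congrArg₂ (· - ·) hQ.2 hQ'.2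
          simp only [add_dotProduct, smul_dotProduct] at this
          rw [sub_smul]
          simpa using this
        exact (smul_eq_zero.1 h1).resolve_left (sub_ne_zero.2 hne)
      have he : e ⬝ᵥ Q.rep = 0 := by
        have := hQ.2
        rwa [add_dotProduct, smul_dotProduct, hd, smul_zero, zero_add] at this
      obtain ⟨a, ha⟩ := eq_smul_of_orth hp0 ht.indep (hΛ'.orth _ ht.mem_left)
        (hΛ'.orth _ ht.mem_mid) (hΛ'.orth _ ht.mem_right) hQ.1 hd he
      refine hQp ?_
      rw [Set.mem_singleton_iff, ← mk_rep Q, mk_eq_mk_iff']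
      exact ⟨a, ha.symm⟩
  have hTc : Nat.card K ≤ T.card + 1 := by
    have h1 : (Finset.univ.filter fun t : K => IsSecant Λ p (t • d + e)).card ≤ 1 := by
      rw [Finset.card_le_one]
      intro t h1 t' h2
      by_contra hne
      exact hcon t t' hne (Finset.mem_filter.1 h1).2 (Finset.mem_filter.1 h2).2
    have h2 : (Finset.univ.filter fun t : K => IsSecant Λ p (t • d + e)).card + T.card =
        (Finset.univ : Finset K).card := by
      convert Finset.card_filter_add_card_filter_not (s := (Finset.univ : Finset K))
        (fun t : K => IsSecant Λ p (t • d + e))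
    rw [Finset.card_univ, ← Nat.card_eq_fintype_card] at h2
    omega
  have h4 := h.ncard_extra hwB hΛ
  have : Nat.card K * Nat.card K ≤ (T.card + 1) * Nat.card K := Nat.mul_le_mul_right _ hTc
  rw [← hX, pow_two] at h4
  rw [add_mul, one_mul] at this
  omega

theorem indep_triple {R E : Type*} [Field R] [AddCommGroup E] [Module R E] {x y z : E}
    (h : ∀ a b c : R, a • x + b • y + c • z = 0 → a = 0 ∧ b = 0 ∧ c = 0) :
    LinearIndependent R ![x, y, z] := by
  rw [Fintype.linearIndependent_iff]
  intro g hg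
  obtain ⟨h1, h2, h3⟩ := h (g 0) (g 1) (g 2) (by simpa [Fin.sum_univ_three] using hg)
  intro i
  fin_cases i <;> assumption

theorem IsTriple.combo_eq_zero {E : Type*} [AddCommGroup E] [Module F E] [Module K E]
    [IsScalarTower K F E] {Λ : Submodule K E} {x y z : E} (h : IsTriple F Λ x y z) {a b c : K}
    (h0 : a • x + b • y + c • z = 0) : a = 0 ∧ b = 0 ∧ c = 0 := by
  have := KleinCL.combo_eq_zero h.indep (a := algebraMap K F a) (b := algebraMap K F b)
    (c := algebraMap K F c) (by simpa only [algebraMap_smul] using h0)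
  simpa using this

/-- Among the planes of `Λ'` through a suitable basis, three are secant. -/
theorem BaerPair.three_secants {A B : Set (Pt F 4)} {n : ℕ} (h : BaerPair K A B n)
    {w p : Fin 4 → F} {Λ Λ' : Submodule K (Fin 4 → F)} (hΛ : IsPlaneSpan A w Λ)
    (hp0 : p ≠ 0) (hΛ' : IsPlaneSpan B p Λ') (hw : w ∈ Λ') (hw0 : w ≠ 0) :
    ∃ d e : Fin 4 → F, IsTriple F Λ' w d e ∧ IsSecant Λ p d ∧ IsSecant Λ p e ∧
      IsSecant Λ p (d + e) := by
  obtain ⟨_, _, _, ht0⟩ := hΛ'.triple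
  obtain ⟨d, e, ht⟩ := ht0.exists_of_mem hw hw0
  obtain ⟨t, -, -, ht1, -⟩ := h.two_secants hΛ hp0 hΛ' hw hw0 ht
  have htd : IsTriple F Λ' w (t • d + e) d := by
    refine ht.of_indep hw (Λ'.add_mem (Λ'.smul_mem t ht.mem_mid) ht.mem_right) ht.mem_mid
      (indep_triple fun a b c habc => ?_)
    obtain ⟨h1, h2, h3⟩ := ht.combo_eq_zero (a := a) (b := b * t + c) (c := b) (by
      rw [← habc, smul_add, add_smul, mul_smul]; abel)
    refine ⟨h1, h3, ?_⟩
    rw [h3] at h2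
    simpa using h2
  -- With the secant `d₁` as a basis vector, the planes `t • d₁ + d` are all different from it and
  -- yield two more secants.
  generalize t • d + e = d₁ at ht1 htd
  obtain ⟨t₁, t₂, hne, h1, h2⟩ := h.two_secants hΛ hp0 hΛ' hw hw0 htd
  have hne' : t₂ - t₁ ≠ 0 := sub_ne_zero.2 hne.symm
  -- The factor `t₂ - t₁` makes the third secant `t₂ • d₁ + d` the sum of the other two.
  refine ⟨(t₂ - t₁) • d₁, t₁ • d₁ + d, ?_, ?_, h1, ?_⟩
  · refine ht.of_indep hw (Λ'.smul_mem _ htd.mem_mid)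
      (Λ'.add_mem (Λ'.smul_mem _ htd.mem_mid) htd.mem_right) (indep_triple fun a b c habc => ?_)
    obtain ⟨h1, h2, h3⟩ := htd.combo_eq_zero (a := a) (b := b * (t₂ - t₁) + c * t₁) (c := c) (by
      rw [← habc, smul_add, add_smul, mul_smul, mul_smul]; abel)
    refine ⟨h1, ?_, h3⟩
    rw [h3, zero_mul, add_zero] at h2
    exact (mul_eq_zero.1 h2).resolve_right hne'
  · obtain ⟨v, hv, hva, hdv⟩ := ht1
    exact ⟨v, hv, hva, by rw [smul_dotProduct, hdv, smul_zero]⟩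
  · have : (t₂ - t₁) • d₁ + (t₁ • d₁ + d) = t₂ • d₁ + d := by rw [sub_smul]; abel
    rwa [this]

/-- If `p` is on the Baer subplane of `w`, the secants through `p` are the same for the Baer
subplane of `w` and for the dual Baer subplane of `p`. -/
theorem BaerPair.transfer {A B : Set (Pt F 4)} {n : ℕ} (h : BaerPair K A B n)
    {w p : Fin 4 → F} {Λ Λ' : Submodule K (Fin 4 → F)} (hΛ : IsPlaneSpan A w Λ) (hp : p ∈ Λ)
    (hp0 : p ≠ 0) (hΛ' : IsPlaneSpan B p Λ') (hw : w ∈ Λ') (hw0 : w ≠ 0) {v : Fin 4 → F}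
    (hv : v ∈ Λ) : ∃ u ∈ Λ', (∀ a : F, u ≠ a • w) ∧ u ⬝ᵥ v = 0 := by
  -- The points of `Λ` and the planes of `Λ'` each determine a Baer subline of lines through `p`;
  -- with three common lines the two coincide. In the bases `p, v₂, v₃` and `w, d, e` this is
  -- explicit: `d` sees only `v₃`, `e` sees only `v₂`, and the third secant relates the two values
  -- over `K`.
  obtain ⟨d, e, ht, ⟨v₂, hv₂, hv₂p, hdv⟩, ⟨v₃, hv₃, hv₃p, hev⟩, ⟨v₁, hv₁, hv₁p, hde⟩⟩ :=
    h.three_secants hΛ hp0 hΛ' hw hw0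
  have orth : ∀ x ∈ Λ', x ⬝ᵥ p = 0 := fun x hx => by rw [dotProduct_comm]; exact hΛ'.orth x hx
  have hdv₃ : d ⬝ᵥ v₃ ≠ 0 := fun h0 => by
    obtain ⟨a, ha⟩ := eq_smul_of_orth hp0 ht.indep (hΛ'.orth _ ht.mem_left)
      (hΛ'.orth _ ht.mem_mid) (hΛ'.orth _ ht.mem_right) (hΛ.orth _ hv₃) h0 hev
    exact hv₃p a ha
  have hev₂ : e ⬝ᵥ v₂ ≠ 0 := fun h0 => by
    obtain ⟨a, ha⟩ := eq_smul_of_orth hp0 ht.indep (hΛ'.orth _ ht.mem_left)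
      (hΛ'.orth _ ht.mem_mid) (hΛ'.orth _ ht.mem_right) (hΛ.orth _ hv₂) hdv h0
    exact hv₂p a ha
  have expand_d : ∀ a b c : K, d ⬝ᵥ (a • p + b • v₂ + c • v₃) = c • (d ⬝ᵥ v₃) := fun a b c => by
    simp [dotProduct_add, dotProduct_smul, orth d ht.mem_mid, hdv]
  have expand_e : ∀ a b c : K, e ⬝ᵥ (a • p + b • v₂ + c • v₃) = b • (e ⬝ᵥ v₂) := fun a b c => by
    simp [dotProduct_add, dotProduct_smul, orth e ht.mem_right, hev]
  obtain ⟨_, _, _, hs0⟩ := hΛ.triple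
  have hs : IsTriple F Λ p v₂ v₃ := by
    refine hs0.of_indep hp hv₂ hv₃ (indep_triple fun a b c habc => ?_)
    have h1 := expand_d a b c
    have h2 := expand_e a b c
    rw [habc, dotProduct_zero, eq_comm, smul_eq_zero] at h1 h2
    have h1 := h1.resolve_right hdv₃
    have h2 := h2.resolve_right hev₂
    rw [h1, h2, zero_smul, zero_smul, add_zero, add_zero, smul_eq_zero] at habc
    exact ⟨habc.resolve_right hp0, h2, h1⟩
  obtain ⟨a, b, c, rfl⟩ := hs.exists_coords hv₁
  rw [add_dotProduct, expand_d, expand_e] at hde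
  have hb : b ≠ 0 := by
    rintro rfl
    have hc : c = 0 := by simpa [hdv₃] using hde
    exact hv₁p (algebraMap K F a) (by simp [hc])
  have hc : c ≠ 0 := by
    rintro rfl
    have hb : b = 0 := by simpa [hev₂] using hde
    exact hv₁p (algebraMap K F a) (by simp [hb])
  obtain ⟨a', t, r, rfl⟩ := hs.exists_coords hv
  have not_prop : ∀ x y : K, ¬ (x = 0 ∧ y = 0) → ∀ k : F, x • d + y • e ≠ k • w := by
    intro x y hxy k hk
    have := combo_eq_zero ht.indep (a := -k) (b := algebraMap K F x) (c := algebraMap K F y) (by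
      rw [algebraMap_smul, algebraMap_smul, add_assoc, hk, neg_smul, neg_add_cancel])
    exact hxy (by simpa using this.2)
  by_cases htr : t = 0 ∧ r = 0
  · refine ⟨d, ht.mem_mid, fun k hk => not_prop 1 0 (by simp) k (by simpa using hk), ?_⟩
    rw [expand_d, htr.2, zero_smul]
  -- These coefficients turn the product with `v` into `t * r` times the relation `hde` of the third
  -- secant.
  · refine ⟨(t * c) • d + (r * b) • e, Λ'.add_mem (Λ'.smul_mem _ ht.mem_mid)
      (Λ'.smul_mem _ ht.mem_right), not_prop _ _ ?_, ?_⟩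
    · simpa [hb, hc] using htr
    · rw [add_dotProduct, smul_dotProduct, smul_dotProduct, expand_d, expand_e, smul_smul,
        smul_smul]
      have : (t * c * r) • (d ⬝ᵥ v₃) + (r * b * t) • (e ⬝ᵥ v₂) =
          (t * r) • (c • (d ⬝ᵥ v₃) + b • (e ⬝ᵥ v₂)) := by
        rw [smul_add, smul_smul, smul_smul]
        congr 2 <;> ring
      rw [this, hde, smul_zero]

end

/-! ### Secants without extra points -/

section

variable {K : Type*} [Field K] [Algebra K F] [Finite F]

theorem subPts_span_subset {A : Set (Pt F 4)} {w : Fin 4 → F} {Λ : Submodule K (Fin 4 → F)}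
    (hΛ : IsPlaneSpan A w Λ) {x y : Fin 4 → F} (hx : x ∈ Λ) (hy : y ∈ Λ) :
    subPts (Submodule.span K {x, y}) ⊆ A ∩ pts (Submodule.span F {x, y}) := by
  rintro _ ⟨v, hv, hv0, rfl⟩
  refine ⟨?_, ?_⟩
  · obtain ⟨a, b, rfl⟩ := Submodule.mem_span_pair.1 hv
    exact (hΛ.mem _ (Λ.add_mem (Λ.smul_mem _ hx) (Λ.smul_mem _ hy)) hv0).2
  · rw [mk_mem_pts]
    exact Submodule.span_le_restrictScalars K F _ hv

/-- Some secant of the Baer subplane of a plane contains no further point of `A`. -/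
theorem BaerPair.exists_clean {A B : Set (Pt F 4)} {n : ℕ} (h : BaerPair K A B n)
    {w : Fin 4 → F} {Λ : Submodule K (Fin 4 → F)} (hw : w ∈ vecs B) (hΛ : IsPlaneSpan A w Λ) :
    ∃ x y z : Fin 4 → F, IsTriple F Λ x y z ∧
      A ∩ pts (Submodule.span F {x, y}) ⊆ subPts (Submodule.span K {x, y}) := by
  have := finite_subfield (F := F) K
  obtain ⟨b₁, b₂, b₃, ht⟩ := hΛ.triple
  by_contra! hcon
  -- The pairs `(a, c)` index the s² secants of `Λ` that miss the point `b₁`.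
  have htr : ∀ a c : K, IsTriple F Λ (b₂ - a • b₁) (b₃ - c • b₁) b₁ := fun a c => by
    refine ht.of_indep (Λ.sub_mem ht.mem_mid (Λ.smul_mem _ ht.mem_left))
      (Λ.sub_mem ht.mem_right (Λ.smul_mem _ ht.mem_left)) ht.mem_left
      (indep_triple fun k l m hk => ?_)
    obtain ⟨h1, h2, h3⟩ := ht.combo_eq_zero (a := m - k * a - l * c) (b := k) (c := l) (by
      rw [← hk, sub_smul, sub_smul, smul_sub, smul_sub, mul_smul, mul_smul]; abel)
    rw [h2, h3] at h1
    exact ⟨h2, h3, by simpa using h1⟩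
  have hQ : ∀ t : K × K, ∃ α β : F, ∃ h0 : α • (b₂ - t.1 • b₁) + β • (b₃ - t.2 • b₁) ≠ 0,
      Projectivization.mk F _ h0 ∈ A ∧ Projectivization.mk F _ h0 ∉ subPts Λ ∧
      ∀ r : F, r ≠ 0 → (∃ k', algebraMap K F k' = r * α) → (∃ l', algebraMap K F l' = r * β)
        → False := by
    rintro ⟨a, c⟩
    obtain ⟨Q, hQ1, hQ2⟩ := Set.not_subset.1 (hcon _ _ _ (htr a c))
    obtain ⟨α, β, hαβ⟩ := Submodule.mem_span_pair.1 (mem_pts_rep.1 hQ1.2)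
    have h0 : α • (b₂ - a • b₁) + β • (b₃ - c • b₁) ≠ 0 := by rw [hαβ]; exact Q.rep_nonzero
    have hQe : Q = Projectivization.mk F _ h0 := by
      conv_lhs => rw [← mk_rep Q]
      rw [mk_eq_mk_iff']
      exact ⟨1, by rw [one_smul, hαβ]⟩
    have hfin : ∀ r : F, r ≠ 0 → (∃ k', algebraMap K F k' = r * α) →
        (∃ l', algebraMap K F l' = r * β) → False := by
      rintro r hr ⟨k, hk⟩ ⟨l, hl⟩
      refine hQ2 ?_
      rw [hQe, mk_mem_subPts]
      refine ⟨r, hr, Submodule.mem_span_pair.2 ⟨k, l, ?_⟩⟩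
      rw [smul_add, smul_smul, smul_smul, ← hk, ← hl, algebraMap_smul, algebraMap_smul]
    refine ⟨α, β, h0, hQe ▸ hQ1.1, ?_, hfin⟩
    rw [mk_mem_subPts]
    rintro ⟨r, hr, hm⟩
    have e : r • (α • (b₂ - a • b₁) + β • (b₃ - c • b₁)) =
        (r * α) • (b₂ - a • b₁) + (r * β) • (b₃ - c • b₁) + (0 : F) • b₁ := by
      rw [smul_add, smul_smul, smul_smul, zero_smul, add_zero]
    obtain ⟨k, l, _, h1, h2, -⟩ := (htr a c).coords_mem (e ▸ hm)
    exact hfin r hr ⟨k, h1⟩ ⟨l, h2⟩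
  choose α β h0 hA hnΛ hfin using hQ
  -- Two secants meet in a point of `Λ`, so an extra point lies on only one of them. An extra point
  -- on each secant would give s² of them.
  have h1 : (Set.univ : Set (K × K)).ncard ≤ ((A ∩ pts (perp (F ∙ w))) \ subPts Λ).ncard := by
    refine Set.ncard_le_ncard_of_injOn (fun t => Projectivization.mk F _ (h0 t)) ?_ ?_
      (Set.toFinite _)
    · intro t _
      refine ⟨⟨hA t, ?_⟩, hnΛ t⟩
      rw [mk_mem_pts, mem_perp_span_singleton, dotProduct_add, dotProduct_smul, dotProduct_smul,
        hΛ.orth _ (htr t.1 t.2).mem_left, hΛ.orth _ (htr t.1 t.2).mem_mid]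
      simp
    · rintro ⟨a, c⟩ _ ⟨a', c'⟩ _ heq
      obtain ⟨r, hr⟩ := (mk_eq_mk_iff' F _ _ _ _).1 heq
      simp only at hr
      set α₁ := α (a, c)
      set β₁ := β (a, c)
      set α₂ := α (a', c')
      set β₂ := β (a', c')
      obtain ⟨e1, e2, e3⟩ := combo_eq_zero ht.indep
        (a := (α₁ * algebraMap K F a + β₁ * algebraMap K F c) -
          r * (α₂ * algebraMap K F a' + β₂ * algebraMap K F c'))
        (b := r * α₂ - α₁) (c := r * β₂ - β₁) (by
          rw [← sub_eq_zero] at hr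
          rw [← hr]
          simp only [sub_smul, add_smul, mul_smul, smul_sub, smul_add, algebraMap_smul]
          abel)
      by_contra hne
      -- Comparing the coefficients at `b₁` gives a non-trivial relation over `K` between `α₁` and
      -- `β₁`. So the point has coordinates in `K` up to a scalar, which `hfin` excludes.
      have e4 : α₁ * (algebraMap K F (a - a')) + β₁ * algebraMap K F (c - c') = 0 := by
        rw [map_sub, map_sub]
        linear_combination e1 + algebraMap K F a' * e2 + algebraMap K F c' * e3
      have key := hfin (a, c)
      by_cases haa : a = a'
      · have hcc : c - c' ≠ 0 := fun h => hne (by rw [haa, sub_eq_zero.1 h])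
        have hβ : β₁ = 0 := by
          rw [haa, sub_self, map_zero, mul_zero, zero_add] at e4
          exact (mul_eq_zero.1 e4).resolve_right ((map_ne_zero _).2 hcc)
        have hα : α₁ ≠ 0 := fun h => h0 (a, c) (by
          change α₁ • _ + β₁ • _ = _
          rw [h, hβ, zero_smul, zero_smul, add_zero])
        exact key α₁⁻¹ (inv_ne_zero hα) ⟨1, by rw [map_one]; exact (inv_mul_cancel₀ hα).symm⟩
          ⟨0, by rw [map_zero]; change 0 = _ * β₁; rw [hβ, mul_zero]⟩
      · have haa' : algebraMap K F (a - a') ≠ 0 := (map_ne_zero _).2 (sub_ne_zero.2 haa)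
        have hα : α₁ = β₁ * algebraMap K F (-(c - c') / (a - a')) := by
          rw [map_div₀, map_neg]
          field_simp
          linear_combination e4
        have hβ : β₁ ≠ 0 := fun h => h0 (a, c) (by
          change α₁ • _ + β₁ • _ = _
          rw [hα, h, zero_mul, zero_smul, zero_smul, add_zero])
        refine key β₁⁻¹ (inv_ne_zero hβ) ⟨-(c - c') / (a - a'), ?_⟩
          ⟨1, by rw [map_one]; exact (inv_mul_cancel₀ hβ).symm⟩
        change _ = _ * α₁
        rw [hα, inv_mul_cancel_left₀ hβ]
  rw [Set.ncard_univ, Nat.card_prod] at h1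
  have h2 := h.ncard_extra hw hΛ
  rw [pow_two] at h2
  omega

end

/-! ### Two Baer subplanes on a clean secant -/

section

variable {K : Type*} [Field K] [Algebra K F] [Finite F]

/-- On a clean secant all points and planes lie on each other's Baer subplanes. -/
theorem BaerPair.mutual_of_clean {A B : Set (Pt F 4)} {n : ℕ} (h : BaerPair K A B n)
    {w : Fin 4 → F} {Λ : Submodule K (Fin 4 → F)} (hw : w ∈ vecs B) (hΛ : IsPlaneSpan A w Λ)
    {x y z : Fin 4 → F} (ht : IsTriple F Λ x y z)
    (hc : A ∩ pts (Submodule.span F {x, y}) ⊆ subPts (Submodule.span K {x, y}))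
    {w' : Fin 4 → F} (hw' : w' ∈ vecs B) (hx : w' ⬝ᵥ x = 0) (hy : w' ⬝ᵥ y = 0)
    {Λ₁ : Submodule K (Fin 4 → F)} (hΛ₁ : IsPlaneSpan A w' Λ₁) {p : Fin 4 → F}
    (hp : p ∈ Submodule.span K {x, y}) (hp0 : p ≠ 0) : ∃ a : F, a ≠ 0 ∧ a • p ∈ Λ₁ := by
  have := finite_subfield (F := F) K
  have hpΛ : p ∈ Λ := by
    obtain ⟨a, b, rfl⟩ := Submodule.mem_span_pair.1 hp
    exact Λ.add_mem (Λ.smul_mem _ ht.mem_left) (Λ.smul_mem _ ht.mem_mid)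
  obtain ⟨Λ', hΛ'⟩ := h.spanB p (hΛ.mem p hpΛ hp0)
  obtain ⟨a, ha, haw⟩ := h.mutual hw hΛ hpΛ hp0 hΛ'
  have hW0 : a • w ≠ 0 := smul_ne_zero ha hw.1
  have hΛW := hΛ.smul_normal a
  -- The line through `x` and `y` is also a secant for `Λ'`: `transfer` is applied to one of `x`,
  -- `y` not proportional to `p`, and orthogonality to the other follows from orthogonality to `p`.
  obtain ⟨u, hu, huw, hux, huy⟩ : ∃ u ∈ Λ', (∀ k : F, u ≠ k • a • w) ∧ u ⬝ᵥ x = 0 ∧ u ⬝ᵥ y = 0 := by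
    have horth : ∀ u ∈ Λ', u ⬝ᵥ p = 0 := fun u hu => by
      rw [dotProduct_comm]; exact hΛ'.orth u hu
    obtain ⟨α, β, rfl⟩ := Submodule.mem_span_pair.1 hp
    by_cases hβ : β = 0
    · have hα : α ≠ 0 := by
        rintro rfl
        simp [hβ] at hp0
      obtain ⟨u, hu, huw, huv⟩ := h.transfer hΛW hpΛ hp0 hΛ' haw hW0 ht.mem_mid
      refine ⟨u, hu, huw, ?_, huv⟩
      have := horth u hu
      rw [dotProduct_add, dotProduct_smul, dotProduct_smul, huv, smul_zero, add_zero] at this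
      exact (smul_eq_zero.1 this).resolve_left hα
    · obtain ⟨u, hu, huw, huv⟩ := h.transfer hΛW hpΛ hp0 hΛ' haw hW0 ht.mem_left
      refine ⟨u, hu, huw, huv, ?_⟩
      have := horth u hu
      rw [dotProduct_add, dotProduct_smul, dotProduct_smul, huv, smul_zero, zero_add] at this
      exact (smul_eq_zero.1 this).resolve_left hβ
  obtain ⟨_, _, _, ht'⟩ := hΛ'.triple
  have hi : LinearIndependent K ![a • w, u] :=
    (ht'.isScalarClosed.pair_indep haw hu hW0).2 fun k hk => huw k hk.symm
  have hixy : LinearIndependent F ![x, y] := by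
    rw [LinearIndependent.pair_iff]
    intro k l hkl
    obtain ⟨h1, h2, -⟩ := combo_eq_zero ht.indep (a := k) (b := l) (c := 0) (by simpa using hkl)
    exact ⟨h1, h2⟩
  have hixyK : LinearIndependent K ![x, y] := LinearIndependent.restrict_scalars (K := F)
    (fun a b hab => by simpa [Algebra.smul_def] using hab) hixy
  have hle : Submodule.span F {a • w, u} ≤ perp (Submodule.span F {x, y}) := by
    rw [Submodule.span_le]
    rintro v (rfl | rfl)
    · refine mem_perp_pair.2 ⟨?_, ?_⟩ <;>
        rw [dotProduct_comm, smul_dotProduct, hΛ.orth _ (by first | exact ht.mem_left | exact ht.mem_mid), smul_zero]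
    · exact mem_perp_pair.2 ⟨by rw [dotProduct_comm, hux], by rw [dotProduct_comm, huy]⟩
  -- The line is clean, so only s + 1 planes of `B` contain it. The Baer subline of `Λ'` through `a
  -- • w` and `u` already provides that many, so `w'` is one of them.
  have heq : subPts (Submodule.span K {a • w, u}) = B ∩ pts (perp (Submodule.span F {x, y})) := by
    refine Set.eq_of_subset_of_ncard_le ?_ ?_ (Set.toFinite _)
    · exact (subPts_span_subset hΛ' haw hu).trans (Set.inter_subset_inter_right _ (pts_mono hle))
    · rw [← h.line _ (finrank_pair hixy), ncard_subPts_pair ht'.isScalarClosed haw hu hi,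
        ← ncard_subPts_pair ht.isScalarClosed ht.mem_left ht.mem_mid hixyK]
      exact Set.ncard_le_ncard hc (Set.toFinite _)
  have hw'm : Projectivization.mk F w' hw'.1 ∈ subPts (Submodule.span K {a • w, u}) := by
    rw [heq]
    refine ⟨hw'.2, ?_⟩
    rw [mk_mem_pts, mem_perp_pair, dotProduct_comm, hx, dotProduct_comm, hy]
    exact ⟨rfl, rfl⟩
  rw [mk_mem_subPts] at hw'm
  obtain ⟨r, hr, hrw⟩ := hw'm
  have hrΛ : r • w' ∈ Λ' := by
    obtain ⟨k, l, hkl⟩ := Submodule.mem_span_pair.1 hrw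
    rw [← hkl]
    exact Λ'.add_mem (Λ'.smul_mem _ haw) (Λ'.smul_mem _ hu)
  exact h.swap.mutual (hΛ.mem p hpΛ hp0) hΛ' hrΛ (smul_ne_zero hr hw'.1) (hΛ₁.smul_normal r)

/-- Two planes of `B` on a common line, with Baer subplanes that agree on this line. -/
structure BaerFrame (A B : Set (Pt F 4)) (w₁ w₂ x y z t : Fin 4 → F)
    (Λ₁ Λ₂ : Submodule K (Fin 4 → F)) : Prop where
  memB₁ : w₁ ∈ vecs B
  memB₂ : w₂ ∈ vecs B
  ne₂₁ : ∀ a : F, w₂ ≠ a • w₁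
  ne₁₂ : ∀ a : F, w₁ ≠ a • w₂
  span₁ : IsPlaneSpan A w₁ Λ₁
  span₂ : IsPlaneSpan A w₂ Λ₂
  triple₁ : IsTriple F Λ₁ x y z
  triple₂ : IsTriple F Λ₂ x y t

/-- The second plane is any other plane of `B` on a clean secant of the first. By `mutual_of_clean`
its Baer subplane contains the Baer subline up to scalars, and the points of `x`, `y`, `x + y`
suffice to adjust these scalars to a common one. -/
theorem BaerPair.exists_frame {A B : Set (Pt F 4)} {n : ℕ} (h : BaerPair K A B n)
    (hB : (vecs B).Nonempty) : ∃ (w₁ w₂ x y z t : Fin 4 → F) (Λ₁ Λ₂ : Submodule K (Fin 4 → F)),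
      BaerFrame A B w₁ w₂ x y z t Λ₁ Λ₂ := by
  have := finite_subfield (F := F) K
  obtain ⟨w, hw⟩ := hB
  obtain ⟨Λ, hΛ⟩ := h.spanA w hw
  obtain ⟨x, y, z, ht, hc⟩ := h.exists_clean hw hΛ
  have hixy : LinearIndependent F ![x, y] := by
    rw [LinearIndependent.pair_iff]
    intro k l hkl
    obtain ⟨h1, h2, -⟩ := combo_eq_zero ht.indep (a := k) (b := l) (c := 0) (by simpa using hkl)
    exact ⟨h1, h2⟩
  have hixyK : LinearIndependent K ![x, y] := LinearIndependent.restrict_scalars (K := F)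
    (fun a b hab => by simpa [Algebra.smul_def] using hab) hixy
  have hx0 : x ≠ 0 := hixy.ne_zero 0
  have hy0 : y ≠ 0 := hixy.ne_zero 1
  have hcard : 1 < (B ∩ pts (perp (Submodule.span F {x, y}))).ncard := by
    rw [← h.line _ (finrank_pair hixy)]
    refine lt_of_lt_of_le ?_ (Set.ncard_le_ncard (subPts_span_subset hΛ ht.mem_left ht.mem_mid)
      (Set.toFinite _))
    rw [ncard_subPts_pair ht.isScalarClosed ht.mem_left ht.mem_mid hixyK]
    have := Finite.one_lt_card (α := K)
    omega
  obtain ⟨Q, hQ, hQw⟩ := Set.exists_ne_of_one_lt_ncard hcard (Projectivization.mk F w hw.1)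
  induction Q using Projectivization.ind with | h w' hw'0 => ?_
  have hw' : w' ∈ vecs B := ⟨hw'0, hQ.1⟩
  have horth := hQ.2
  rw [mk_mem_pts, mem_perp_pair, dotProduct_comm, dotProduct_comm y] at horth
  have hne : ∀ a : F, w' ≠ a • w := fun a ha =>
    hQw ((mk_eq_mk_iff' F _ _ _ _).2 ⟨a, ha.symm⟩)
  have hne' : ∀ a : F, w ≠ a • w' := fun a ha =>
    hQw ((mk_eq_mk_iff' F _ _ _ _).2 ⟨a, ha.symm⟩).symm
  obtain ⟨Λ₀, hΛ₀⟩ := h.spanA w' hw'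
  obtain ⟨a, ha, hax⟩ := h.mutual_of_clean hw hΛ ht hc hw' horth.1 horth.2 hΛ₀
    (Submodule.subset_span (by simp) : x ∈ Submodule.span K {x, y}) hx0
  obtain ⟨Λ₂, hΛ₂, hmem⟩ := hΛ₀.exists_smul ha
  have hx₂ : x ∈ Λ₂ := (hmem x).2 hax
  have key := fun p hp hp0 => h.mutual_of_clean hw hΛ ht hc hw' horth.1 horth.2 hΛ₂ (p := p) hp hp0
  obtain ⟨b, hb, hby⟩ := key y (Submodule.subset_span (by simp)) hy0
  have hxy0 : x + y ≠ 0 := fun h0 => by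
    have := LinearIndependent.pair_iff.1 hixy 1 1 (by simpa using h0)
    exact one_ne_zero this.1
  obtain ⟨c, hc0, hcxy⟩ := key (x + y)
    (Submodule.add_mem _ (Submodule.subset_span (by simp)) (Submodule.subset_span (by simp))) hxy0
  obtain ⟨_, _, _, ht₂⟩ := hΛ₂.triple
  have hi₂ : LinearIndependent K ![x, b • y] := by
    refine (ht₂.isScalarClosed.pair_indep hx₂ hby hx0).2 fun k hk => ?_
    have := LinearIndependent.pair_iff.1 hixy k (-b) (by rw [hk, neg_smul, add_neg_cancel])
    exact hb (neg_eq_zero.1 this.2)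
  obtain ⟨_, ht₃⟩ := ht₂.exists_of_mem₂ hx₂ hby hi₂
  -- In the basis starting with `x`, `b • y`, the vector `c • (x + y)` has coordinates `c` and `c /
  -- b`. Both are therefore in `K`, and so is their quotient, which is what brings `y` itself into
  -- `Λ₂`.
  obtain ⟨k, l, _, hk, hl, -⟩ := ht₃.coords_mem (a := c) (b := c / b) (c := 0) (by
    rw [smul_smul, div_mul_cancel₀ _ hb, zero_smul, add_zero, ← smul_add]
    exact hcxy)
  have hy₂ : y ∈ Λ₂ := by
    have h1 : (l / k) • b • y ∈ Λ₂ := Λ₂.smul_mem _ hby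
    rw [← algebraMap_smul F, map_div₀, hk, hl, smul_smul] at h1
    have e : c / b / c * b = 1 := by field_simp
    rwa [e, one_smul] at h1
  obtain ⟨t, ht₄⟩ := ht₂.exists_of_mem₂ hx₂ hy₂ hixyK
  exact ⟨w, w', x, y, z, t, Λ, Λ₂, ⟨hw, hw', hne, hne', hΛ, hΛ₂, ht, ht₄⟩⟩

/-- Two Baer sublines of a Baer plane have a common point. -/
theorem exists_common {E : Type*} [AddCommGroup E] [Module K E] {Λ : Submodule K E}
    (hΛ : finrank K Λ = 3) {x y z t : E} (hx : x ∈ Λ) (hy : y ∈ Λ) (hz : z ∈ Λ) (ht : t ∈ Λ)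
    (h1 : LinearIndependent K ![x, y]) (h2 : LinearIndependent K ![z, t]) :
    ∃ v ∈ Λ, v ≠ 0 ∧ (∃ a b : K, a • x + b • y = v) ∧ ∃ a b : K, a • z + b • t = v := by
  have hfd : FiniteDimensional K Λ := FiniteDimensional.of_finrank_pos (by rw [hΛ]; norm_num)
  have hle : ∀ x y : E, x ∈ Λ → y ∈ Λ → Submodule.span K {x, y} ≤ Λ := by
    intro x y hx hy
    rw [Submodule.span_le]
    rintro v (rfl | rfl) <;> assumption
  have : FiniteDimensional K (Submodule.span K {x, y}) := FiniteDimensional.span_of_finite K (by simp)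
  have : FiniteDimensional K (Submodule.span K {z, t}) := FiniteDimensional.span_of_finite K (by simp)
  have h3 := Submodule.finrank_sup_add_finrank_inf_eq (Submodule.span K {x, y}) (Submodule.span K {z, t})
  have h4 : finrank K ↥(Submodule.span K {x, y} ⊔ Submodule.span K {z, t}) ≤ 3 := by
    rw [← hΛ]
    exact Submodule.finrank_mono (sup_le (hle _ _ hx hy) (hle _ _ hz ht))
  rw [finrank_pair h1, finrank_pair h2] at h3
  obtain ⟨v, hv, hv0⟩ := (Submodule.ne_bot_iff _).1 (Submodule.one_le_finrank_iff.1
    (show 1 ≤ finrank K ↥(Submodule.span K {x, y} ⊓ Submodule.span K {z, t}) by omega))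
  exact ⟨v, hle _ _ hx hy hv.1, hv0, Submodule.mem_span_pair.1 hv.1, Submodule.mem_span_pair.1 hv.2⟩

end

/-! ### The dual lattice of a frame lies in `B` -/

section

variable {K : Type*} [Field K] [Algebra K F] [Finite F]

section Frame

variable {A B : Set (Pt F 4)} {n : ℕ} {w₁ w₂ x y z t : Fin 4 → F}
  {Λ₁ Λ₂ : Submodule K (Fin 4 → F)}

/-- The plane of `w₂` is spanned by `x`, `y`, `t`; were `w₁` orthogonal to all three, it would be
proportional to `w₂`. -/
theorem BaerFrame.dot_ne₁ (hf : BaerFrame A B w₁ w₂ x y z t Λ₁ Λ₂) : w₁ ⬝ᵥ t ≠ 0 := fun h0 => by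
  have orth : ∀ v ∈ Λ₂, v ⬝ᵥ w₂ = 0 := fun u hu => by
    rw [dotProduct_comm]; exact hf.span₂.orth u hu
  obtain ⟨a, ha⟩ := eq_smul_of_orth (v := w₁) hf.memB₂.1 hf.triple₂.indep
    (hf.span₂.orth _ hf.triple₂.mem_left) (hf.span₂.orth _ hf.triple₂.mem_mid)
    (hf.span₂.orth _ hf.triple₂.mem_right)
    (by rw [dotProduct_comm]; exact hf.span₁.orth _ hf.triple₁.mem_left)
    (by rw [dotProduct_comm]; exact hf.span₁.orth _ hf.triple₁.mem_mid)
    (by rw [dotProduct_comm]; exact h0)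
  exact hf.ne₁₂ a ha

theorem BaerFrame.symm (hf : BaerFrame A B w₁ w₂ x y z t Λ₁ Λ₂) :
    BaerFrame A B w₂ w₁ x y t z Λ₂ Λ₁ :=
  ⟨hf.memB₂, hf.memB₁, hf.ne₁₂, hf.ne₂₁, hf.span₂, hf.span₁, hf.triple₂, hf.triple₁⟩

/-- Besides `c₂ • x - c₁ • y`, this is a second point of the line in which the plane `f` meets `Λ₁`,
off the common line of the two planes. -/
theorem BaerFrame.exists_orth (hf : BaerFrame A B w₁ w₂ x y z t Λ₁ Λ₂) {f : Fin 4 → F}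
    {c₁ c₂ c₃ : K} (h₁ : f ⬝ᵥ x = algebraMap K F c₁) (h₂ : f ⬝ᵥ y = algebraMap K F c₂)
    (h₃ : f ⬝ᵥ z = algebraMap K F c₃) (hc : ¬ (c₁ = 0 ∧ c₂ = 0)) :
    ∃ v ∈ Λ₁, f ⬝ᵥ v = 0 ∧ w₂ ⬝ᵥ v ≠ 0 := by
  have hx := hf.span₂.orth _ hf.triple₂.mem_left
  have hy := hf.span₂.orth _ hf.triple₂.mem_mid
  have hz := hf.symm.dot_ne₁
  by_cases hc₁ : c₁ = 0
  · have hc₂ : c₂ ≠ 0 := fun h => hc ⟨hc₁, h⟩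
    refine ⟨c₃ • y - c₂ • z, Λ₁.sub_mem (Λ₁.smul_mem _ hf.triple₁.mem_mid)
      (Λ₁.smul_mem _ hf.triple₁.mem_right), ?_, ?_⟩
    · rw [dotProduct_sub, dotProduct_smul, dotProduct_smul, h₂, h₃, Algebra.smul_def,
        Algebra.smul_def, mul_comm, sub_self]
    · rw [dotProduct_sub, dotProduct_smul, dotProduct_smul, hy, smul_zero, zero_sub, neg_ne_zero]
      exact smul_ne_zero hc₂ hz
  · refine ⟨c₃ • x - c₁ • z, Λ₁.sub_mem (Λ₁.smul_mem _ hf.triple₁.mem_left)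
      (Λ₁.smul_mem _ hf.triple₁.mem_right), ?_, ?_⟩
    · rw [dotProduct_sub, dotProduct_smul, dotProduct_smul, h₁, h₃, Algebra.smul_def,
        Algebra.smul_def, mul_comm, sub_self]
    · rw [dotProduct_sub, dotProduct_smul, dotProduct_smul, hx, smul_zero, zero_sub, neg_ne_zero]
      exact smul_ne_zero hc₁ hz

/-- The plane `f` meets `Λ₁` and `Λ₂` in two secants through P = `c₂ • x - c₁ • y`. By `transfer`,
each of them is the axis of a Baer subline of planes in the dual Baer subplane `Λ'` at P. Two Baer
sublines of `Λ'` share a plane, and a plane containing both secants is `f`. -/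
theorem BaerFrame.smul_mem_dual (h : BaerPair K A B n) (hf : BaerFrame A B w₁ w₂ x y z t Λ₁ Λ₂)
    {f : Fin 4 → F} (hf0 : f ≠ 0) {c₁ c₂ c₃ c₄ : K} (h₁ : f ⬝ᵥ x = algebraMap K F c₁)
    (h₂ : f ⬝ᵥ y = algebraMap K F c₂) (h₃ : f ⬝ᵥ z = algebraMap K F c₃)
    (h₄ : f ⬝ᵥ t = algebraMap K F c₄) (hc : ¬ (c₁ = 0 ∧ c₂ = 0)) {Λ' : Submodule K (Fin 4 → F)}
    (hΛ' : IsPlaneSpan B (c₂ • x - c₁ • y) Λ') : ∃ a : F, a ≠ 0 ∧ a • f ∈ Λ' := by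
  obtain ⟨v₁, hv₁, hfv₁, hwv₁⟩ := hf.exists_orth h₁ h₂ h₃ hc
  obtain ⟨v₂, hv₂, hfv₂, hwv₂⟩ := hf.symm.exists_orth h₁ h₂ h₄ hc
  set P := c₂ • x - c₁ • y with hP
  have hP₁ : P ∈ Λ₁ := Λ₁.sub_mem (Λ₁.smul_mem _ hf.triple₁.mem_left)
    (Λ₁.smul_mem _ hf.triple₁.mem_mid)
  have hP₂ : P ∈ Λ₂ := Λ₂.sub_mem (Λ₂.smul_mem _ hf.triple₂.mem_left)
    (Λ₂.smul_mem _ hf.triple₂.mem_mid)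
  have hP0 : P ≠ 0 := fun h0 => by
    have := hf.triple₁.combo_eq_zero (a := c₂) (b := -c₁) (c := 0) (by
      rw [neg_smul, zero_smul, add_zero, ← sub_eq_add_neg]; exact h0)
    exact hc ⟨neg_eq_zero.1 this.2.1, this.1⟩
  have hfP : f ⬝ᵥ P = 0 := by
    rw [hP, dotProduct_sub, dotProduct_smul, dotProduct_smul, h₁, h₂, Algebra.smul_def,
      Algebra.smul_def, mul_comm, sub_self]
  obtain ⟨a₁, ha₁, hm₁⟩ := h.mutual hf.memB₁ hf.span₁ hP₁ hP0 hΛ'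
  obtain ⟨a₂, ha₂, hm₂⟩ := h.mutual hf.memB₂ hf.span₂ hP₂ hP0 hΛ'
  have hw₁ : a₁ • w₁ ≠ 0 := smul_ne_zero ha₁ hf.memB₁.1
  have hw₂ : a₂ • w₂ ≠ 0 := smul_ne_zero ha₂ hf.memB₂.1
  obtain ⟨u₁, hu₁, hn₁, hd₁⟩ := h.transfer (hf.span₁.smul_normal a₁) hP₁ hP0 hΛ' hm₁ hw₁ hv₁
  obtain ⟨u₂, hu₂, hn₂, hd₂⟩ := h.transfer (hf.span₂.smul_normal a₂) hP₂ hP0 hΛ' hm₂ hw₂ hv₂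
  obtain ⟨_, _, _, ht'⟩ := hΛ'.triple
  have hi₁ := (ht'.isScalarClosed.pair_indep hm₁ hu₁ hw₁).2 fun k hk => hn₁ k hk.symm
  have hi₂ := (ht'.isScalarClosed.pair_indep hm₂ hu₂ hw₂).2 fun k hk => hn₂ k hk.symm
  obtain ⟨u, hu, hu0, ⟨α, β, e₁⟩, ⟨γ, ε, e₂⟩⟩ :=
    exists_common ht'.finrank_eq hm₁ hu₁ hm₂ hu₂ hi₁ hi₂
  have hind : LinearIndependent F ![P, v₁, v₂] := indep_triple fun a b c habc => by
    have k1 := congrArg (w₁ ⬝ᵥ ·) habc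
    have k2 := congrArg (w₂ ⬝ᵥ ·) habc
    simp only [dotProduct_add, dotProduct_smul, hf.span₁.orth _ hP₁, hf.span₁.orth _ hv₁,
      hf.span₂.orth _ hP₂, hf.span₂.orth _ hv₂, dotProduct_zero, smul_zero, add_zero, zero_add,
      smul_eq_zero] at k1 k2
    have k1 := k1.resolve_right hwv₂
    have k2 := k2.resolve_right hwv₁
    rw [k1, k2, zero_smul, zero_smul, add_zero, add_zero, smul_eq_zero] at habc
    exact ⟨habc.resolve_right hP0, k2, k1⟩
  obtain ⟨k, hk⟩ := eq_smul_of_orth (v := f) hu0 hind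
    (by rw [dotProduct_comm]; exact hΛ'.orth _ hu)
    (by rw [← e₁, add_dotProduct, smul_dotProduct, smul_dotProduct, smul_dotProduct, hd₁,
          hf.span₁.orth _ hv₁]; simp)
    (by rw [← e₂, add_dotProduct, smul_dotProduct, smul_dotProduct, smul_dotProduct, hd₂,
          hf.span₂.orth _ hv₂]; simp)
    (by rw [dotProduct_comm, hfP]) (by rw [dotProduct_comm, hfv₁]) (by rw [dotProduct_comm, hfv₂])
  have hk0 : k ≠ 0 := by
    rintro rfl
    exact hf0 (by rw [hk, zero_smul])
  exact ⟨k⁻¹, inv_ne_zero hk0, by rwa [hk, inv_smul_smul₀ hk0]⟩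

theorem BaerFrame.indep (hf : BaerFrame A B w₁ w₂ x y z t Λ₁ Λ₂) :
    LinearIndependent F ![x, y, z, t] := by
  rw [Fintype.linearIndependent_iff]
  intro g hg
  have hg' : g 0 • x + g 1 • y + g 2 • z + g 3 • t = 0 := by
    simpa [Fin.sum_univ_four] using hg
  have h1 := congrArg (w₁ ⬝ᵥ ·) hg'
  simp only [dotProduct_add, dotProduct_smul, hf.span₁.orth _ hf.triple₁.mem_left,
    hf.span₁.orth _ hf.triple₁.mem_mid, hf.span₁.orth _ hf.triple₁.mem_right, dotProduct_zero,
    smul_zero, add_zero, zero_add, smul_eq_zero] at h1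
  have h1 := h1.resolve_right hf.dot_ne₁
  rw [h1, zero_smul, add_zero] at hg'
  obtain ⟨h2, h3, h4⟩ := combo_eq_zero hf.triple₁.indep hg'
  intro i
  fin_cases i <;> assumption

/-- If `f` does not contain the common line of the frame, `smul_mem_dual` applies. Otherwise the
planes `g` and `g + f` are of that kind, and in the dual Baer subplane at `x` the Baer subline
through them meets the one through `w₁` and `w₂` in `f`. -/
theorem BaerFrame.mem_of_coords (h : BaerPair K A B n) (hf : BaerFrame A B w₁ w₂ x y z t Λ₁ Λ₂)
    {f g : Fin 4 → F} (hf0 : f ≠ 0) {c₁ c₂ c₃ c₄ : K} (h₁ : f ⬝ᵥ x = algebraMap K F c₁)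
    (h₂ : f ⬝ᵥ y = algebraMap K F c₂) (h₃ : f ⬝ᵥ z = algebraMap K F c₃)
    (h₄ : f ⬝ᵥ t = algebraMap K F c₄) (hgx : g ⬝ᵥ x = 0) (hgy : g ⬝ᵥ y = 1) (hgz : g ⬝ᵥ z = 0)
    (hgt : g ⬝ᵥ t = 0) : f ∈ vecs B := by
  by_cases hc : c₁ = 0 ∧ c₂ = 0
  · obtain ⟨rfl, rfl⟩ := hc
    have hx0 : x ≠ 0 := hf.triple₁.indep.ne_zero 0
    obtain ⟨Λ', hΛ'⟩ := h.spanB x (hf.span₁.mem x hf.triple₁.mem_left hx0)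
    have hg0 : g ≠ 0 := by
      rintro rfl
      simp at hgy
    have hgf0 : g + f ≠ 0 := by
      intro h0
      have := congrArg (· ⬝ᵥ y) h0
      simp [add_dotProduct, hgy, h₂] at this
    have hΛ'' : IsPlaneSpan B ((1 : K) • x - (0 : K) • y) Λ' := by simpa using hΛ'
    obtain ⟨a, ha, hag⟩ := hf.smul_mem_dual h hg0 (c₁ := 0) (c₂ := 1) (c₃ := 0) (c₄ := 0)
      (by simpa using hgx) (by simpa using hgy) (by simpa using hgz) (by simpa using hgt)
      (by simp) hΛ''
    obtain ⟨b, hb, hbg⟩ := hf.smul_mem_dual h hgf0 (c₁ := 0) (c₂ := 1) (c₃ := c₃) (c₄ := c₄)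
      (by simp [add_dotProduct, hgx, h₁]) (by simp [add_dotProduct, hgy, h₂])
      (by simp [add_dotProduct, hgz, h₃]) (by simp [add_dotProduct, hgt, h₄]) (by simp) hΛ''
    obtain ⟨a₁, ha₁, hm₁⟩ := h.mutual hf.memB₁ hf.span₁ hf.triple₁.mem_left hx0 hΛ'
    obtain ⟨a₂, ha₂, hm₂⟩ := h.mutual hf.memB₂ hf.span₂ hf.triple₂.mem_left hx0 hΛ'
    obtain ⟨_, _, _, ht'⟩ := hΛ'.triple
    have hi₁ := (ht'.isScalarClosed.pair_indep hm₁ hm₂ (smul_ne_zero ha₁ hf.memB₁.1)).2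
      fun k hk => hf.ne₂₁ (a₂⁻¹ * (k * a₁)) (by
        rw [mul_smul, mul_smul, hk, inv_smul_smul₀ ha₂])
    have hi₂ := (ht'.isScalarClosed.pair_indep hag hbg (smul_ne_zero ha hg0)).2 fun k hk => by
      have h1 := congrArg (· ⬝ᵥ y) hk
      simp only [smul_dotProduct, add_dotProduct, hgy, h₂, map_zero, add_zero, smul_eq_mul,
        mul_one] at h1
      rw [smul_smul, h1, smul_add, left_eq_add, smul_eq_zero] at hk
      exact hk.elim hb hf0
    obtain ⟨u, hu, hu0, ⟨α, β, e₁⟩, ⟨γ, ε, e₂⟩⟩ :=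
      exists_common ht'.finrank_eq hm₁ hm₂ hag hbg hi₁ hi₂
    have huy : u ⬝ᵥ y = 0 := by
      rw [← e₁]
      simp [add_dotProduct, smul_dotProduct, hf.span₁.orth _ hf.triple₁.mem_mid,
        hf.span₂.orth _ hf.triple₂.mem_mid]
    -- Orthogonality to `y` cancels the `g`-part of `u`, and a multiple of `f` remains.
    have h5 : γ • a + ε • b = 0 := by
      rw [← huy, ← e₂]
      simp [add_dotProduct, smul_dotProduct, hgy, h₂]
    have h6 : (ε • b) • f = u := by
      rw [← e₂, smul_add b, smul_add ε, ← smul_assoc, ← smul_assoc, ← smul_assoc, ← add_assoc,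
        ← add_smul, h5, zero_smul, zero_add]
    have h7 : ε • b ≠ 0 := fun h0 => hu0 (by rw [← h6, h0, zero_smul])
    exact (smul_mem_vecs h7).1 (h6 ▸ hΛ'.mem u hu hu0)
  · have hP0 : c₂ • x - c₁ • y ≠ 0 := fun h0 => by
      have := hf.triple₁.combo_eq_zero (a := c₂) (b := -c₁) (c := 0) (by
        rw [neg_smul, zero_smul, add_zero, ← sub_eq_add_neg]; exact h0)
      exact hc ⟨neg_eq_zero.1 this.2.1, this.1⟩
    obtain ⟨Λ', hΛ'⟩ := h.spanB _ (hf.span₁.mem _ (Λ₁.sub_mem (Λ₁.smul_mem c₂ hf.triple₁.mem_left)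
      (Λ₁.smul_mem c₁ hf.triple₁.mem_mid)) hP0)
    obtain ⟨a, ha, haf⟩ := hf.smul_mem_dual h hf0 h₁ h₂ h₃ h₄ hc hΛ'
    exact (smul_mem_vecs ha).1 (hΛ'.mem _ haf (smul_ne_zero ha hf0))

end Frame

end

section

/-! ### Baer subgeometries of rank 4 given by dual bases -/

section Lattice

variable (K : Type*) [Field K] [Algebra K F]

/-- The vectors with coordinates in `K` with respect to `b`. -/
def latMap (b : Fin 4 → Fin 4 → F) : (Fin 4 → K) →ₗ[K] (Fin 4 → F) := Fintype.linearCombination K b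

/-- The points with coordinates in `K` with respect to `b`. -/
def baerPts (b : Fin 4 → Fin 4 → F) : Set (Pt F 4) := subPts (LinearMap.range (latMap K b))

variable {K}

theorem latMap_apply (b : Fin 4 → Fin 4 → F) (c : Fin 4 → K) : latMap K b c = ∑ i, c i • b i :=
  Fintype.linearCombination_apply K b c

theorem latMap_dot (b : Fin 4 → Fin 4 → F) (c : Fin 4 → K) (v : Fin 4 → F) :
    latMap K b c ⬝ᵥ v = ∑ i, c i • (b i ⬝ᵥ v) := by
  rw [latMap_apply, sum_dotProduct]
  simp only [smul_dotProduct]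

/-- Bases dual to each other for the dot product. -/
def DualBases (b b' : Fin 4 → Fin 4 → F) : Prop := ∀ i j, b i ⬝ᵥ b' j = if i = j then 1 else 0

theorem DualBases.symm {b b' : Fin 4 → Fin 4 → F} (h : DualBases b b') : DualBases b' b :=
  fun i j => by rw [dotProduct_comm, h j i]; simp [eq_comm]

theorem DualBases.coord {b b' : Fin 4 → Fin 4 → F} (h : DualBases b b') (c : Fin 4 → K)
    (i : Fin 4) : latMap K b c ⬝ᵥ b' i = algebraMap K F (c i) := by
  rw [latMap_dot]
  simp [h _ i, Algebra.smul_def]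

theorem DualBases.dot {b b' : Fin 4 → Fin 4 → F} (h : DualBases b b') (c d : Fin 4 → K) :
    latMap K b c ⬝ᵥ latMap K b' d = algebraMap K F (c ⬝ᵥ d) := by
  rw [dotProduct_comm, latMap_dot]
  simp only [dotProduct_comm (b' _), h.coord]
  simp [dotProduct, Algebra.smul_def, mul_comm]

theorem DualBases.injective {b b' : Fin 4 → Fin 4 → F} (h : DualBases b b') :
    Function.Injective (latMap K b) := by
  intro c d hcd
  ext i
  apply (algebraMap K F).injective
  rw [← h.coord, ← h.coord, hcd]

theorem DualBases.isScalarClosed {b b' : Fin 4 → Fin 4 → F} (h : DualBases b b') :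
    IsScalarClosed F (LinearMap.range (latMap K b)) := by
  rintro _ ⟨c, rfl⟩ hc0 a ⟨d, hd⟩
  have hc : c ≠ 0 := fun h0 => hc0 (by rw [h0, map_zero])
  obtain ⟨i, hi⟩ := Function.ne_iff.1 hc
  have h1 := congrArg (· ⬝ᵥ b' i) hd
  simp only [smul_dotProduct, h.coord, smul_eq_mul] at h1
  refine ⟨d i / c i, ?_⟩
  rw [map_div₀, h1, mul_div_cancel_right₀]
  exact (map_ne_zero _).2 hi

theorem DualBases.ncard [Finite F] {b b' : Fin 4 → Fin 4 → F} (h : DualBases b b')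
    (N : Submodule K (Fin 4 → K)) {n : ℕ} (hn : finrank K N = n) :
    (subPts (F := F) (N.map (latMap K b))).ncard = ∑ i ∈ Finset.range n, Nat.card K ^ i := by
  have := finite_subfield (F := F) K
  refine ncard_subPts (h.isScalarClosed.mono (LinearMap.map_le_range)) ?_
  rw [← (Submodule.equivMapOfInjective _ h.injective N).finrank_eq, hn]

theorem DualBases.linearIndependent {b b' : Fin 4 → Fin 4 → F} (h : DualBases b b') :
    LinearIndependent F b := by
  rw [Fintype.linearIndependent_iff]
  intro g hg i
  have h1 := h.coord g i
  rw [latMap_apply, hg, zero_dotProduct] at h1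
  exact h1.symm

theorem DualBases.expand {b b' : Fin 4 → Fin 4 → F} (h : DualBases b b') (v : Fin 4 → F) :
    v = ∑ i, (b' i ⬝ᵥ v) • b i := by
  have hs : Function.Surjective (latMap F b) := LinearMap.injective_iff_surjective.1 h.injective
  obtain ⟨c, rfl⟩ := hs v
  rw [latMap_apply]
  refine Finset.sum_congr rfl fun i _ => ?_
  rw [← latMap_apply, dotProduct_comm, h.coord]
  rfl

theorem exists_dualBases {b : Fin 4 → Fin 4 → F} (hb : LinearIndependent F b) :
    ∃ b', DualBases b b' := by
  let B := basisOfLinearIndependentOfCardEqFinrank hb (by simp)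
  refine ⟨dotForm.dualBasis dotForm_nondegenerate B, fun i j => ?_⟩
  have := LinearMap.BilinForm.apply_dualBasis_left dotForm_nondegenerate B j i
  rw [dotForm_apply, dotProduct_comm] at this
  rw [← this]
  simp [B]

/-- A Cameron-Liebler pair without lines contains a Baer subgeometry. -/
theorem BaerPair.exists_baer [Finite F] {A B : Set (Pt F 4)} {n : ℕ} (h : BaerPair K A B n)
    (hB : (vecs B).Nonempty) :
    ∃ b b', DualBases b b' ∧ baerPts K b ⊆ A ∧ baerPts K b' ⊆ B := by
  have := finite_subfield (F := F) K
  obtain ⟨w₁, w₂, x, y, z, t, Λ₁, Λ₂, hf⟩ := h.exists_frame hB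
  obtain ⟨b', hd⟩ := exists_dualBases hf.indep
  have hmemB : ∀ d : Fin 4 → K, latMap K b' d ≠ 0 → latMap K b' d ∈ vecs B := by
    intro d hd0
    exact hf.mem_of_coords h hd0 (hd.symm.coord d 0) (hd.symm.coord d 1) (hd.symm.coord d 2)
      (hd.symm.coord d 3) (hd.symm 1 0) (hd.symm 1 1) (hd.symm 1 2) (hd.symm 1 3)
  refine ⟨_, b', hd, ?_, ?_⟩
  · rintro _ ⟨_, ⟨c, rfl⟩, h0, rfl⟩
    rw [mk_mem_iff]
    by_contra hcon
    have hc : c ≠ 0 := fun hc => h0 (by rw [hc, map_zero])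
    have h1 := h.poorB _ h0 hcon
    -- The dual lattice has s² + s + 1 planes through the point, all in `B`; a point outside `A` is
    -- on only n ≤ s² planes of `B`.
    have h2 : finrank K (perp (K ∙ c)) = 3 := by rw [finrank_perp, finrank_span_singleton hc]
    have h3 := hd.symm.ncard _ h2
    have h4 : subPts (F := F) ((perp (K ∙ c)).map (latMap K b')) ⊆
        B ∩ pts (perp (F ∙ latMap K ![x, y, z, t] c)) := by
      rintro _ ⟨_, ⟨d, hdc, rfl⟩, hd0, rfl⟩
      refine ⟨(hmemB d hd0).2, ?_⟩
      rw [mk_mem_pts, mem_perp_span_singleton, hd.dot, mem_perp_span_singleton.1 hdc, map_zero]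
    have h5 := Set.ncard_le_ncard h4 (Set.toFinite _)
    rw [h3, h1] at h5
    have h6 := h.le_card
    rw [h.card_eq] at h6
    simp [Finset.sum_range_succ] at h5
    omega
  · rintro _ ⟨_, ⟨d, rfl⟩, h0, rfl⟩
    exact (hmemB d h0).2

/-- The linear form `c ↦ latMap b c ⬝ᵥ v`. -/
def latForm (K : Type*) [Field K] [Algebra K F] (b : Fin 4 → Fin 4 → F) (v : Fin 4 → F) :
    (Fin 4 → K) →ₗ[K] F := ((dotForm v).restrictScalars K).comp (latMap K b)

theorem latForm_apply (b : Fin 4 → Fin 4 → F) (v : Fin 4 → F) (c : Fin 4 → K) :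
    latForm K b v c = latMap K b c ⬝ᵥ v :=
  (dotProduct_comm _ _ : v ⬝ᵥ latMap K b c = _)

theorem baerPts_inter (b : Fin 4 → Fin 4 → F) (v : Fin 4 → F) :
    baerPts K b ∩ pts (perp (F ∙ v)) =
      subPts ((LinearMap.ker (latForm K b v)).map (latMap K b)) := by
  ext P
  constructor
  · rintro ⟨⟨_, ⟨c, rfl⟩, h0, rfl⟩, h⟩
    rw [mk_mem_pts, mem_perp_span_singleton, dotProduct_comm] at h
    exact ⟨_, ⟨c, by rw [SetLike.mem_coe, LinearMap.mem_ker, latForm_apply, h], rfl⟩, h0, rfl⟩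
  · rintro ⟨_, ⟨c, hc, rfl⟩, h0, rfl⟩
    rw [SetLike.mem_coe, LinearMap.mem_ker, latForm_apply] at hc
    refine ⟨⟨_, ⟨c, rfl⟩, h0, rfl⟩, ?_⟩
    rw [mk_mem_pts, mem_perp_span_singleton, dotProduct_comm, hc]

/-- A plane meets a Baer subgeometry in a Baer subline or a Baer subplane. -/
theorem DualBases.finrank_ker [Finite F] {b b' : Fin 4 → Fin 4 → F} (h : DualBases b b')
    (hq : Nat.card F = Nat.card K ^ 2) {v : Fin 4 → F} (hv : v ≠ 0) :
    (v ∈ vecs (baerPts K b') → finrank K (LinearMap.ker (latForm K b v)) = 3) ∧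
    (v ∉ vecs (baerPts K b') → finrank K (LinearMap.ker (latForm K b v)) = 2) := by
  have := finite_subfield (F := F) K
  -- The range has rank 1 or 2, as `F` has rank 2 over `K`. Rank 1 means that the coordinates `b i
  -- ⬝ᵥ v` are proportional to elements of `K`, so that `v` is in the dual lattice up to a scalar.
  have h1 := LinearMap.finrank_range_add_finrank_ker (latForm K b v)
  rw [finrank_fin_fun] at h1
  have h2 := Submodule.finrank_le (LinearMap.range (latForm K b v))
  rw [finrank_eq_two hq] at h2
  have hpos : 1 ≤ finrank K (LinearMap.range (latForm K b v)) := by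
    rw [Submodule.one_le_finrank_iff, Ne, LinearMap.range_eq_bot]
    intro h0
    refine hv ?_
    rw [h.symm.expand v]
    refine Finset.sum_eq_zero fun i _ => ?_
    have := LinearMap.congr_fun h0 (Pi.single i 1)
    rw [latForm_apply, latMap_dot, LinearMap.zero_apply] at this
    simp only [Pi.single_apply, ite_smul, one_smul, zero_smul, Finset.sum_ite_eq',
      Finset.mem_univ, if_true] at this
    rw [this, zero_smul]
  constructor
  · rintro ⟨hv0, hmem⟩
    rw [baerPts, mk_mem_subPts] at hmem
    obtain ⟨a, ha, d, hd⟩ := hmem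
    have h3 : LinearMap.range (latForm K b v) ≤ K ∙ a⁻¹ := by
      rintro _ ⟨c, rfl⟩
      rw [latForm_apply, Submodule.mem_span_singleton]
      refine ⟨c ⬝ᵥ d, ?_⟩
      rw [Algebra.smul_def, ← h.dot, hd, dotProduct_smul, smul_eq_mul, mul_comm a,
        mul_inv_cancel_right₀ ha]
    have h4 := Submodule.finrank_mono h3
    rw [finrank_span_singleton (inv_ne_zero ha)] at h4
    omega
  · intro hv'
    by_contra hcon
    have h3 : finrank K (LinearMap.range (latForm K b v)) = 1 := by omega
    obtain ⟨r, hr0', hk⟩ : ∃ r : F, r ≠ 0 ∧ ∀ i, ∃ k : K, k • r = b i ⬝ᵥ v := by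
      obtain ⟨r, hr0, hr⟩ := finrank_eq_one_iff'.1 h3
      refine ⟨r, fun h0 => hr0 (Subtype.ext h0), fun i => ?_⟩
      obtain ⟨k, hk⟩ := hr ⟨latForm K b v (Pi.single i 1), _, rfl⟩
      refine ⟨k, ?_⟩
      have := congrArg Subtype.val hk
      rw [Submodule.coe_smul] at this
      rw [this]
      simp only [latForm_apply, latMap_dot, Pi.single_apply, ite_smul, one_smul, zero_smul,
        Finset.sum_ite_eq', Finset.mem_univ, if_true]
    choose k hk using hk
    refine hv' ⟨hv, ?_⟩
    rw [baerPts, mk_mem_subPts]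
    refine ⟨r⁻¹, inv_ne_zero hr0', k, ?_⟩
    conv_rhs => rw [h.symm.expand v]
    rw [latMap_apply, Finset.smul_sum]
    refine Finset.sum_congr rfl fun i _ => ?_
    rw [← hk i, smul_smul, mul_smul_comm, inv_mul_cancel₀ hr0', smul_assoc, one_smul]

theorem DualBases.ncard_baerPts [Finite F] {b b' : Fin 4 → Fin 4 → F} (h : DualBases b b') :
    (baerPts K b).ncard = ∑ i ∈ Finset.range 4, Nat.card K ^ i := by
  have := h.ncard (K := K) ⊤ (n := 4) (by simp)
  rwa [Submodule.map_top] at this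

/-- With s the order of `K`: of s³ + s² + s + 1 points, a plane of the subgeometry contains s² + s +
1 and misses s·q, while any other contains s + 1 and misses (s + 1)q. -/
theorem DualBases.off_plane [Finite F] {b b' : Fin 4 → Fin 4 → F} (h : DualBases b b')
    (hq : Nat.card F = Nat.card K ^ 2) (w : Pt F 4) :
    (({P | P ∈ baerPts K b ∧ ¬ orthogonal P w}.ncard : ℕ) : ℝ) =
      ((Nat.card K : ℝ) + 1 - (baerPts K b').indicator (fun _ => (1 : ℝ)) w) * Nat.card F := by
  classical
  induction w using Projectivization.ind with | h v hv => ?_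
  have h2 : {P | P ∈ baerPts K b ∧ ¬ orthogonal P (Projectivization.mk F v hv)} =
      baerPts K b \ (baerPts K b ∩ pts (perp (F ∙ v))) := by
    ext P
    simp only [Set.mem_ofPred_eq, orthogonal_iff_mem_pts, Set.mem_sdiff, Set.mem_inter_iff,
      mem_pts_perp_comm (P := P), submodule_mk]
    tauto
  rw [h2, Set.cast_ncard_sdiff Set.inter_subset_left (Set.toFinite _), h.ncard_baerPts,
    baerPts_inter, hq, Set.indicator_apply]
  by_cases hm : v ∈ vecs (baerPts K b')
  · rw [h.ncard _ ((h.finrank_ker hq hv).1 hm), if_pos hm.2]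
    simp [Finset.sum_range_succ]
    ring
  · rw [h.ncard _ ((h.finrank_ker hq hv).2 hm), if_neg fun h' => hm ⟨hv, h'⟩]
    simp [Finset.sum_range_succ]
    ring

theorem DualBases.clPair [Finite F] {b b' : Fin 4 → Fin 4 → F} (h : DualBases b b')
    (hq : Nat.card F = Nat.card K ^ 2) :
    CLPair (baerPts K b) (baerPts K b') ((Nat.card K : ℝ) + 1) :=
  ⟨h.off_plane hq, h.symm.off_plane hq⟩

/-- The planes of a Baer subgeometry are the points of the dual one. -/
theorem DualBases.isPlaneOf_iff [Finite F] {b b' : Fin 4 → Fin 4 → F} (h : DualBases b b')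
    (hq : Nat.card F = Nat.card K ^ 2) (w : Pt F 4) :
    IsPlaneOf (baerPts K b) (perp w.submodule) ↔ w ∈ baerPts K b' := by
  have := finite_subfield (F := F) K
  induction w using Projectivization.ind with | h v hv => ?_
  rw [submodule_mk]
  constructor
  · rintro ⟨h3, hW⟩
    -- A plane outside the dual lattice meets the lattice in rank 2 over `K`, which spans at most a
    -- line over `F`.
    by_contra hcon
    have h2 := (h.finrank_ker (K := K) hq hv).2 fun h' => hcon h'.2
    have hle : perp (F ∙ v) ≤ Submodule.span F
        (((LinearMap.ker (latForm K b v)).map (latMap K b) : Submodule K (Fin 4 → F)) :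
          Set (Fin 4 → F)) := by
      rw [hW]
      refine iSup₂_le fun P hP => ?_
      obtain ⟨hPS, hPW⟩ := hP
      have hm : P ∈ baerPts K b ∩ pts (perp (F ∙ v)) := ⟨hPS, hPW⟩
      rw [baerPts_inter] at hm
      obtain ⟨u, hu, hu0, rfl⟩ := hm
      rw [submodule_mk, Submodule.span_singleton_le_iff_mem]
      exact Submodule.subset_span hu
    have h4 := Submodule.finrank_mono hle
    rw [h3] at h4
    set N := (LinearMap.ker (latForm K b v)).map (latMap K b)
    have hN : finrank K N = 2 := by
      rw [← (Submodule.equivMapOfInjective _ h.injective _).finrank_eq, h2]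
    let e := finBasisOfFinrankEq K N hN
    have h5 : Submodule.span F (N : Set (Fin 4 → F)) ≤
        Submodule.span F (Set.range fun i => (e i : Fin 4 → F)) := by
      rw [Submodule.span_le]
      intro u hu
      have h6 := e.sum_repr ⟨u, hu⟩
      have h7 := congrArg Subtype.val h6
      simp only [AddSubmonoidClass.coe_finsetSum, Submodule.coe_smul] at h7
      rw [← h7]
      refine Submodule.sum_mem _ fun i _ => ?_
      rw [← algebraMap_smul F]
      exact Submodule.smul_mem _ _ (Submodule.subset_span ⟨i, rfl⟩)
    have h8 := Submodule.finrank_mono h5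
    have h9 := finrank_range_le_card (R := F) (fun i => (e i : Fin 4 → F))
    rw [Set.finrank, Fintype.card_fin] at h9
    omega
  · rintro ⟨_, ⟨d, rfl⟩, hd0, heq⟩
    rw [← submodule_mk v hv, heq, submodule_mk]
    refine ⟨by rw [finrank_perp, finrank_span_singleton hd0], le_antisymm ?_ (iSup₂_le fun P hP => hP.2)⟩
    intro u hu
    have hd : d ≠ 0 := fun h0 => hd0 (by rw [h0, map_zero])
    obtain ⟨j, hj⟩ := Function.ne_iff.1 hd
    simp only [Pi.zero_apply] at hj
    rw [mem_perp_span_singleton, latMap_dot] at hu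
    -- The lattice vectors with coordinates `e_i - (d_i / d_j) e_j` are orthogonal to `d`. They span
    -- the plane, since the correction along `b j` sums to a multiple of the product of `u` with the
    -- normal vector, which is zero.
    have hexp : u = ∑ i, (b' i ⬝ᵥ u) • latMap K b (Pi.single i 1 - (d i / d j) • Pi.single j 1) := by
      have e1 : ∀ i, latMap K b (Pi.single i 1 - (d i / d j) • Pi.single j 1) =
          b i - (d i / d j) • b j := by
        intro i
        rw [map_sub, map_smul, latMap, Fintype.linearCombination_apply_single,
          Fintype.linearCombination_apply_single, one_smul, one_smul]
      simp only [e1, smul_sub, Finset.sum_sub_distrib]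
      rw [← h.expand u, eq_comm, sub_eq_self]
      have e2 : ∀ i, (b' i ⬝ᵥ u) • (d i / d j) • b j = ((d j)⁻¹ • (d i • (b' i ⬝ᵥ u))) • b j := by
        intro i
        rw [← algebraMap_smul F (d i / d j), smul_smul]
        congr 1
        rw [smul_smul, Algebra.smul_def, mul_comm, div_eq_mul_inv, mul_comm (d i)]
      rw [Finset.sum_congr rfl fun i _ => e2 i, ← Finset.sum_smul, ← Finset.smul_sum, hu,
        smul_zero, zero_smul]
    rw [hexp]
    refine Submodule.sum_mem _ fun i _ => Submodule.smul_mem _ _ ?_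
    set c : Fin 4 → K := Pi.single i 1 - (d i / d j) • Pi.single j 1 with hc
    by_cases hc0 : latMap K b c = 0
    · rw [hc0]
      exact Submodule.zero_mem _
    · have hmem : Projectivization.mk F _ hc0 ∈ {P : Pt F 4 | P ∈ baerPts K b ∧
          P.submodule ≤ perp (F ∙ latMap K b' d)} := by
        refine ⟨⟨_, ⟨c, rfl⟩, hc0, rfl⟩, ?_⟩
        rw [submodule_mk, Submodule.span_singleton_le_iff_mem, mem_perp_span_singleton, h.symm.dot,
          hc, dotProduct_sub, dotProduct_smul]
        simp [div_mul_cancel₀ _ hj]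
      refine Submodule.mem_iSup_of_mem _ (Submodule.mem_iSup_of_mem hmem ?_)
      rw [submodule_mk]
      exact Submodule.mem_span_singleton_self _

end Lattice

end

section

/-! ### The Klein correspondence -/

section Klein

/-- Contraction of a Plücker vector with a linear form. -/
def iota (w : Fin 4 → F) : (Fin 6 → F) →ₗ[F] (Fin 4 → F) where
  toFun z := ![z 0 * w 1 + z 1 * w 2 + z 2 * w 3, -(z 0 * w 0) + z 3 * w 2 - z 4 * w 3,
    -(z 1 * w 0) - z 3 * w 1 + z 5 * w 3, -(z 2 * w 0) + z 4 * w 1 - z 5 * w 2]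
  map_add' z z' := by
    ext i
    fin_cases i <;> simp <;> ring
  map_smul' a z := by
    ext i
    fin_cases i <;> simp <;> ring

theorem iota_apply (w : Fin 4 → F) (z : Fin 6 → F) : iota w z =
    ![z 0 * w 1 + z 1 * w 2 + z 2 * w 3, -(z 0 * w 0) + z 3 * w 2 - z 4 * w 3,
    -(z 1 * w 0) - z 3 * w 1 + z 5 * w 3, -(z 2 * w 0) + z 4 * w 1 - z 5 * w 2] := rfl

/-- The duality of the Klein quadric that interchanges points and planes. -/
def revMap : (Fin 6 → F) →ₗ[F] (Fin 6 → F) where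
  toFun z := ![z 5, z 4, z 3, z 2, z 1, z 0]
  map_add' z z' := by
    ext i
    fin_cases i <;> rfl
  map_smul' a z := by
    ext i
    fin_cases i <;> rfl

theorem revMap_apply (z : Fin 6 → F) : revMap z = ![z 5, z 4, z 3, z 2, z 1, z 0] := rfl

theorem revMap_revMap (z : Fin 6 → F) : revMap (revMap z) = z := by
  ext i
  fin_cases i <;> rfl

theorem revMap_ne_zero {z : Fin 6 → F} (hz : z ≠ 0) : revMap z ≠ 0 := fun h =>
  hz (by rw [← revMap_revMap z, h, map_zero])

theorem kleinForm_revMap (z : Fin 6 → F) : kleinForm (revMap z) = kleinForm z := by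
  simp [kleinForm, revMap_apply]
  ring

/-- The Plücker coordinates as a linear map in the second vector. -/
def pluckerMap (u : Fin 4 → F) : (Fin 4 → F) →ₗ[F] (Fin 6 → F) where
  toFun v := plucker u v
  map_add' z z' := by
    ext i
    fin_cases i <;> simp [plucker] <;> ring
  map_smul' a z := by
    ext i
    fin_cases i <;> simp [plucker] <;> ring

theorem pluckerMap_apply (u v : Fin 4 → F) : pluckerMap u v = plucker u v := rfl

theorem plucker_swap (u v : Fin 4 → F) : plucker u v = -plucker v u := by
  ext i
  fin_cases i <;> simp [plucker] <;> ring

theorem plucker_self (u : Fin 4 → F) : plucker u u = 0 := by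
  ext i
  fin_cases i <;> simp [plucker] <;> ring

theorem plucker_smul_left (a : F) (u v : Fin 4 → F) : plucker (a • u) v = plucker u (a • v) := by
  ext i
  fin_cases i <;> simp [plucker] <;> ring

theorem kleinForm_plucker (u v : Fin 4 → F) : kleinForm (plucker u v) = 0 := by
  simp [kleinForm, plucker]
  ring

/-- Contraction of a decomposable bivector; it makes the kernel of `iota w` the lines in the plane
of `w`. -/
theorem iota_plucker (w u v : Fin 4 → F) :
    iota w (plucker u v) = (v ⬝ᵥ w) • u - (u ⬝ᵥ w) • v := by
  ext i
  fin_cases i <;> simp [iota_apply, plucker, dotProduct, Fin.sum_univ_four] <;> ring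

theorem iota_dot (w : Fin 4 → F) (z : Fin 6 → F) : iota w z ⬝ᵥ w = 0 := by
  simp [iota_apply, dotProduct, Fin.sum_univ_four]
  ring

theorem iota_revMap_plucker (a b u : Fin 4 → F) (α β : F) (hu : u = α • a + β • b) :
    iota u (revMap (plucker a b)) = 0 := by
  subst hu
  ext i
  fin_cases i <;> simp [iota_apply, revMap_apply, plucker] <;> ring

theorem iota_smul (a : F) (w : Fin 4 → F) (z : Fin 6 → F) : iota (a • w) z = a • iota w z := by
  ext i
  fin_cases i <;> simp [iota_apply] <;> ring

/-- For a line `z` of the quadric, `iota p (revMap z)` is the plane joining it to `p`, and the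
vanishing right side says that `z` lies in that plane. -/
theorem iota_iota (p : Fin 4 → F) (z : Fin 6 → F) :
    iota (iota p (revMap z)) z = -kleinForm z • p := by
  ext i
  fin_cases i <;> simp [iota_apply, revMap_apply, kleinForm] <;> ring

/-- The polar form of the Klein quadric. -/
theorem polar_plucker (a b : Fin 4 → F) (z : Fin 6 → F) :
    kleinForm (plucker a b + z) = kleinForm z - iota a (revMap z) ⬝ᵥ b := by
  simp [kleinForm, plucker, iota_apply, revMap_apply, dotProduct, Fin.sum_univ_four]
  ring

/-- Together with `polar_plucker` this identifies the polar form with a determinant: lines are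
conjugate exactly when they meet. -/
theorem det_eq_polar (a b c d : Fin 4 → F) :
    (Matrix.of ![a, b, c, d]).det = -(iota a (revMap (plucker c d)) ⬝ᵥ b) := by
  have h12 : Fin.succAbove (1 : Fin 4) (2 : Fin 3) = 3 := by decide
  have h22 : Fin.succAbove (2 : Fin 4) (2 : Fin 3) = 3 := by decide
  have h32 : Fin.succAbove (3 : Fin 4) (2 : Fin 3) = 2 := by decide
  simp [plucker, iota_apply, revMap_apply, dotProduct,
    Matrix.det_succ_row_zero, Fin.sum_univ_succ, h12, h22, h32]
  ring

theorem eq_plucker_of_smul {z : Fin 6 → F} {a : F} (ha : a ≠ 0) {u v : Fin 4 → F}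
    (h : a • z = plucker u v) : ∃ u v, z = plucker u v := by
  refine ⟨u, a⁻¹ • v, ?_⟩
  rw [← pluckerMap_apply, map_smul, pluckerMap_apply, ← h, inv_smul_smul₀ ha]

/-- A point of the quadric is a skew 4 × 4 matrix of rank 2. If its entry (i, j) is non-zero, rows i
and j span the line, and their Plücker vector is that entry times `z`. -/
theorem exists_eq_plucker {z : Fin 6 → F} (hz : z ≠ 0) (hk : kleinForm z = 0) :
    ∃ u v, z = plucker u v := by
  obtain ⟨i, hi⟩ := Function.ne_iff.1 hz
  simp only [Pi.zero_apply] at hi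
  have hk' : z 0 * z 5 + z 1 * z 4 + z 2 * z 3 = 0 := hk
  fin_cases i
  · refine eq_plucker_of_smul hi (u := ![0, z 0, z 1, z 2]) (v := ![-z 0, 0, z 3, -z 4]) ?_
    ext j
    fin_cases j <;> simp [plucker] <;>
      first | ring1 | linear_combination hk'
  · refine eq_plucker_of_smul hi (u := ![0, z 0, z 1, z 2]) (v := ![-z 1, -z 3, 0, z 5]) ?_
    ext j
    fin_cases j <;> simp [plucker] <;>
      first | ring1 | linear_combination hk'
  · refine eq_plucker_of_smul hi (u := ![0, z 0, z 1, z 2]) (v := ![-z 2, z 4, -z 5, 0]) ?_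
    ext j
    fin_cases j <;> simp [plucker] <;>
      first | ring1 | linear_combination hk'
  · refine eq_plucker_of_smul hi (u := ![-z 0, 0, z 3, -z 4]) (v := ![-z 1, -z 3, 0, z 5]) ?_
    ext j
    fin_cases j <;> simp [plucker] <;>
      first | ring1 | linear_combination hk'
  · refine eq_plucker_of_smul hi (u := ![-z 2, z 4, -z 5, 0]) (v := ![-z 0, 0, z 3, -z 4]) ?_
    ext j
    fin_cases j <;> simp [plucker] <;>
      first | ring1 | linear_combination hk'
  · refine eq_plucker_of_smul hi (u := ![-z 1, -z 3, 0, z 5]) (v := ![-z 2, z 4, -z 5, 0]) ?_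
    ext j
    fin_cases j <;> simp [plucker] <;>
      first | ring1 | linear_combination hk'

theorem exists_dot_eq_one {n : ℕ} {w : Fin n → F} (hw : w ≠ 0) : ∃ a, a ⬝ᵥ w = 1 := by
  by_contra! h
  refine hw (dotProduct_eq_zero w fun v => ?_)
  by_contra hv
  refine h ((w ⬝ᵥ v)⁻¹ • v) ?_
  rw [smul_dotProduct, dotProduct_comm v, smul_eq_mul, inv_mul_cancel₀ hv]

/-- The lines through the point `p`. -/
def pencil (p : Fin 4 → F) : Submodule F (Fin 6 → F) := LinearMap.ker ((iota p).comp revMap)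

/-- The lines in the plane orthogonal to `w`. -/
def dualPencil (w : Fin 4 → F) : Submodule F (Fin 6 → F) := LinearMap.ker (iota w)

theorem mem_pencil {p : Fin 4 → F} {z : Fin 6 → F} : z ∈ pencil p ↔ iota p (revMap z) = 0 := Iff.rfl

theorem mem_dualPencil {w : Fin 4 → F} {z : Fin 6 → F} : z ∈ dualPencil w ↔ iota w z = 0 := Iff.rfl

theorem revMap_mem_pencil {p : Fin 4 → F} {z : Fin 6 → F} :
    revMap z ∈ pencil p ↔ z ∈ dualPencil p := by
  rw [mem_pencil, revMap_revMap, mem_dualPencil]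

theorem finrank_dualPencil {w : Fin 4 → F} (hw : w ≠ 0) : finrank F (dualPencil w) = 3 := by
  have h1 := LinearMap.finrank_range_add_finrank_ker (iota w)
  have h2 : LinearMap.range (iota w) = perp (F ∙ w) := by
    ext x
    rw [mem_perp_span_singleton, dotProduct_comm]
    constructor
    · rintro ⟨z, rfl⟩
      exact iota_dot w z
    · intro hx
      obtain ⟨a, ha⟩ := exists_dot_eq_one hw
      exact ⟨plucker x a, by rw [iota_plucker, ha, hx, one_smul, zero_smul, sub_zero]⟩
  rw [h2, finrank_perp, finrank_span_singleton hw, finrank_fin_fun] at h1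
  rw [dualPencil]
  omega

theorem finrank_pencil {p : Fin 4 → F} (hp : p ≠ 0) : finrank F (pencil p) = 3 := by
  have h1 : (dualPencil p).map revMap = pencil p := by
    ext z
    constructor
    · rintro ⟨z, hz, rfl⟩
      exact revMap_mem_pencil.2 hz
    · intro hz
      exact ⟨revMap z, hz, revMap_revMap z⟩
  rw [← h1, ← (Submodule.equivMapOfInjective revMap (fun x y h => by
    rw [← revMap_revMap x, h, revMap_revMap]) _).finrank_eq, finrank_dualPencil hp]

theorem plucker_eq_zero_iff {p v : Fin 4 → F} (hp : p ≠ 0) :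
    plucker p v = 0 ↔ ∃ a : F, a • p = v := by
  constructor
  · intro h
    obtain ⟨w, hw⟩ := exists_dot_eq_one hp
    have := iota_plucker w p v
    rw [h, map_zero, dotProduct_comm p, hw, one_smul, eq_comm, sub_eq_zero] at this
    exact ⟨_, this⟩
  · rintro ⟨a, rfl⟩
    rw [← pluckerMap_apply, map_smul, pluckerMap_apply, plucker_self, smul_zero]

theorem pencil_eq_range {p : Fin 4 → F} (hp : p ≠ 0) :
    pencil p = LinearMap.range (pluckerMap p) := by
  symm
  apply Submodule.eq_of_le_of_finrank_eq
  · rintro _ ⟨v, rfl⟩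
    exact iota_revMap_plucker p v p 1 0 (by simp)
  · have h1 := LinearMap.finrank_range_add_finrank_ker (pluckerMap p)
    have h2 : LinearMap.ker (pluckerMap p) = F ∙ p := by
      ext v
      rw [LinearMap.mem_ker, pluckerMap_apply, plucker_eq_zero_iff hp,
        Submodule.mem_span_singleton]
    rw [h2, finrank_span_singleton hp, finrank_fin_fun] at h1
    rw [finrank_pencil hp]
    omega

theorem kleinForm_of_mem_pencil {p : Fin 4 → F} (hp : p ≠ 0) {z : Fin 6 → F} (hz : z ∈ pencil p) :
    kleinForm z = 0 := by
  rw [pencil_eq_range hp] at hz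
  obtain ⟨v, rfl⟩ := hz
  exact kleinForm_plucker p v

theorem kleinForm_of_mem_dualPencil {p : Fin 4 → F} (hp : p ≠ 0) {z : Fin 6 → F}
    (hz : z ∈ dualPencil p) : kleinForm z = 0 := by
  rw [← kleinForm_revMap]
  exact kleinForm_of_mem_pencil hp (revMap_mem_pencil.2 hz)

theorem indep_of_plucker {u v : Fin 4 → F} (h : plucker u v ≠ 0) : LinearIndependent F ![u, v] := by
  have hu : u ≠ 0 := by
    rintro rfl
    refine h ?_
    rw [plucker_swap, ← pluckerMap_apply, map_zero, neg_zero]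
  rw [LinearIndependent.pair_iff' hu]
  exact fun a ha => h ((plucker_eq_zero_iff hu).2 ⟨a, ha⟩)

theorem plucker_mem_dualPencil {w u v : Fin 4 → F} (h : plucker u v ≠ 0) :
    plucker u v ∈ dualPencil w ↔ u ⬝ᵥ w = 0 ∧ v ⬝ᵥ w = 0 := by
  rw [mem_dualPencil, iota_plucker]
  constructor
  · intro h0
    have e : (v ⬝ᵥ w) • u + (-(u ⬝ᵥ w)) • v = 0 := by
      rw [neg_smul, ← sub_eq_add_neg]
      exact h0
    have hi : LinearIndependent F ![u, v] := indep_of_plucker h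
    have := LinearIndependent.pair_iff.1 hi _ _ e
    exact ⟨neg_eq_zero.1 this.2, this.1⟩
  · rintro ⟨h1, h2⟩
    rw [h1, h2, zero_smul, zero_smul, sub_zero]

theorem plucker_mem_pencil {p u v : Fin 4 → F} (h : plucker u v ≠ 0) :
    plucker u v ∈ pencil p ↔ p ∈ Submodule.span F {u, v} := by
  constructor
  · intro hm
    by_cases hp : p = 0
    · rw [hp]
      exact Submodule.zero_mem _
    rw [pencil_eq_range hp] at hm
    obtain ⟨v', hv'⟩ := hm
    rw [pluckerMap_apply] at hv'
    have hi : v' ∉ F ∙ p := fun h0 => h (by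
      rw [← hv', plucker_eq_zero_iff hp]
      exact Submodule.mem_span_singleton.1 h0)
    rw [← perp_perp (F ∙ p), mem_perp] at hi
    push Not at hi
    obtain ⟨w, hw, hwv⟩ := hi
    rw [mem_perp_span_singleton] at hw
    -- Contracting with a form that vanishes at `p` but not at `v'` expresses `p` through `u` and
    -- `v`.
    have h1 := congrArg (iota w) hv'
    rw [iota_plucker, iota_plucker, hw, zero_smul, sub_zero] at h1
    rw [dotProduct_comm] at hwv
    rw [← Submodule.smul_mem_iff _ hwv, h1]
    exact Submodule.sub_mem _ (Submodule.smul_mem _ _ (Submodule.subset_span (by simp)))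
      (Submodule.smul_mem _ _ (Submodule.subset_span (by simp)))
  · intro hm
    obtain ⟨a, b, hab⟩ := Submodule.mem_span_pair.1 hm
    exact iota_revMap_plucker u v p a b hab.symm

theorem latin_mk {p : Fin 4 → F} (hp : p ≠ 0) : latin (Projectivization.mk F p hp) = pencil p := by
  rw [latin, submodule_mk]
  apply le_antisymm
  · rw [Submodule.span_le]
    rintro _ ⟨u, hu, v, rfl⟩
    obtain ⟨a, rfl⟩ := Submodule.mem_span_singleton.1 hu
    rw [plucker_smul_left]
    exact iota_revMap_plucker p _ p 1 0 (by simp)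
  · rw [pencil_eq_range hp]
    rintro _ ⟨v, rfl⟩
    exact Submodule.subset_span ⟨p, Submodule.mem_span_singleton_self p, v, rfl⟩

theorem greek_perp {w : Fin 4 → F} (hw : w ≠ 0) : greek (perp (F ∙ w)) = dualPencil w := by
  rw [greek]
  apply le_antisymm
  · rw [Submodule.span_le]
    rintro _ ⟨u, hu, v, hv, rfl⟩
    rw [mem_perp_span_singleton, dotProduct_comm] at hu hv
    rw [SetLike.mem_coe, mem_dualPencil, iota_plucker, hu, hv, zero_smul, zero_smul, sub_zero]
  · intro z hz
    by_cases h0 : z = 0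
    · rw [h0]
      exact Submodule.zero_mem _
    obtain ⟨u, v, rfl⟩ := exists_eq_plucker h0 (kleinForm_of_mem_dualPencil hw hz)
    rw [plucker_mem_dualPencil h0] at hz
    refine Submodule.subset_span ⟨u, ?_, v, ?_, rfl⟩ <;>
      rw [mem_perp_span_singleton, dotProduct_comm]
    exacts [hz.1, hz.2]

theorem isGenerator_pencil {p : Fin 4 → F} (hp : p ≠ 0) : IsGenerator (pencil p) :=
  ⟨finrank_pencil hp, fun _ hz => kleinForm_of_mem_pencil hp hz⟩

theorem isGenerator_dualPencil {p : Fin 4 → F} (hp : p ≠ 0) : IsGenerator (dualPencil p) :=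
  ⟨finrank_dualPencil hp, fun _ hz => kleinForm_of_mem_dualPencil hp hz⟩

/-- A point on the plane, joined to another point of the plane, gives a common line. If it is off
the plane, contraction with `w` shows that a common Plücker vector `plucker p v` has `v`
proportional to `p`. -/
theorem disjoint_pencil_dualPencil {p w : Fin 4 → F} (hp : p ≠ 0) (hw : w ≠ 0) :
    Disjoint (pencil p) (dualPencil w) ↔ p ⬝ᵥ w ≠ 0 := by
  rw [Submodule.disjoint_def]
  constructor
  · intro h h0
    have h1 : ¬ perp (F ∙ w) ≤ F ∙ p := fun hle => by
      have := Submodule.finrank_mono hle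
      rw [finrank_perp, finrank_span_singleton hp, finrank_span_singleton hw] at this
      omega
    obtain ⟨u, hu, hup⟩ := SetLike.not_le_iff_exists.1 h1
    rw [mem_perp_span_singleton, dotProduct_comm] at hu
    refine hup (Submodule.mem_span_singleton.2 ((plucker_eq_zero_iff hp).1 (h _ ?_ ?_)))
    · exact iota_revMap_plucker p u p 1 0 (by simp)
    · rw [mem_dualPencil, iota_plucker, hu, h0, zero_smul, zero_smul, sub_zero]
  · intro h z hz hz'
    rw [pencil_eq_range hp] at hz
    obtain ⟨v, rfl⟩ := hz
    rw [pluckerMap_apply] at *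
    rw [mem_dualPencil, iota_plucker, sub_eq_zero] at hz'
    rw [plucker_eq_zero_iff hp]
    refine ⟨(p ⬝ᵥ w)⁻¹ * (v ⬝ᵥ w), ?_⟩
    rw [mul_smul, hz', inv_smul_smul₀ h]

theorem exists_mem_pencil_inf {p p' : Fin 4 → F} (hp : p ≠ 0) :
    ∃ z ≠ 0, z ∈ pencil p ∧ z ∈ pencil p' := by
  by_cases h : plucker p p' = 0
  · obtain ⟨a, rfl⟩ := (plucker_eq_zero_iff hp).1 h
    have : pencil p ≠ ⊥ := fun h0 => by
      have := finrank_pencil hp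
      rw [h0, finrank_bot] at this
      omega
    obtain ⟨z, hz, hz0⟩ := (Submodule.ne_bot_iff _).1 this
    exact ⟨z, hz0, hz, by rw [mem_pencil, iota_smul, mem_pencil.1 hz, smul_zero]⟩
  · exact ⟨_, h, iota_revMap_plucker p p' p 1 0 (by simp),
      iota_revMap_plucker p p' p' 0 1 (by simp)⟩

theorem not_disjoint_pencil {p p' : Fin 4 → F} (hp : p ≠ 0) :
    ¬ Disjoint (pencil p) (pencil p') := by
  obtain ⟨z, hz0, h1, h2⟩ := exists_mem_pencil_inf (p' := p') hp
  exact fun h => hz0 (Submodule.disjoint_def.1 h z h1 h2)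

theorem not_disjoint_dualPencil {p p' : Fin 4 → F} (hp : p ≠ 0) :
    ¬ Disjoint (dualPencil p) (dualPencil p') := by
  obtain ⟨z, hz0, h1, h2⟩ := exists_mem_pencil_inf (p' := p') hp
  rw [← revMap_revMap z, revMap_mem_pencil] at h1 h2
  exact fun h => revMap_ne_zero hz0 (Submodule.disjoint_def.1 h _ h1 h2)

end Klein

end

/-! ### Generators as Latin and Greek planes -/

section

section Generators

/-- The hypothesis says that `a, b, c, d` are linearly dependent; a dependency, with its `c, d` part
moved to the other side, is a point on both lines. -/
theorem exists_common_point {a b c d : Fin 4 → F} (h₁ : plucker a b ≠ 0) (h₂ : plucker c d ≠ 0)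
    (h : kleinForm (plucker a b + plucker c d) = 0) :
    ∃ p ≠ 0, plucker a b ∈ pencil p ∧ plucker c d ∈ pencil p := by
  rw [polar_plucker, kleinForm_plucker, zero_sub] at h
  rw [← det_eq_polar, ← Matrix.exists_vecMul_eq_zero_iff] at h
  obtain ⟨v, hv0, hv⟩ := h
  have hrel : v 0 • a + v 1 • b = (-v 2) • c + (-v 3) • d := by
    ext j
    have := congrFun hv j
    simp [Matrix.vecMul, dotProduct, Fin.sum_univ_four] at this
    simp
    linear_combination this
  refine ⟨v 0 • a + v 1 • b, fun h0 => hv0 ?_, iota_revMap_plucker _ _ _ _ _ rfl,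
    iota_revMap_plucker _ _ _ _ _ hrel⟩
  have hi₁ : LinearIndependent F ![a, b] := indep_of_plucker h₁
  have hi₂ : LinearIndependent F ![c, d] := indep_of_plucker h₂
  have e₁ := LinearIndependent.pair_iff.1 hi₁ _ _ h0
  rw [hrel] at h0
  have e₂ := LinearIndependent.pair_iff.1 hi₂ _ _ h0
  ext i
  fin_cases i
  exacts [e₁.1, e₁.2, neg_eq_zero.1 e₂.1, neg_eq_zero.1 e₂.2]

theorem IsGenerator.eq_of_basis {G H : Submodule F (Fin 6 → F)} (hG : IsGenerator G)
    (hH : finrank F H = 3) (e : Basis (Fin 3) F G) (h : ∀ i, (e i : Fin 6 → F) ∈ H) : G = H := by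
  refine Submodule.eq_of_le_of_finrank_eq ?_ (by rw [hG.1, hH])
  intro g hg
  have h1 := congrArg Subtype.val (e.sum_repr ⟨g, hg⟩)
  simp only [AddSubmonoidClass.coe_finsetSum, Submodule.coe_smul] at h1
  rw [← h1]
  exact Submodule.sum_mem _ fun i _ => Submodule.smul_mem _ _ (h i)

/-- The generators of the Klein quadric are the planes of lines through a point and the planes of
lines in a plane. -/
theorem IsGenerator.eq_pencil_or {G : Submodule F (Fin 6 → F)} (hG : IsGenerator G) :
    ∃ p ≠ 0, G = pencil p ∨ G = dualPencil p := by
  let e := finBasisOfFinrankEq F G hG.1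
  have hne : ∀ i, (e i : Fin 6 → F) ≠ 0 := fun i h => e.ne_zero i (Subtype.ext h)
  obtain ⟨a, b, hab⟩ := exists_eq_plucker (hne 0) (hG.2 _ (e 0).2)
  obtain ⟨c, d, hcd⟩ := exists_eq_plucker (hne 1) (hG.2 _ (e 1).2)
  obtain ⟨p, hp0, hp⟩ := exists_common_point (hab ▸ hne 0) (hcd ▸ hne 1) (by
    rw [← hab, ← hcd]
    exact hG.2 _ (G.add_mem (e 0).2 (e 1).2))
  rw [← hab, ← hcd] at hp
  by_cases h2 : (e 2 : Fin 6 → F) ∈ pencil p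
  · refine ⟨p, hp0, Or.inl (hG.eq_of_basis (finrank_pencil hp0) e fun i => ?_)⟩
    fin_cases i
    exacts [hp.1, hp.2, h2]
  -- The third line misses `p`, so `iota p (revMap (e 2))` is the plane joining them. A line of `G`
  -- through `p` meets the third line, hence lies in this plane.
  · have hy0 : iota p (revMap (e 2)) ≠ 0 := h2
    have key : ∀ z ∈ G, z ∈ pencil p → z ∈ dualPencil (iota p (revMap (e 2))) := by
      intro z hzG hz
      rw [pencil_eq_range hp0] at hz
      obtain ⟨u, rfl⟩ := hz
      rw [pluckerMap_apply] at *
      have h3 := hG.2 _ (G.add_mem hzG (e 2).2)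
      rw [polar_plucker, hG.2 _ (e 2).2, zero_sub, neg_eq_zero] at h3
      rw [mem_dualPencil, iota_plucker, dotProduct_comm u, h3, dotProduct_comm p, iota_dot,
        zero_smul, zero_smul, sub_zero]
    refine ⟨_, hy0, Or.inr (hG.eq_of_basis (finrank_dualPencil hy0) e fun i => ?_)⟩
    fin_cases i
    · exact key _ (e 0).2 hp.1
    · exact key _ (e 1).2 hp.2
    · rw [mem_dualPencil]
      change iota (iota p (revMap (e 2))) (e 2) = 0
      rw [iota_iota, hG.2 _ (e 2).2, neg_zero, zero_smul]

/-- The Greek plane of the plane orthogonal to `w`. -/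
def greekPt (w : Pt F 4) : Submodule F (Fin 6 → F) := greek (perp w.submodule)

theorem greekPt_mk {w : Fin 4 → F} (hw : w ≠ 0) :
    greekPt (Projectivization.mk F w hw) = dualPencil w := by
  rw [greekPt, submodule_mk, greek_perp hw]

theorem isGenerator_latin (P : Pt F 4) : IsGenerator (latin P) := by
  induction P using Projectivization.ind with | h p hp => ?_
  rw [latin_mk]
  exact isGenerator_pencil hp

theorem isGenerator_greekPt (P : Pt F 4) : IsGenerator (greekPt P) := by
  induction P using Projectivization.ind with | h p hp => ?_
  rw [greekPt_mk]
  exact isGenerator_dualPencil hp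

theorem IsGenerator.eq_latin_or {G : Submodule F (Fin 6 → F)} (hG : IsGenerator G) :
    (∃ P, G = latin P) ∨ ∃ w, G = greekPt w := by
  obtain ⟨p, hp, rfl | rfl⟩ := hG.eq_pencil_or
  · exact Or.inl ⟨_, (latin_mk hp).symm⟩
  · exact Or.inr ⟨_, (greekPt_mk hp).symm⟩

theorem disjoint_latin_greekPt {P w : Pt F 4} :
    Disjoint (latin P) (greekPt w) ↔ ¬ orthogonal P w := by
  induction P using Projectivization.ind with | h p hp => ?_
  induction w using Projectivization.ind with | h w hw => ?_
  rw [latin_mk, greekPt_mk, disjoint_pencil_dualPencil hp hw, orthogonal_mk]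

theorem not_disjoint_latin (P Q : Pt F 4) : ¬ Disjoint (latin P) (latin Q) := by
  induction P using Projectivization.ind with | h p hp => ?_
  induction Q using Projectivization.ind with | h w hw => ?_
  rw [latin_mk, latin_mk]
  exact not_disjoint_pencil hp

theorem not_disjoint_greekPt (P Q : Pt F 4) : ¬ Disjoint (greekPt P) (greekPt Q) := by
  induction P using Projectivization.ind with | h p hp => ?_
  induction Q using Projectivization.ind with | h w hw => ?_
  rw [greekPt_mk, greekPt_mk]
  exact not_disjoint_dualPencil hp

theorem latin_ne_greekPt (P w : Pt F 4) : latin P ≠ greekPt w := fun h => by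
  obtain ⟨Q, hQ⟩ := exists_not_self_orthogonal P
  rw [← disjoint_latin_greekPt, h] at hQ
  exact not_disjoint_greekPt _ _ hQ

theorem eq_of_forall_orthogonal {n : ℕ} {P Q : Pt F n}
    (h : ∀ w, orthogonal P w ↔ orthogonal Q w) : P = Q := by
  have : perp P.submodule = perp Q.submodule := by
    ext v
    by_cases hv : v = 0
    · simp [hv]
    · have := h (Projectivization.mk F v hv)
      rwa [orthogonal_iff_mem_pts, orthogonal_iff_mem_pts, mk_mem_pts, mk_mem_pts] at this
  apply submodule_injective
  rw [← perp_perp P.submodule, this, perp_perp]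

theorem latin_injective : Function.Injective (latin (F := F)) := fun P Q h =>
  eq_of_forall_orthogonal fun w => by
    rw [← not_iff_not, ← disjoint_latin_greekPt, ← disjoint_latin_greekPt, h]

theorem greekPt_injective : Function.Injective (greekPt (F := F)) := fun P Q h =>
  eq_of_forall_orthogonal fun w => by
    rw [← not_iff_not, orthogonal_comm, ← disjoint_latin_greekPt, orthogonal_comm,
      ← disjoint_latin_greekPt, h]

/-- The points whose Latin planes are in `L`. -/
def ptSet (L : Set (Submodule F (Fin 6 → F))) : Set (Pt F 4) := latin ⁻¹' L

/-- The planes whose Greek planes are in `L`. -/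
def plSet (L : Set (Submodule F (Fin 6 → F))) : Set (Pt F 4) := greekPt ⁻¹' L

/-- Generators of the same kind meet, so only Latin planes count against a Greek one and conversely,
and there disjointness is non-incidence. -/
theorem isCameronLiebler_iff {L : Set (Submodule F (Fin 6 → F))} (hL : ∀ G ∈ L, IsGenerator G)
    (x : ℝ) : IsCameronLiebler L x ↔ CLPair (ptSet L) (plSet L) x := by
  have h1 : ∀ w, {H | H ∈ L ∧ Disjoint H (greekPt w)} =
      latin '' {P | P ∈ ptSet L ∧ ¬ orthogonal P w} := by
    intro w
    ext H
    constructor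
    · rintro ⟨hH, hd⟩
      obtain ⟨P, rfl⟩ | ⟨P, rfl⟩ := (hL H hH).eq_latin_or
      · exact ⟨P, ⟨hH, disjoint_latin_greekPt.1 hd⟩, rfl⟩
      · exact absurd hd (not_disjoint_greekPt _ _)
    · rintro ⟨P, ⟨hP, hd⟩, rfl⟩
      exact ⟨hP, disjoint_latin_greekPt.2 hd⟩
  have h2 : ∀ P, {H | H ∈ L ∧ Disjoint H (latin P)} =
      greekPt '' {w | w ∈ plSet L ∧ ¬ orthogonal w P} := by
    intro P
    ext H
    constructor
    · rintro ⟨hH, hd⟩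
      obtain ⟨w, rfl⟩ | ⟨w, rfl⟩ := (hL H hH).eq_latin_or
      · exact absurd hd (not_disjoint_latin _ _)
      · exact ⟨w, ⟨hH, by rw [orthogonal_comm]; exact disjoint_latin_greekPt.1 hd.symm⟩, rfl⟩
    · rintro ⟨w, ⟨hw, hd⟩, rfl⟩
      exact ⟨hw, (disjoint_latin_greekPt.2 (by rwa [orthogonal_comm])).symm⟩
  have h3 : ∀ w, (plSet L).indicator (fun _ => (1 : ℝ)) w =
      L.indicator (fun _ => (1 : ℝ)) (greekPt w) := fun w => rfl
  have h4 : ∀ P, (ptSet L).indicator (fun _ => (1 : ℝ)) P =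
      L.indicator (fun _ => (1 : ℝ)) (latin P) := fun w => rfl
  constructor
  · rintro ⟨-, h⟩
    refine ⟨fun w => ?_, fun P => ?_⟩
    · rw [h3, ← h _ (isGenerator_greekPt w), h1, Set.ncard_image_of_injective _ latin_injective]
    · rw [h4, ← h _ (isGenerator_latin P), h2, Set.ncard_image_of_injective _ greekPt_injective]
  · intro h
    refine ⟨hL, fun G hG => ?_⟩
    obtain ⟨P, rfl⟩ | ⟨w, rfl⟩ := hG.eq_latin_or
    · rw [h2, Set.ncard_image_of_injective _ greekPt_injective, h.off_point, h4]
    · rw [h1, Set.ncard_image_of_injective _ latin_injective, h.off_plane, h3]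

/-- The set of generators given by a set of points and a set of planes. -/
def genSet (A B : Set (Pt F 4)) : Set (Submodule F (Fin 6 → F)) := latin '' A ∪ greekPt '' B

theorem isGenerator_of_mem_genSet {A B : Set (Pt F 4)} : ∀ G ∈ genSet A B, IsGenerator G := by
  rintro _ (⟨P, -, rfl⟩ | ⟨w, -, rfl⟩)
  exacts [isGenerator_latin P, isGenerator_greekPt w]

theorem latin_mem_genSet {A B : Set (Pt F 4)} {P : Pt F 4} : latin P ∈ genSet A B ↔ P ∈ A := by
  constructor
  · rintro (⟨Q, hQ, h⟩ | ⟨w, -, h⟩)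
    · exact latin_injective h ▸ hQ
    · exact absurd h.symm (latin_ne_greekPt _ _)
  · exact fun h => Or.inl ⟨P, h, rfl⟩

theorem greekPt_mem_genSet {A B : Set (Pt F 4)} {w : Pt F 4} : greekPt w ∈ genSet A B ↔ w ∈ B := by
  constructor
  · rintro (⟨Q, -, h⟩ | ⟨w, hw, h⟩)
    · exact absurd h (latin_ne_greekPt _ _)
    · exact greekPt_injective h ▸ hw
  · exact fun h => Or.inr ⟨w, h, rfl⟩

theorem isCameronLiebler_genSet {A B : Set (Pt F 4)} {x : ℝ} (h : CLPair A B x) :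
    IsCameronLiebler (genSet A B) x := by
  rw [isCameronLiebler_iff isGenerator_of_mem_genSet]
  have h1 : ptSet (genSet A B) = A := Set.ext fun P => latin_mem_genSet
  have h2 : plSet (genSet A B) = B := Set.ext fun P => greekPt_mem_genSet
  rwa [h1, h2]

theorem genSet_subset {A B : Set (Pt F 4)} {L : Set (Submodule F (Fin 6 → F))}
    (hA : A ⊆ ptSet L) (hB : B ⊆ plSet L) : genSet A B ⊆ L := by
  rintro _ (⟨P, hP, rfl⟩ | ⟨w, hw, rfl⟩)
  exacts [hA hP, hB hw]

end Generators

/-! ### Lines give point-pencils, subgeometries give sets of Baer type -/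

section Pencils

/-- A plane misses q of the q + 1 points of a line, or none if it contains the line. -/
theorem clPair_line [Finite F] {M : Submodule F (Fin 4 → F)} (hM : finrank F M = 2) :
    CLPair (pts M) (pts (perp M)) 1 := by
  classical
  have key : ∀ M : Submodule F (Fin 4 → F), finrank F M = 2 → ∀ w : Pt F 4,
      (({P | P ∈ pts M ∧ ¬ orthogonal P w}.ncard : ℕ) : ℝ) =
      (1 - (pts (perp M)).indicator (fun _ => (1 : ℝ)) w) * (Nat.card F : ℝ) := by
    intro M hM w
    have e : ((_ : ℕ) : ℝ) = _ := congrArg Nat.cast (ncard_off (d := 1) hM w)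
    simp only [orthogonal_comm (v := w)] at e
    rw [Set.indicator_apply]
    split_ifs at e ⊢ <;> push_cast at e <;> linarith
  refine ⟨key M hM, fun p => ?_⟩
  have := key (perp M) (by rw [finrank_perp, hM]) p
  rwa [perp_perp] at this

/-- The vertex is the Plücker vector of `M`: it lies in the Latin planes of the points on `M` and in
the Greek planes of the planes through `M`. -/
theorem isPointPencil_line [Finite F] {M : Submodule F (Fin 4 → F)} (hM : finrank F M = 2) :
    IsPointPencil (genSet (pts M) (pts (perp M))) := by
  let e := finBasisOfFinrankEq F M hM
  obtain ⟨x, hx⟩ : ∃ x : Fin 4 → F, x = e 0 := ⟨_, rfl⟩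
  obtain ⟨y, hy⟩ : ∃ y : Fin 4 → F, y = e 1 := ⟨_, rfl⟩
  have hi : LinearIndependent F ![x, y] := by
    have := e.linearIndependent.map' M.subtype (Submodule.ker_subtype M)
    have e' : ![x, y] = M.subtype ∘ e := by
      ext i
      fin_cases i <;> simp [hx, hy]
    rwa [e']
  have hspan : M = Submodule.span F {x, y} := by
    symm
    refine Submodule.eq_of_le_of_finrank_eq ?_ (by rw [hM, finrank_pair hi])
    rw [Submodule.span_le]
    exact Set.insert_subset (hx ▸ (e 0).2) (Set.singleton_subset_iff.2 (hy ▸ (e 1).2))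
  have hx0 : x ≠ 0 := hi.ne_zero 0
  have hz : plucker x y ≠ 0 := fun h0 => by
    obtain ⟨a, ha⟩ := (plucker_eq_zero_iff hx0).1 h0
    exact (LinearIndependent.pair_iff' hx0).1 hi a ha
  refine ⟨Projectivization.mk F _ hz, ?_, ?_⟩
  · intro v hv
    rw [submodule_mk, Submodule.mem_span_singleton] at hv
    obtain ⟨a, rfl⟩ := hv
    rw [← pluckerMap_apply, ← map_smul]
    exact kleinForm_plucker _ _
  · have h1 : ∀ P : Pt F 4, plucker x y ∈ latin P ↔ P ∈ pts M := by
      intro P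
      induction P using Projectivization.ind with | h p hp => ?_
      rw [latin_mk, plucker_mem_pencil hz, mk_mem_pts, hspan]
    have h2 : ∀ P : Pt F 4, plucker x y ∈ greekPt P ↔ P ∈ pts (perp M) := by
      intro P
      induction P using Projectivization.ind with | h p hp => ?_
      rw [greekPt_mk, plucker_mem_dualPencil hz, mk_mem_pts, hspan, mem_perp_pair]
    ext G
    rw [submodule_mk]
    simp only [Set.mem_ofPred_eq, Submodule.span_singleton_le_iff_mem]
    constructor
    · rintro (⟨P, hP, rfl⟩ | ⟨P, hP, rfl⟩)
      · exact ⟨isGenerator_latin P, (h1 P).2 hP⟩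
      · exact ⟨isGenerator_greekPt P, (h2 P).2 hP⟩
    · rintro ⟨hG, hzG⟩
      obtain ⟨P, rfl⟩ | ⟨w, rfl⟩ := hG.eq_latin_or
      · exact latin_mem_genSet.2 ((h1 P).1 hzG)
      · exact greekPt_mem_genSet.2 ((h2 w).1 hzG)

/-- The set of generators given by a Baer subgeometry and its planes is of Baer type. -/
theorem isBaerType_genSet [Finite F] {K : Subfield F} (hq : Nat.card F = Nat.card K ^ 2)
    {b b' : Fin 4 → Fin 4 → F} (h : DualBases b b') :
    IsBaerType (genSet (baerPts K b) (baerPts K b')) := by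
  let B : Basis (Fin 4) F (Fin 4 → F) :=
    basisOfLinearIndependentOfCardEqFinrank h.linearIndependent (by simp)
  have hB : ∀ i, B i = b i := fun i => by simp [B]
  refine ⟨baerPts K b, ⟨K, hq.symm, B, ?_⟩, ?_⟩
  · have hsum : ∀ c : Fin 4 → K, ∑ i, (c i : F) • B i = latMap K b c := fun c => by
      rw [latMap_apply]
      exact Finset.sum_congr rfl fun i _ => by rw [hB]; rfl
    ext P
    simp only [hsum, Set.mem_ofPred_eq]
    constructor
    · rintro ⟨_, ⟨c, rfl⟩, h0, rfl⟩
      exact ⟨c, fun hc => h0 (by rw [hc, map_zero]), by rw [submodule_mk]⟩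
    · rintro ⟨c, hc, hP⟩
      have h0 : latMap K b c ≠ 0 := fun h0 => hc (h.injective (by rw [h0, map_zero]))
      exact ⟨_, ⟨c, rfl⟩, h0, submodule_injective (by rw [hP, submodule_mk])⟩
  · ext G
    constructor
    · rintro (⟨P, hP, rfl⟩ | ⟨w, hw, rfl⟩)
      · exact Or.inl ⟨P, hP, rfl⟩
      · exact Or.inr ⟨_, (h.isPlaneOf_iff hq w).2 hw, rfl⟩
    · rintro (⟨P, hP, rfl⟩ | ⟨W, hW, rfl⟩)
      · exact Or.inl ⟨P, hP, rfl⟩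
      · have h1 : finrank F (perp W) = 1 := by rw [finrank_perp, hW.1]
        have h2 : W = perp (Projectivization.mk'' (perp W) h1).submodule := by
          rw [submodule_mk'', perp_perp]
        refine Or.inr ⟨Projectivization.mk'' (perp W) h1, (h.isPlaneOf_iff hq _).1 (h2 ▸ hW), ?_⟩
        rw [greekPt, ← h2]

end Pencils

end

section

/-! ### A small blocking set without Baer subplanes -/

section Cross

/-- The set consisting of two lines, each without its point at infinity, and one further point at
infinity. -/
def crossSet : Set (Pt F 3) :=
  {P | ∀ v ∈ P.submodule, (v 2 ≠ 0 → v 0 * v 1 = 0) ∧ (v 2 = 0 → v 0 = v 1)}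

theorem mk_mem_crossSet {v : Fin 3 → F} (hv : v ≠ 0) :
    Projectivization.mk F v hv ∈ crossSet ↔
      (v 2 ≠ 0 → v 0 * v 1 = 0) ∧ (v 2 = 0 → v 0 = v 1) := by
  simp only [crossSet, Set.mem_ofPred_eq, submodule_mk]
  constructor
  · exact fun h => h v (Submodule.mem_span_singleton_self v)
  · intro h u hu
    obtain ⟨a, rfl⟩ := Submodule.mem_span_singleton.1 hu
    simp only [Pi.smul_apply, smul_eq_mul]
    constructor
    · intro h2
      have := h.1 (right_ne_zero_of_mul h2)
      linear_combination a * a * this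
    · intro h2
      rcases mul_eq_zero.1 h2 with h0 | h0
      · simp [h0]
      · rw [h.2 h0]

theorem exists_eq_perp_singleton {l : Submodule F (Fin 3 → F)} (hl : finrank F l = 2) :
    ∃ a : Fin 3 → F, a ≠ 0 ∧ l = perp (F ∙ a) := by
  have h1 : finrank F (perp l) = 1 := by rw [finrank_perp, hl]
  obtain ⟨a, ha, h⟩ := finrank_eq_one_iff'.1 h1
  refine ⟨a, fun h0 => ha (Subtype.ext h0), ?_⟩
  have : perp l = F ∙ (a : Fin 3 → F) := by
    ext u
    rw [Submodule.mem_span_singleton]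
    constructor
    · intro hu
      obtain ⟨c, hc⟩ := h ⟨u, hu⟩
      exact ⟨c, congrArg Subtype.val hc⟩
    · rintro ⟨c, rfl⟩
      exact (perp l).smul_mem c a.2
  rw [← this, perp_perp]

/-- For a line with coefficients `a`: if `a 1 ≠ 0` it meets X₀ = 0 off infinity, if `a 1 = 0 ≠ a 0`
it meets X₁ = 0 off infinity, and the line at infinity X₂ = 0 has the point (1, 1, 0). -/
theorem isBlockingSet_crossSet : IsBlockingSet (crossSet (F := F)) := by
  intro l hl
  obtain ⟨a, ha, rfl⟩ := exists_eq_perp_singleton hl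
  have key : ∀ v : Fin 3 → F, v ≠ 0 → a ⬝ᵥ v = 0 → (v 2 ≠ 0 → v 0 * v 1 = 0) →
      (v 2 = 0 → v 0 = v 1) → ∃ P ∈ crossSet (F := F), P.submodule ≤ perp (F ∙ a) :=
    fun v hv h1 h2 h3 => ⟨Projectivization.mk F v hv, (mk_mem_crossSet hv).2 ⟨h2, h3⟩, by
      rwa [submodule_mk, Submodule.span_singleton_le_iff_mem, mem_perp_span_singleton]⟩
  have hne : ∀ {v : Fin 3 → F} (i : Fin 3), v i ≠ 0 → v ≠ 0 := fun i h h0 => h (by simp [h0])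
  by_cases h1 : a 1 = 0
  · by_cases h0 : a 0 = 0
    · exact key ![1, 1, 0] (hne 0 (by simp)) (by simp [dotProduct, Fin.sum_univ_three, h0, h1])
        (by simp) (by simp)
    · by_cases h2 : a 2 = 0
      · exact key ![0, 0, 1] (hne 2 (by simp)) (by simp [dotProduct, Fin.sum_univ_three, h2])
          (by simp) (by simp)
      · refine key ![-a 2, 0, a 0] (hne 2 (by simpa)) ?_ (by simp) (by simp [h0])
        simp [dotProduct, Fin.sum_univ_three]
        ring
  · refine key ![0, -a 2, a 1] (hne 2 (by simpa)) ?_ (by simp) (by simp [h1])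
    simp [dotProduct, Fin.sum_univ_three]
    ring

/-- A line through (1, 0, 0) or (0, 1, 0) contains a point missing from the set. Any other line
meets the two axes in at most two affine points, and has a third affine point because q > 2. -/
theorem not_line_crossSet [Finite F] (hF : 2 < Nat.card F) (l : Submodule F (Fin 3 → F))
    (hl : finrank F l = 2) : ∃ P : Pt F 3, P.submodule ≤ l ∧ P ∉ crossSet := by
  obtain ⟨a, ha, rfl⟩ := exists_eq_perp_singleton hl
  have hne : ∀ {v : Fin 3 → F} (i : Fin 3), v i ≠ 0 → v ≠ 0 := fun i h h0 => h (by simp [h0])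
  have key : ∀ v : Fin 3 → F, v ≠ 0 → a ⬝ᵥ v = 0 →
      ¬ ((v 2 ≠ 0 → v 0 * v 1 = 0) ∧ (v 2 = 0 → v 0 = v 1)) →
      ∃ P : Pt F 3, P.submodule ≤ perp (F ∙ a) ∧ P ∉ crossSet :=
    fun v hv h1 h2 => ⟨Projectivization.mk F v hv, by
      rwa [submodule_mk, Submodule.span_singleton_le_iff_mem, mem_perp_span_singleton],
      fun h => h2 ((mk_mem_crossSet hv).1 h)⟩
  by_cases h0 : a 0 = 0
  · exact key ![1, 0, 0] (hne 0 (by simp)) (by simp [dotProduct, Fin.sum_univ_three, h0])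
      (by simp)
  by_cases h1 : a 1 = 0
  · exact key ![0, 1, 0] (hne 1 (by simp)) (by simp [dotProduct, Fin.sum_univ_three, h1])
      (by simp)
  classical
  have : Fintype F := Fintype.ofFinite F
  obtain ⟨t, ht⟩ := Finset.exists_mem_notMem_of_card_lt_card
    (s := {0, -a 2 / a 1}) (t := (Finset.univ : Finset F)) (by
      refine lt_of_le_of_lt Finset.card_le_two ?_
      rwa [Finset.card_univ, ← Nat.card_eq_fintype_card])
  simp only [Finset.mem_insert, Finset.mem_singleton, not_or] at ht
  refine key ![(-a 2 - a 1 * t) / a 0, t, 1] (hne 2 (by simp)) ?_ ?_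
  · simp [dotProduct, Fin.sum_univ_three]
    field_simp
    ring
  · have h3 : -a 2 - a 1 * t ≠ 0 := fun h => ht.2.2 (by
      rw [eq_div_iff h1]
      linear_combination -h)
    simp [h0, h3, ht.2.1]

/-- A crude bound, enough for δ ≤ q + 1. -/
theorem ncard_crossSet_le [Finite F] : (crossSet (F := F)).ncard ≤ 2 * Nat.card F + 1 := by
  have hne : ∀ {v : Fin 3 → F} (i : Fin 3), v i ≠ 0 → v ≠ 0 := fun i h h0 => h (by simp [h0])
  let f : F → Pt F 3 := fun y => Projectivization.mk F ![0, y, 1] (hne 2 (by simp))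
  let g : F → Pt F 3 := fun y => Projectivization.mk F ![y, 0, 1] (hne 2 (by simp))
  let e : Pt F 3 := Projectivization.mk F ![1, 1, 0] (hne 0 (by simp))
  have : Finite (Pt F 3) := Projectivization.finite_of_finite F _
  have h1 : crossSet ⊆ (Set.range f ∪ Set.range g) ∪ {e} := by
    intro P hP
    induction P using Projectivization.ind with | h v hv => ?_
    rw [mk_mem_crossSet] at hP
    by_cases h2 : v 2 = 0
    · refine Or.inr ((mk_eq_mk_iff' F _ _ _ _).2 ⟨v 0, ?_⟩)
      ext i
      fin_cases i <;> simp [h2, hP.2 h2]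
    · rcases mul_eq_zero.1 (hP.1 h2) with h | h
      · refine Or.inl (Or.inl ⟨v 1 / v 2, (mk_eq_mk_iff' F _ _ _ _).2 ⟨(v 2)⁻¹, ?_⟩⟩)
        ext i
        fin_cases i <;> simp [h, h2, div_eq_inv_mul]
      · refine Or.inl (Or.inr ⟨v 0 / v 2, (mk_eq_mk_iff' F _ _ _ _).2 ⟨(v 2)⁻¹, ?_⟩⟩)
        ext i
        fin_cases i <;> simp [h, h2, div_eq_inv_mul]
  have hr : ∀ h : F → Pt F 3, (Set.range h).ncard ≤ Nat.card F := fun h => by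
    rw [← Set.image_univ, ← Set.ncard_univ]
    exact Set.ncard_image_le
  have h2 := Set.ncard_le_ncard h1
  have h3 := Set.ncard_union_le (Set.range f ∪ Set.range g) {e}
  have h4 := Set.ncard_union_le (Set.range f) (Set.range g)
  have h5 := hr f
  have h6 := hr g
  rw [Set.ncard_singleton] at h3
  omega

/-- The span over the subfield of the basis of a Baer subplane. -/
theorem IsBaerSubgeometry.exists_triple {S : Set (Pt F 3)} (hS : IsBaerSubgeometry S) :
    ∃ K : Subfield F, Nat.card K ^ 2 = Nat.card F ∧ ∃ Λ : Submodule K (Fin 3 → F),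
      (∃ x y z, IsTriple F Λ x y z) ∧ ∀ v ∈ Λ, v ≠ 0 → v ∈ vecs S := by
  obtain ⟨K, hK, b, rfl⟩ := hS
  have ht : IsTriple F (Submodule.span K {b 0, b 1, b 2}) (b 0) (b 1) (b 2) := by
    refine ⟨?_, rfl⟩
    have e : ![b 0, b 1, b 2] = b := by
      ext i : 1
      fin_cases i <;> rfl
    rw [e]
    exact b.linearIndependent
  refine ⟨K, hK, _, ⟨_, _, _, ht⟩, fun v hv hv0 => ⟨hv0, ?_⟩⟩
  obtain ⟨k, l, m, h⟩ := ht.exists_coords hv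
  have e : ∑ i, ((![k, l, m] i : K) : F) • b i = v := by
    rw [h]
    simp [Fin.sum_univ_three, Subfield.smul_def]
  refine ⟨![k, l, m], fun h0 => hv0 ?_, by rw [submodule_mk, e]⟩
  rw [← e, h0]
  simp

/-- A Baer subplane meets the line at infinity, so it contains c = (c₀, c₀, 0) and no other point at
infinity. An affine vector of `Λ` must stay on the axes when `K`-multiples of c are added, which
forces a translate starting with (0, -c₀). The difference of two such translates starts with (0, 0),
so its own translates have equal first coordinates and never start with (0, -c₀). -/
theorem not_containsBaerSubplane_crossSet [Finite F] :
    ¬ ContainsBaerSubplane (crossSet (F := F)) := by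
  rintro ⟨S, hS, hSB⟩
  obtain ⟨K, hK, Λ, ⟨x, y, z, ht⟩, hΛ⟩ := hS.exists_triple
  have good : ∀ v ∈ Λ, (v 2 ≠ 0 → v 0 * v 1 = 0) ∧ (v 2 = 0 → v 0 = v 1) := by
    intro v hv
    by_cases hv0 : v = 0
    · simp [hv0]
    · obtain ⟨h, h'⟩ := hΛ v hv hv0
      exact (mk_mem_crossSet h).1 (hSB h')
  obtain ⟨c, hc, hc0, hc2⟩ : ∃ c ∈ Λ, c ≠ 0 ∧ c 2 = 0 := by
    have := finite_subfield (F := F) K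
    let f : Λ →ₗ[K] F := (LinearMap.proj (R := K) (φ := fun _ : Fin 3 => F) 2).comp Λ.subtype
    have hlt : finrank K F < finrank K Λ := by
      rw [ht.finrank_eq, finrank_eq_two hK.symm]; norm_num
    have : 0 < finrank K (LinearMap.ker f) := by
      have h1 := LinearMap.finrank_range_add_finrank_ker f
      have h2 := Submodule.finrank_le (LinearMap.range f)
      omega
    obtain ⟨y, hy⟩ := (Submodule.ne_bot_iff _).1 (Submodule.one_le_finrank_iff.1 this)
    exact ⟨y, y.2, fun h => hy.2 (Subtype.ext h), hy.1⟩
  have hc1 := (good c hc).2 hc2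
  have hC0 : c 0 ≠ 0 := fun h => hc0 (by
    ext i
    fin_cases i
    exacts [h, hc1 ▸ h, hc2])
  have hinf : ∀ v ∈ Λ, v 2 = 0 → v ∈ Submodule.span K {c} := by
    intro v hv h2
    have h1 := (good v hv).2 h2
    have e : (v 0 / c 0) • c = v := by
      ext i
      fin_cases i
      · simp [hC0]
      · simp [← hc1, hC0, h1]
      · simp [hc2, h2]
    obtain ⟨k, hk⟩ := ht.isScalarClosed c hc hc0 (v 0 / c 0) (e.symm ▸ hv)
    rw [Submodule.mem_span_singleton]
    exact ⟨k, by rw [← e, ← hk, algebraMap_smul]⟩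
  have norm : ∀ v ∈ Λ, v 2 ≠ 0 → ∃ u ∈ Λ, u 0 = 0 ∧ u 1 = -c 0 ∧ ∃ k : K, u = v + k • c := by
    intro v hv h2
    have h3 := (good _ (Λ.add_mem hv hc)).1 (by simpa [hc2] using h2)
    simp only [Pi.add_apply, ← hc1] at h3
    rcases mul_eq_zero.1 ((good v hv).1 h2) with h | h
    · refine ⟨v, hv, h, ?_, 0, by simp⟩
      rw [h, zero_add] at h3
      linear_combination (mul_eq_zero.1 h3).resolve_left hC0
    · rw [h, zero_add] at h3
      have h4 := (mul_eq_zero.1 h3).resolve_right hC0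
      exact ⟨v + c, Λ.add_mem hv hc, by simpa using h4, by
        simp only [Pi.add_apply, h, zero_add]
        -- Here v + c starts with (0, c₀), and testing v + 2c forces 2c₀ = 0, so the sign does not
        -- matter.
        have h5 := (good _ (Λ.add_mem (Λ.add_mem hv hc) hc)).1 (by simpa [hc2] using h2)
        simp only [Pi.add_apply, ← hc1, h, zero_add] at h5
        rw [h4, zero_add] at h5
        rcases mul_eq_zero.1 h5 with h6 | h6
        · exact absurd h6 hC0
        · linear_combination h6 - hc1, 1, by simp⟩
  obtain ⟨u, w, htc⟩ := ht.exists_of_mem hc hc0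
  have hu2 : ∀ v ∈ Λ, (v = u ∨ v = w ∨ ∃ l : K, v = u - w + l • c) → v 2 ≠ 0 := by
    intro v hv h h2
    obtain ⟨m, rfl⟩ := Submodule.mem_span_singleton.1 (hinf v hv h2)
    have hh : ∀ a b d : K, a • c + b • u + d • w = 0 → b = 0 := by
      intro a b d h
      have := (combo_eq_zero htc.indep (a := (a : F)) (b := (b : F)) (c := (d : F))
        (by simpa [Subfield.smul_def] using h)).2.1
      exact_mod_cast this
    have hh' : ∀ a b d : K, a • c + b • u + d • w = 0 → d = 0 := by
      intro a b d h
      have := (combo_eq_zero htc.indep (a := (a : F)) (b := (b : F)) (c := (d : F))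
        (by simpa [Subfield.smul_def] using h)).2.2
      exact_mod_cast this
    rcases h with h | h | ⟨l, h⟩
    · exact one_ne_zero (neg_eq_zero.1 (hh m (-1) 0 (by rw [h]; module)))
    · exact one_ne_zero (neg_eq_zero.1 (hh' m 0 (-1) (by rw [h]; module)))
    · exact one_ne_zero (neg_eq_zero.1 (hh (m - l) (-1) 1 (by rw [sub_smul, h]; module)))
  obtain ⟨u', hu', hu0, hu1, k, hk⟩ := norm u htc.mem_mid (hu2 u htc.mem_mid (Or.inl rfl))
  obtain ⟨w', hw', hw0, hw1, l, hl⟩ := norm w htc.mem_right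
    (hu2 w htc.mem_right (Or.inr (Or.inl rfl)))
  have hd := hu2 (u' - w') (Λ.sub_mem hu' hw') (Or.inr (Or.inr ⟨k - l, by rw [hk, hl]; module⟩))
  obtain ⟨v, hv, hv0, hv1, m, hm⟩ := norm _ (Λ.sub_mem hu' hw') hd
  have e0 : (u' - w' + m • c) 0 = (m : F) * c 0 := by
    simp [hu0, hw0, Subfield.smul_def]
  have e1 : (u' - w' + m • c) 1 = (m : F) * c 0 := by
    simp [hu1, hw1, Subfield.smul_def, hc1]
  rw [← hm] at e0 e1
  apply hC0
  linear_combination hv1 - e1 + e0 - hv0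

end Cross

end

section

/-! ### Decomposition of Cameron-Liebler sets -/

/-- A subfield of order k is the set of roots of X^k - X. Each plane section brings its own
subfield, and this makes them all equal. -/
theorem subfield_eq_of_card [Finite F] {K K' : Subfield F} (h : Nat.card K = Nat.card K') :
    K = K' := by
  classical
  have : Fintype F := Fintype.ofFinite F
  have h1 : 1 < Nat.card K := Finite.one_lt_card
  let R : Finset F := (Polynomial.X ^ Nat.card K - Polynomial.X : Polynomial F).roots.toFinset
  have hR : R.card ≤ Nat.card K := by
    refine (Multiset.toFinset_card_le _).trans ((Polynomial.card_roots' _).trans ?_)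
    rw [FiniteField.X_pow_card_sub_X_natDegree_eq F h1]
  have key : ∀ k : Subfield F, Nat.card k = Nat.card K → (k : Set F).toFinset = R := by
    intro k hk
    refine Finset.eq_of_subset_of_card_le ?_ ?_
    · intro a ha
      rw [Set.mem_toFinset] at ha
      rw [Multiset.mem_toFinset, Polynomial.mem_roots (FiniteField.X_pow_card_sub_X_ne_zero F h1)]
      have := FiniteField.pow_card (⟨a, ha⟩ : k)
      rw [← Nat.card_eq_fintype_card, hk] at this
      have := congrArg Subtype.val this
      simpa [sub_eq_zero] using this
    · rw [Set.toFinset_card, ← Nat.card_eq_fintype_card]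
      exact hR.trans hk.ge
  exact SetLike.coe_injective (Set.toFinset_inj.1 ((key K rfl).trans (key K' h.symm).symm))

/-! ### From blocking sets in plane sections to a Baer subgeometry -/

section Planes

variable [Finite F]

/-- A plane section of a Cameron-Liebler pair contains a Baer subplane if small non-trivial
blocking sets do. -/
theorem CLPair.exists_isPlaneSpan {A B : Set (Pt F 4)} {n : ℕ} (h : CLPair A B n)
    (hline : ∀ M : Submodule F (Fin 4 → F), finrank F M = 2 → ¬ pts M ⊆ A)
    (hmin : ∀ C : Set (Pt F 3), IsNontrivialBlockingSet C → C.ncard = n + Nat.card F →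
      ContainsBaerSubplane C) {w : Fin 4 → F} (hw : w ∈ vecs B) :
    ∃ K : Subfield F, Nat.card K ^ 2 = Nat.card F ∧
      ∃ Λ : Submodule K (Fin 4 → F), IsPlaneSpan A w Λ := by
  obtain ⟨hw0, hwB⟩ := hw
  have h3 : finrank F (perp (F ∙ w)) = 3 := by rw [finrank_perp, finrank_span_singleton hw0]
  let e := finBasisOfFinrankEq F (perp (F ∙ w)) h3
  let φ : (Fin 3 → F) →ₗ[F] (Fin 4 → F) :=
    (perp (F ∙ w)).subtype.comp e.equivFun.symm.toLinearMap
  have hφ : Function.Injective φ := Subtype.val_injective.comp e.equivFun.symm.injective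
  have hφw : ∀ v, φ v ∈ perp (F ∙ w) := fun v => (e.equivFun.symm v).2
  have hφs : ∀ u ∈ perp (F ∙ w), ∃ v, φ v = u := fun u hu =>
    ⟨e.equivFun ⟨u, hu⟩, by simp [φ]⟩
  let m := Projectivization.map φ hφ
  have hm : Function.Injective m := Projectivization.map_injective φ hφ
  have hmk : ∀ v (hv : v ≠ 0), m (Projectivization.mk F v hv) =
      Projectivization.mk F (φ v) fun h0 => hv (hφ (h0.trans (map_zero φ).symm)) :=
    fun v hv => Projectivization.map_mk φ hφ v hv
  have hmem : ∀ (P : Pt F 3) (l : Submodule F (Fin 3 → F)), m P ∈ pts (l.map φ) ↔ P ∈ pts l := by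
    intro P l
    induction P using Projectivization.ind with | h v hv => ?_
    rw [hmk, mk_mem_pts, mk_mem_pts, Submodule.mem_map]
    exact ⟨fun ⟨u, hu, h⟩ => hφ h ▸ hu, fun h => ⟨v, h, rfl⟩⟩
  have hsurj : ∀ P ∈ pts (perp (F ∙ w)), ∃ Q, m Q = P := by
    intro P hP
    induction P using Projectivization.ind with | h u hu => ?_
    rw [mk_mem_pts] at hP
    obtain ⟨v, rfl⟩ := hφs u hP
    exact ⟨Projectivization.mk F v fun h0 => hu (by rw [h0, map_zero]), rfl⟩
  have hl2 : ∀ l : Submodule F (Fin 3 → F), finrank F l = 2 → finrank F (l.map φ) = 2 :=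
    fun l hl => by rw [← (l.equivMapOfInjective φ hφ).finrank_eq, hl]
  have hle : ∀ l : Submodule F (Fin 3 → F), l.map φ ≤ perp (F ∙ w) := by
    rintro l _ ⟨v, -, rfl⟩
    exact hφw v
  -- Every line of the plane lies on a plane of `B`, namely `w`, so by `ncard_line` it has a point
  -- of `A`.
  have hblock : IsNontrivialBlockingSet (m ⁻¹' A) := by
    constructor
    · intro l hl
      have h1 : Projectivization.mk F w hw0 ∈ B ∩ pts (perp (l.map φ)) := by
        refine ⟨hwB, ?_⟩
        rw [mk_mem_pts]
        exact le_perp_comm.1 (hle l) (Submodule.mem_span_singleton_self w)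
      have h2 := (Set.ncard_pos (Set.toFinite _)).2 ⟨_, h1⟩
      rw [← h.ncard_line (hl2 l hl), Set.ncard_pos (Set.toFinite _)] at h2
      obtain ⟨P, hPA, hP⟩ := h2
      obtain ⟨Q, rfl⟩ := hsurj P (pts_mono (hle l) hP)
      exact ⟨Q, hPA, (hmem Q l).1 hP⟩
    · rintro ⟨l, hl, hlA⟩
      refine hline _ (hl2 l hl) fun P hP => ?_
      obtain ⟨Q, rfl⟩ := hsurj P (pts_mono (hle l) hP)
      exact hlA Q ((hmem Q l).1 hP)
  have hcard : (m ⁻¹' A).ncard = n + Nat.card F := by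
    have h1 := h.ncard_plane (Projectivization.mk F w hw0)
    rw [Set.indicator_of_mem hwB, one_mul, submodule_mk] at h1
    have h2 : m '' (m ⁻¹' A) = A ∩ pts (perp (F ∙ w)) := by
      rw [Set.image_preimage_eq_inter_range]
      congr 1
      ext P
      refine ⟨?_, hsurj P⟩
      rintro ⟨Q, rfl⟩
      induction Q using Projectivization.ind with | h v hv => ?_
      rw [hmk, mk_mem_pts]
      exact hφw v
    rw [← Set.ncard_image_of_injective _ hm, h2]
    exact_mod_cast h1
  obtain ⟨S, hS, hSA⟩ := hmin _ hblock hcard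
  obtain ⟨K, hK, Λ, ⟨x, y, z, ht⟩, hΛ⟩ := hS.exists_triple
  refine ⟨K, hK, Λ.map (φ.restrictScalars K), ⟨φ x, φ y, φ z, ?_, ?_⟩, ?_, ?_⟩
  · have e' : ![φ x, φ y, φ z] = φ ∘ ![x, y, z] := by
      ext i : 1
      fin_cases i <;> rfl
    rw [e']
    exact ht.indep.map' φ (LinearMap.ker_eq_bot.2 hφ)
  · rw [ht.span_eq, Submodule.map_span]
    simp [Set.image_insert_eq]
  · rintro _ ⟨v, -, rfl⟩
    exact mem_perp_span_singleton.1 (hφw v)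
  · rintro _ ⟨v, hv, rfl⟩ h0
    refine ⟨h0, ?_⟩
    obtain ⟨hv0, hvS⟩ := hΛ v hv fun h => h0 (by simp [h])
    exact hSA hvS

/-- The line has q + 1 points in `A`, hence q + 1 planes of `B` through it, which is all of them. -/
theorem CLPair.pts_perp_subset {A B : Set (Pt F 4)} {x : ℝ} (h : CLPair A B x)
    {M : Submodule F (Fin 4 → F)} (hM : finrank F M = 2) (hMA : pts M ⊆ A) :
    pts (perp M) ⊆ B := by
  have h1 := h.ncard_line hM
  rw [Set.inter_eq_right.2 hMA, ncard_pts hM] at h1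
  have h2 : finrank F (perp M) = 2 := by rw [finrank_perp, hM]
  have h3 := Set.eq_of_subset_of_ncard_le (Set.inter_subset_right (s := B) (t := pts (perp M)))
    (by rw [← h1, ncard_pts h2])
  exact Set.inter_eq_right.1 h3

theorem CLPair.ncard_perp_span {A B : Set (Pt F 4)} {n : ℕ} (h : CLPair A B n) {w : Fin 4 → F}
    (hw : w ≠ 0) : (w ∈ vecs B → (A ∩ pts (perp (F ∙ w))).ncard = n + Nat.card F) ∧
      (w ∉ vecs B → (A ∩ pts (perp (F ∙ w))).ncard = n) := by
  have h1 := h.ncard_plane (Projectivization.mk F w hw)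
  rw [submodule_mk] at h1
  constructor <;> intro hB <;> rw [← mk_mem_iff hw] at hB
  · rw [Set.indicator_of_mem hB, one_mul] at h1
    exact_mod_cast h1
  · rw [Set.indicator_of_notMem hB, zero_mul, add_zero] at h1
    exact_mod_cast h1

/-- A Cameron-Liebler pair with small parameter and without lines contains a Baer subgeometry. -/
theorem CLPair.exists_baer {A B : Set (Pt F 4)} {n : ℕ} (h : CLPair A B n) (hn : n ≤ Nat.card F)
    (hA : ∀ M : Submodule F (Fin 4 → F), finrank F M = 2 → ¬ pts M ⊆ A)
    (hmin : ∀ C : Set (Pt F 3), IsNontrivialBlockingSet C → C.ncard = n + Nat.card F →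
      ContainsBaerSubplane C) (hB : B.Nonempty) :
    ∃ K : Subfield F, Nat.card K ^ 2 = Nat.card F ∧
      ∃ b b', DualBases b b' ∧ baerPts K b ⊆ A ∧ baerPts K b' ⊆ B := by
  have hB' : ∀ M : Submodule F (Fin 4 → F), finrank F M = 2 → ¬ pts M ⊆ B := fun M hM hMB =>
    hA (perp M) (by rw [finrank_perp, hM]) (h.swap.pts_perp_subset hM hMB)
  obtain ⟨P, hP⟩ := hB
  have hP' : P.rep ∈ vecs B := ⟨P.rep_nonzero, by rwa [mk_rep]⟩
  obtain ⟨K, hK, -⟩ := h.exists_isPlaneSpan hA hmin hP'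
  have huniq : ∀ K' : Subfield F, Nat.card K' ^ 2 = Nat.card F → K' = K := fun K' hK' =>
    subfield_eq_of_card (Nat.pow_left_injective two_ne_zero (hK'.trans hK.symm))
  have hbp : BaerPair K A B n :=
    { line := fun M hM => h.ncard_line hM
      richA := fun w hw => (h.ncard_perp_span hw.1).1 hw
      richB := fun w hw => (h.swap.ncard_perp_span hw.1).1 hw
      poorB := fun w hw => (h.swap.ncard_perp_span hw).2
      poorA := fun w hw => (h.ncard_perp_span hw).2
      spanA := fun w hw => by
        obtain ⟨K', hK', hs⟩ := h.exists_isPlaneSpan hA hmin hw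
        obtain rfl := huniq K' hK'
        exact hs
      spanB := fun w hw => by
        obtain ⟨K', hK', hs⟩ := h.swap.exists_isPlaneSpan hB' hmin hw
        obtain rfl := huniq K' hK'
        exact hs
      le_card := hn
      card_eq := hK.symm }
  exact ⟨K, hK, hbp.exists_baer ⟨_, hP'⟩⟩

end Planes

/-! ### Splitting off one component at a time -/

section Sets

variable [Finite F]

theorem IsCameronLiebler.sdiff {L C : Set (Submodule F (Fin 6 → F))} {x y : ℝ}
    (hL : IsCameronLiebler L x) (hC : IsCameronLiebler C y) (h : C ⊆ L) :
    IsCameronLiebler (L \ C) (x - y) := by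
  refine ⟨fun G hG => hL.1 G hG.1, fun G hG => ?_⟩
  have e : {H | H ∈ L \ C ∧ Disjoint H G} =
      {H | H ∈ L ∧ Disjoint H G} \ {H | H ∈ C ∧ Disjoint H G} := by
    ext H
    simp only [Set.mem_sdiff, Set.mem_ofPred_eq]
    tauto
  have hsub : {H | H ∈ C ∧ Disjoint H G} ⊆ {H | H ∈ L ∧ Disjoint H G} :=
    fun H hH => ⟨h hH.1, hH.2⟩
  rw [e, Set.cast_ncard_sdiff hsub (Set.toFinite _), hL.2 G hG, hC.2 G hG,
    Set.indicator_sdiff h]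
  simp only [Pi.sub_apply]
  ring

/-- A non-empty Cameron-Liebler set with small parameter contains a point-pencil or a set of Baer
subgeometry type. -/
theorem IsCameronLiebler.exists_subset {s d : ℕ} (hs : Nat.card F = s ^ 2) (hd : d ≤ Nat.card F + 1)
    (hmin : ∀ C : Set (Pt F 3), IsNontrivialBlockingSet C → C.ncard < Nat.card F + d →
      ContainsBaerSubplane C)
    {L : Set (Submodule F (Fin 6 → F))} {x : ℝ} (hL : IsCameronLiebler L x) (hx : x < d)
    (hne : L.Nonempty) :
    ∃ C ⊆ L, C.Nonempty ∧ ∃ y : ℝ, 0 ≤ y ∧ IsCameronLiebler C y ∧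
      (IsPointPencil C ∨ (IsBaerType C ∧ IsCameronLiebler C ((s : ℝ) + 1))) := by
  have h := (isCameronLiebler_iff hL.1 x).1 hL
  set A := ptSet L with hA
  set B := plSet L with hB
  have hq := card_pos_real (F := F)
  have pos : ∀ {A' B' : Set (Pt F 4)}, CLPair A' B' x → A'.Nonempty → 0 < x := by
    intro A' B' h' hA'
    have h1 : (0 : ℝ) < A'.ncard := by exact_mod_cast (Set.ncard_pos (Set.toFinite _)).2 hA'
    rw [h'.ncard_eq] at h1
    exact pos_of_mul_pos_left h1 (by positivity)
  have hx0 : 0 < x := by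
    obtain ⟨G, hG⟩ := hne
    obtain ⟨P, rfl⟩ | ⟨w, rfl⟩ := (hL.1 G hG).eq_latin_or
    · exact pos h ⟨P, hG⟩
    · exact pos h.swap ⟨w, hG⟩
  have hBne : B.Nonempty := by
    rw [← Set.ncard_pos (Set.toFinite _)]
    have : (0 : ℝ) < B.ncard := by
      rw [h.swap.ncard_eq]
      positivity
    exact_mod_cast this
  -- The parameter is an integer, because a plane of `B` has x + q points of `A`.
  obtain ⟨n, rfl⟩ : ∃ n : ℕ, x = n := by
    obtain ⟨w, hw⟩ := hBne
    have h1 := h.ncard_plane w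
    rw [Set.indicator_of_mem hw, one_mul] at h1
    have h2 : Nat.card F ≤ (A ∩ pts (perp w.submodule)).ncard := by
      have : (Nat.card F : ℝ) ≤ (A ∩ pts (perp w.submodule)).ncard := by linarith
      exact_mod_cast this
    refine ⟨(A ∩ pts (perp w.submodule)).ncard - Nat.card F, ?_⟩
    rw [Nat.cast_sub h2]
    linarith
  have hnd : n < d := by exact_mod_cast hx
  have hne' : ∀ {A' B' : Set (Pt F 4)} {y : ℝ}, CLPair A' B' y → 0 < y →
      (genSet A' B').Nonempty := by
    intro A' B' y h' hy
    have h1 : (0 : ℝ) < A'.ncard := by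
      rw [h'.ncard_eq]
      positivity
    obtain ⟨P, hP⟩ := (Set.ncard_pos (Set.toFinite A')).1 (by exact_mod_cast h1)
    exact ⟨_, latin_mem_genSet.2 hP⟩
  by_cases hline : ∃ M : Submodule F (Fin 4 → F), finrank F M = 2 ∧ pts M ⊆ A
  · obtain ⟨M, hM, hMA⟩ := hline
    exact ⟨genSet (pts M) (pts (perp M)), genSet_subset hMA (h.pts_perp_subset hM hMA),
      hne' (clPair_line hM) one_pos, 1, zero_le_one, isCameronLiebler_genSet (clPair_line hM),
      Or.inl (isPointPencil_line hM)⟩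
  -- The first `omega` is n ≤ q, from n < d ≤ q + 1.
  · obtain ⟨K, hK, b, b', hb, hbA, hbB⟩ := h.exists_baer (by omega)
      (fun M hM hMA => hline ⟨M, hM, hMA⟩) (fun C hC hcard => hmin C hC (by omega)) hBne
    have hKs : Nat.card K = s := Nat.pow_left_injective two_ne_zero (hK.trans hs)
    have hCL := isCameronLiebler_genSet (hb.clPair hK.symm)
    rw [hKs] at hCL
    exact ⟨genSet (baerPts K b) (baerPts K b'), genSet_subset hbA hbB,
      hne' (hb.clPair hK.symm) (by positivity), _, by positivity, hCL,
      Or.inr ⟨isBaerType_genSet hK.symm hb, hCL⟩⟩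

/-- The decomposition of a Cameron-Liebler set with small parameter. -/
theorem IsCameronLiebler.exists_decomposition {s d : ℕ} (hs : Nat.card F = s ^ 2)
    (hd : d ≤ Nat.card F + 1)
    (hmin : ∀ C : Set (Pt F 3), IsNontrivialBlockingSet C → C.ncard < Nat.card F + d →
      ContainsBaerSubplane C)
    {L : Set (Submodule F (Fin 6 → F))} {x : ℝ} (hL : IsCameronLiebler L x) (hx : x < d) :
    ∃ D : Set (Set (Submodule F (Fin 6 → F))),
      (∀ C ∈ D, IsPointPencil C ∨ (IsBaerType C ∧ IsCameronLiebler C ((s : ℝ) + 1))) ∧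
      D.PairwiseDisjoint id ∧ L = ⋃₀ D := by
  -- The removed part has parameter `y ≥ 0`, so the bound on the parameter persists; the size drops
  -- strictly.
  induction h : L.ncard using Nat.strong_induction_on generalizing L x with | _ N ih => ?_
  obtain rfl | hne := L.eq_empty_or_nonempty
  · exact ⟨∅, by simp, by simp, by simp⟩
  obtain ⟨C, hCL, hC, y, hy, hCy, hC'⟩ := hL.exists_subset hs hd hmin hx hne
  have hlt : (L \ C).ncard < N := by
    rw [← h]
    obtain ⟨G, hG⟩ := hC
    exact Set.ncard_lt_ncard ⟨Set.sdiff_subset, fun h' => (h' (hCL hG)).2 hG⟩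
  obtain ⟨D, hD1, hD2, hD3⟩ := ih _ hlt (hL.sdiff hCy hCL) (by linarith) rfl
  refine ⟨insert C D, ?_, ?_, ?_⟩
  · rintro E (rfl | hE)
    exacts [hC', hD1 E hE]
  · rw [Set.pairwiseDisjoint_insert]
    refine ⟨hD2, fun E hE _ => ?_⟩
    have : E ⊆ L \ C := hD3 ▸ Set.subset_sUnion_of_mem hE
    exact Set.disjoint_left.2 fun G hG hG' => (this hG').2 hG
  · rw [Set.sUnion_insert, ← hD3, Set.union_sdiff_cancel hCL]

/-- The excess of the least size of a non-trivial blocking set without Baer subplanes. -/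
theorem le_of_isLeast_blockingSet {s d : ℕ} (hs : Nat.card F = s ^ 2)
    (hd : Nat.card F + d ∈ lowerBounds {n : ℕ | ∃ B : Set (Pt F 3), IsNontrivialBlockingSet B ∧
      ¬ ContainsBaerSubplane B ∧ B.ncard = n}) : d ≤ Nat.card F + 1 := by
  have h1 : 1 < Nat.card F := Finite.one_lt_card
  -- A square larger than 1 is at least 4, which `not_line_crossSet` needs.
  have h2 : 2 < Nat.card F := by
    rw [hs] at *
    have : 2 ≤ s := by
      by_contra! h
      interval_cases s <;> simp at h1
    nlinarith
  have h3 := hd ⟨crossSet, ⟨isBlockingSet_crossSet, fun ⟨l, hl, h⟩ => by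
    obtain ⟨P, hP, hP'⟩ := not_line_crossSet h2 l hl
    exact hP' (h P hP)⟩, not_containsBaerSubplane_crossSet, rfl⟩
  have h4 := ncard_crossSet_le (F := F)
  omega

end Sets

end

end KleinCL

theorem mainTheorem3 {F : Type*} [Field F] [Finite F] (q s δ : ℕ)
    (hq : Nat.card F = q) (hs : q = s ^ 2)
    (hδ : IsLeast {n : ℕ | ∃ B : Set (KleinCL.Pt F 3), KleinCL.IsNontrivialBlockingSet B ∧
      ¬ KleinCL.ContainsBaerSubplane B ∧ B.ncard = n} (q + δ))
    (L : Set (Submodule F (Fin 6 → F))) (x : ℝ)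
    (hL : KleinCL.IsCameronLiebler L x) (hx : x < δ) :
    ∃ D : Set (Set (Submodule F (Fin 6 → F))),
      (∀ C ∈ D, KleinCL.IsPointPencil C ∨
        (KleinCL.IsBaerType C ∧ KleinCL.IsCameronLiebler C ((s : ℝ) + 1))) ∧
      D.PairwiseDisjoint id ∧ L = ⋃₀ D := by
  subst hq
  refine hL.exists_decomposition hs (KleinCL.le_of_isLeast_blockingSet hs hδ.2)
    (fun C hC hlt => ?_) hx
  by_contra hB
  exact absurd (hδ.2 ⟨C, hC, hB, rfl⟩) (not_le.2 hlt)
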